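/- Let $T>0$, $H\in(1/2,1)$, $d,K\in\mathbb N$, and let $B=(B_1,\dots,B_d)$ be a $d$-dimensional fractional Brownian motion on $[0,T]$ with Hurst parameter $H$ (independent components, continuous paths) on a probability space $(\Omega,\mathcal F,\mathbb P)$. Put $\phi(s,t)=H(2H-1)|s-t|^{2H-2}$, let $\mathcal H_\phi$ be the space of measurable $f:[0,T]\to\mathbb R$ for which $|f|_\phi^2=\int_0^T\int_0^T f(s)f(t)\phi(s,t)\,ds\,dt$ converges absolutely, with inner product $\langle f,g\rangle_\phi=\int_0^T\int_0^T f(s)g(t)\phi(s,t)\,ds\,dt$, and put $\Phi[f](t)=\int_0^T f(s)\phi(t,s)\,ds$. Let $e_1,\dots,e_K\in\mathcal H_\phi$ be orthonormal with $\xi_k:=\Phi[e_k]$ continuous on $[0,T]$, and let $Z_k^{(i)}=\int_0^T e_k(s)\,dB_i(s)$ be the fractional Wiener integrals, i.e. the $L^2(\mathbb P)$-limits of the elementary integrals of step functions converging to $e_k$ in $|\cdot|_\phi$. Let $\mathbf z$ be the $K\times d$ matrix with entries $\mathbf z_{ki}=Z_k^{(i)}$. Let $b:[0,T]\times\mathbb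 R^d\to\mathbb R^d$ be such that $b,\partial_{x_1}b,\dots,\partial_{x_d}b$ are bounded and continuous, let $\sigma:[0,T]\to\mathbb R^d$ be bounded and continuous, and let $c\in\mathbb R^d$. Let $u:[0,T]\times\mathbb R^{K\times d}\to\mathbb R^d$ be the classical ($C^1$) solution of $$\partial_t u_i=b_i(t,u)+\sigma_i(t)\sum_{k=1}^K\xi_k(t)\left[x_{ki}u_i-\partial_{x_{ki}}u_i\right]\ \text{ on } ]0,T]\times\mathbb R^{K\times d},\qquad u_i(0,\mathbf x)=c_i,\qquad i=1,\dots,d,$$ and let $X^K(t)=u(t,\mathbf z)$, $t\in[0,T]$. Then all the random variables $\partial_{x_{ki}}u_j(t,\mathbf z)$ are integrable; there are measurable functions $g_{ik}^{(j)}:[0,T]\times\mathbb R^d\to\mathbb R$ such that, for every $t\in[0,T]$, $$g_{ik}^{(j)}(t,X^K(t))=\mathbb E\left[\partial_{x_{ki}}u_j(t,\mathbf z)\,\middle|\,\sigma(X^K(t))\right]\quad\text{a.s.};$$ and for every such choice of the $g_{ik}^{(j)}$ the law $\mu^K(t,A)=\mathbb P(X^K(t)\in A)$, $t\in[0,T]$,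 $A\in\mathcal B(\mathbb R^d)$, solves in the sense of distributions the Fokker–Planck equation $$\left(\partial_t+\sum_{i,j=1}^d\sum_{k=1}^K\sigma_i(t)\xi_k(t)x_i\,g_{ik}^{(j)}(t,x)\,\partial^2_{x_ix_j}+\sum_{i=1}^d b_i(t,x)\partial_{x_i}\right)^{*}\mu^K=0,$$ that is, for every compactly supported $C^2$ function $\varphi$ of $(t,x)\in[0,T]\times\mathbb R^d$ (the restriction of a $C^2_c$ function on $\mathbb R\times\mathbb R^d$) with $\varphi(0,\cdot)=\varphi(T,\cdot)=0$, $$\int_0^T\!\int_{\mathbb R^d}\Big[\partial_t\varphi+\sum_{i,j=1}^d\sum_{k=1}^K\sigma_i(t)\xi_k(t)x_i\,g_{ik}^{(j)}(t,x)\,\partial^2_{x_ix_j}\varphi+\sum_{i=1}^d b_i(t,x)\,\partial_{x_i}\varphi\Big]\,\mu^K(t,dx)\,dt=0,$$ the integral being absolutely convergent. -/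

import Mathlib

open MeasureTheory ProbabilityTheory Set Filter Topology

noncomputable section

namespace WongZakaiFBM

/-! ### Fractional Brownian motion and the space `H_φ` -/

/-- `B` is a `d`-dimensional fractional Brownian motion on `[0,T]` with Hurst parameter `H`:
a centred Gaussian process with independent components (for a jointly Gaussian process: the
covariances between different components vanish), the fractional covariance in each component,
and continuous paths. -/
structure IsFractionalBrownianMotion {Ω : Type*} [MeasurableSpace Ω] (P : Measure Ω)
    (T H : ℝ) (d : ℕ) (B : ℝ → Ω → Fin d → ℝ) : Prop where
  gaussian : IsGaussianProcess (fun (q : Fin d × Icc (0 : ℝ) T) ω => B q.2 ω q.1) P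
  centered : ∀ t ∈ Icc (0 : ℝ) T, ∀ i, ∫ ω, B t ω i ∂P = 0
  covariance : ∀ s ∈ Icc (0 : ℝ) T, ∀ t ∈ Icc (0 : ℝ) T, ∀ i j,
    ∫ ω, B t ω i * B s ω j ∂P =
      if i = j then (1 / 2) * (t ^ (2 * H) + s ^ (2 * H) - |t - s| ^ (2 * H)) else 0
  continuous_paths : ∀ᵐ ω ∂P, ContinuousOn (fun t => B t ω) (Icc 0 T)

/-- The kernel `φ(s,t) = H(2H-1)|s-t|^{2H-2}`. -/
def phi (H s t : ℝ) : ℝ := H * (2 * H - 1) * |s - t| ^ (2 * H - 2)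

/-- `f` belongs to `H_φ`: it is measurable on `[0,T]` and the double integral
`∫∫ f(s) f(t) φ(s,t) ds dt` over `[0,T]²` is (absolutely) convergent. -/
def MemHPhi (T H : ℝ) (f : ℝ → ℝ) : Prop :=
  AEStronglyMeasurable f (volume.restrict (Icc 0 T)) ∧
    IntegrableOn (fun p : ℝ × ℝ => f p.1 * f p.2 * phi H p.1 p.2) (Icc 0 T ×ˢ Icc 0 T)

/-- The inner product `⟨f,g⟩_φ = ∫∫ f(s) g(t) φ(s,t) ds dt`. -/
def innerPhi (T H : ℝ) (f g : ℝ → ℝ) : ℝ :=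
  ∫ p in Icc (0 : ℝ) T ×ˢ Icc (0 : ℝ) T, f p.1 * g p.2 * phi H p.1 p.2

/-- The map `Φ[f](t) = ∫_0^T f(s) φ(t,s) ds`. -/
def PhiMap (T H : ℝ) (f : ℝ → ℝ) (t : ℝ) : ℝ := ∫ s in (0 : ℝ)..T, f s * phi H t s

/-- A step function `∑ₘ aₘ χ_{[0,tₘ]}` on `[0,T]`. -/
structure StepFunction (T : ℝ) where
  n : ℕ
  coef : Fin n → ℝ
  time : Fin n → ℝ
  time_mem : ∀ m, time m ∈ Icc (0 : ℝ) T

/-- The value of the step function at `s`. -/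
def StepFunction.toFun {T : ℝ} (F : StepFunction T) (s : ℝ) : ℝ :=
  ∑ m, F.coef m * (Icc (0 : ℝ) (F.time m)).indicator (fun _ => (1 : ℝ)) s

/-- The elementary integral `∑ₘ aₘ β(tₘ)` of a step function against a real process `β`. -/
def StepFunction.integral {T : ℝ} {Ω : Type*} (F : StepFunction T) (β : ℝ → Ω → ℝ) (ω : Ω) : ℝ :=
  ∑ m, F.coef m * β (F.time m) ω

/-- `Y` is (a version of) the fractional Wiener integral `∫_0^T f(s) dβ(s)`, `f ∈ H_φ`: the limit
in `L²(P)` of elementary integrals of step functions that converge to `f` in the norm `|·|_φ`. -/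
structure IsWienerIntegral {Ω : Type*} [MeasurableSpace Ω] (P : Measure Ω) (T H : ℝ)
    (β : ℝ → Ω → ℝ) (f : ℝ → ℝ) (Y : Ω → ℝ) : Prop where
  memHPhi : MemHPhi T H f
  measurable : Measurable Y
  memLp : MemLp Y 2 P
  approx : ∃ F : ℕ → StepFunction T,
    Tendsto (fun n => innerPhi T H (fun s => f s - (F n).toFun s) (fun s => f s - (F n).toFun s))
      atTop (𝓝 0) ∧
    Tendsto (fun n => eLpNorm (fun ω => (F n).integral β ω - Y ω) 2 P) atTop (𝓝 0)

/-! ### Coefficients, the hyperbolic system and the approximation -/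

/-- The assumptions on the coefficients: `b` and its first order partial derivatives in `x` are
bounded and continuous on `[0,T] × ℝ^d`, and `σ` is bounded and continuous on `[0,T]`. -/
structure CoefficientAssumption (T : ℝ) {d : ℕ} (b : ℝ → (Fin d → ℝ) → Fin d → ℝ)
    (σ : ℝ → Fin d → ℝ) : Prop where
  b_continuous : ContinuousOn (fun p : ℝ × (Fin d → ℝ) => b p.1 p.2) (Icc 0 T ×ˢ univ)
  b_bounded : ∃ M : ℝ, ∀ t ∈ Icc (0 : ℝ) T, ∀ x, ‖b t x‖ ≤ M
  b_differentiable : ∀ t ∈ Icc (0 : ℝ) T, Differentiable ℝ (b t)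
  db_continuous :
    ContinuousOn (fun p : ℝ × (Fin d → ℝ) => fderiv ℝ (b p.1) p.2) (Icc 0 T ×ˢ univ)
  db_bounded : ∃ M : ℝ, ∀ t ∈ Icc (0 : ℝ) T, ∀ x, ‖fderiv ℝ (b t) x‖ ≤ M
  σ_continuous : ContinuousOn σ (Icc 0 T)
  σ_bounded : ∃ M : ℝ, ∀ t ∈ Icc (0 : ℝ) T, ‖σ t‖ ≤ M

/-- The partial derivative `∂_{x_{ki}} u_j (t, x)` of `u : [0,T] × ℝ^{K×d} → ℝ^d`. -/
def partialKI {d K : ℕ} (u : ℝ → (Fin K → Fin d → ℝ) → Fin d → ℝ) (k : Fin K) (i j : Fin d)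
    (t : ℝ) (x : Fin K → Fin d → ℝ) : ℝ :=
  fderiv ℝ (fun y => u t y j) x (Pi.single k (Pi.single i 1))

/-- `u` is a classical solution, of class `C¹` on `[0,T] × ℝ^{K×d}`, of the system
`∂_t u_i = b_i(t,u) + σ_i(t) ∑_k ξ_k(t) (x_{ki} u_i - ∂_{x_{ki}} u_i)`, `u_i(0,x) = c_i`. -/
structure IsClassicalSolution (T : ℝ) {d K : ℕ} (b : ℝ → (Fin d → ℝ) → Fin d → ℝ)
    (σ : ℝ → Fin d → ℝ) (ξ : Fin K → ℝ → ℝ) (c : Fin d → ℝ)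
    (u : ℝ → (Fin K → Fin d → ℝ) → Fin d → ℝ) : Prop where
  contDiffOn :
    ContDiffOn ℝ 1 (fun p : ℝ × (Fin K → Fin d → ℝ) => u p.1 p.2) (Icc 0 T ×ˢ univ)
  equation : ∀ t ∈ Ioc (0 : ℝ) T, ∀ x i,
    HasDerivWithinAt (fun s => u s x i)
      (b t (u t x) i + σ t i * ∑ k, ξ k t * (x k i * u t x i - partialKI u k i i t x))
      (Icc 0 T) t
  initial : ∀ x, u 0 x = c

/-- The approximating process `X^K(t) = u(t, z)`, where `z` is the `K × d` matrix with entries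
`z_{ki} = Z_k^{(i)}`. -/
def approxProcess {Ω : Type*} {d K : ℕ} (u : ℝ → (Fin K → Fin d → ℝ) → Fin d → ℝ)
    (Z : Fin K → Fin d → Ω → ℝ) (t : ℝ) (ω : Ω) : Fin d → ℝ :=
  u t (fun k i => Z k i ω)

/-- `g i k j` is a (jointly) measurable function `g_{ik}^{(j)}` of `(t,x)` such that, for every
`t ∈ [0,T]`, `g_{ik}^{(j)}(t, X^K(t)) = E[∂_{x_{ki}} u_j(t, z) | X^K(t)]` almost surely. -/
structure IsCondDerivative {Ω : Type*} [MeasurableSpace Ω] (P : Measure Ω) (T : ℝ) {d K : ℕ}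
    (u : ℝ → (Fin K → Fin d → ℝ) → Fin d → ℝ) (Z : Fin K → Fin d → Ω → ℝ)
    (g : Fin d → Fin K → Fin d → ℝ → (Fin d → ℝ) → ℝ) : Prop where
  measurable : ∀ i k j, Measurable (fun p : ℝ × (Fin d → ℝ) => g i k j p.1 p.2)
  condExp_eq : ∀ i k j, ∀ t ∈ Icc (0 : ℝ) T,
    (fun ω => g i k j t (approxProcess u Z t ω)) =ᵐ[P]
      P[fun ω => partialKI u k i j t (fun l m => Z l m ω) |
        MeasurableSpace.comap (approxProcess u Z t) inferInstance]

/-! ### The Fokker–Planck equation -/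

/-- The partial derivative `∂_{x_i} f (x)` of `f : ℝ^d → ℝ`. -/
def partialX {d : ℕ} (i : Fin d) (f : (Fin d → ℝ) → ℝ) (x : Fin d → ℝ) : ℝ :=
  fderiv ℝ f x (Pi.single i 1)

/-- The operator `∂_t + ∑_{i,j} a_{ij}(t,x) ∂²_{x_i x_j} + ∑_i b_i(t,x) ∂_{x_i}` applied to
`ψ` at `(t,x)`. -/
def parabolicOp {d : ℕ} (a : Fin d → Fin d → ℝ → (Fin d → ℝ) → ℝ)
    (b : ℝ → (Fin d → ℝ) → Fin d → ℝ) (ψ : ℝ → (Fin d → ℝ) → ℝ) (t : ℝ) (x : Fin d → ℝ) : ℝ :=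
  deriv (fun s => ψ s x) t
    + ∑ i, ∑ j, a i j t x * partialX i (partialX j (ψ t)) x
    + ∑ i, b t x i * partialX i (ψ t) x

/-- The family of measures `μ t`, `t ∈ [0,T]`, solves in the sense of distributions
`(∂_t + ∑ a_{ij} ∂²_{x_i x_j} + ∑ b_i ∂_{x_i})^* μ = 0`: for each compactly supported `C²` test
function `ψ` vanishing at `t = 0` and at `t = T`, the integral over `[0,T] × ℝ^d` of the operator
applied to `ψ` against `μ t (dx) dt` converges absolutely and is zero. -/
def SolvesFokkerPlanck (T : ℝ) {d : ℕ} (a : Fin d → Fin d → ℝ → (Fin d → ℝ) → ℝ)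
    (b : ℝ → (Fin d → ℝ) → Fin d → ℝ) (μ : ℝ → Measure (Fin d → ℝ)) : Prop :=
  ∀ ψ : ℝ → (Fin d → ℝ) → ℝ,
    ContDiff ℝ 2 (fun p : ℝ × (Fin d → ℝ) => ψ p.1 p.2) →
    HasCompactSupport (fun p : ℝ × (Fin d → ℝ) => ψ p.1 p.2) →
    (∀ x, ψ 0 x = 0) → (∀ x, ψ T x = 0) →
      (∀ t ∈ Icc (0 : ℝ) T, Integrable (parabolicOp a b ψ t) (μ t)) ∧
      IntegrableOn (fun t => ∫ x, |parabolicOp a b ψ t x| ∂(μ t)) (Icc 0 T) ∧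
      IntegrableOn (fun t => ∫ x, parabolicOp a b ψ t x ∂(μ t)) (Icc 0 T) ∧
      ∫ t in (0 : ℝ)..T, ∫ x, parabolicOp a b ψ t x ∂(μ t) = 0

end WongZakaiFBM

end

/-! For a test function `ψ` and a fixed outcome, `t ↦ ψ(t, X(t))` is continuously differentiable on
`[0,T]` and vanishes at both ends, so its derivative integrates to zero in time. By the system, this
derivative is the drift part plus the sum of `σ_i ξ_k (z_{ki} u_i - ∂_{ki} u_i) ∂_i ψ(t,u)` over `i`
and `k`. The entries of `z` are independent standard Gaussians, so `E[z_{ki} F(z)] = E[∂_{ki} F(z)]`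
for `F = u_i ∂_i ψ(t,u)`. The product rule yields `∂_i ψ ∂_{ki} u_i`, which cancels the subtracted
term, and `∑_j u_i ∂_i ∂_j ψ ∂_{ki} u_j`. In the latter everything except `∂_{ki} u_j` is a function
of `X(t)`, so that factor may be replaced by its conditional expectation. This is
`IsModel.integral_totalTime_eq`; Fubini then gives the equation.

Three ingredients support this computation.

Gaussianity of `z` (`map_wienerIntegrals_eq_gaussianPi`): the kernel `φ` is a positive mixture of
products of indicators of windows, hence positive semidefinite, so Cauchy–Schwarz holds in `H_φ` and
its inner product passes to limits. On step functions this inner product is the covariance of the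
elementary integrals. The Wiener integrals are therefore `L²` limits of jointly Gaussian variables,
with limiting covariance the identity by orthonormality.

Growth of the solution (`IsClassicalSolution.exists_partialKI_le`): equation `i` differentiates
`u_i` only in the column `x_{·i}`, with a velocity depending on time alone. Along its
characteristics it becomes an ordinary differential equation whose linear coefficient is of order
`‖x‖`. Gronwall bounds `u` exponentially. A weighted maximum over a cone of dependence bounds the
increments of `u`, hence its gradient, again exponentially. Gaussian vectors integrate such
functions, which justifies every exchange of integrals.

Existence of `g` (`exists_measurable_condExp`): disintegrating the laws of `(X(t), ∂_{ki} u_j(t,z))`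
as a kernel in `t` gives conditional expectations jointly measurable in `(t,x)`. -/

noncomputable section

namespace WongZakaiFBM

/-! ### Positive semidefiniteness of mixtures of rank one kernels. -/

section PositiveDefiniteKernel

variable {α β : Type*} [MeasurableSpace α] [MeasurableSpace β] {μ : Measure α} {ν : Measure β}
  [SFinite μ] [SFinite ν] {k : α → α → ℝ} {q : α → β → ℝ}

/-- The kernel `k` is a superposition of the rank one kernels `q(s,y) q(t,y)`. -/
structure IsMixture (μ : Measure α) (ν : Measure β) (k : α → α → ℝ) (q : α → β → ℝ) : Prop where
  measurable : Measurable (Function.uncurry q)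
  nonneg : ∀ s y, 0 ≤ q s y
  kernel_nonneg : ∀ s t, 0 ≤ k s t
  eq : ∀ᵐ p ∂(μ.prod μ), ENNReal.ofReal (k p.1 p.2)
    = ∫⁻ y, ENNReal.ofReal (q p.1 y) * ENNReal.ofReal (q p.2 y) ∂ν

/-- Tonelli: for fixed `y` the integrand separates in the two variables. All factors of the kernel
are nonnegative, so absolute values fall on `f` and `g` alone. -/
lemma IsMixture.lintegral_eq (h : IsMixture μ ν k q) {f g : α → ℝ}
    (hf : AEStronglyMeasurable f μ) (hg : AEStronglyMeasurable g μ) :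
    ∫⁻ p, ‖f p.1 * g p.2 * k p.1 p.2‖ₑ ∂(μ.prod μ) =
      ∫⁻ y, (∫⁻ s, ‖f s‖ₑ * ENNReal.ofReal (q s y) ∂μ)
        * (∫⁻ s, ‖g s‖ₑ * ENNReal.ofReal (q s y) ∂μ) ∂ν := by
  have hq := h.measurable
  have hq1 : Measurable (fun x : (α × α) × β => q x.1.1 x.2) :=
    hq.comp ((measurable_fst.comp measurable_fst).prodMk measurable_snd)
  have hq2 : Measurable (fun x : (α × α) × β => q x.1.2 x.2) :=
    hq.comp ((measurable_snd.comp measurable_fst).prodMk measurable_snd)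
  have hqy : ∀ y, Measurable (fun s => q s y) := fun y =>
    hq.comp (measurable_id.prodMk measurable_const)
  have hf1 : AEMeasurable (fun p : α × α => ‖f p.1‖ₑ) (μ.prod μ) := hf.comp_fst.enorm
  have hg1 : AEMeasurable (fun p : α × α => ‖g p.2‖ₑ) (μ.prod μ) := hg.comp_snd.enorm
  calc ∫⁻ p, ‖f p.1 * g p.2 * k p.1 p.2‖ₑ ∂(μ.prod μ)
      = ∫⁻ p, ∫⁻ y, (‖f p.1‖ₑ * ENNReal.ofReal (q p.1 y)) *
          (‖g p.2‖ₑ * ENNReal.ofReal (q p.2 y)) ∂ν ∂(μ.prod μ) := by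
        refine lintegral_congr_ae ?_
        filter_upwards [h.eq] with p hp
        rw [enorm_mul, enorm_mul, Real.enorm_of_nonneg (h.kernel_nonneg _ _), hp,
          ← lintegral_const_mul]
        · refine lintegral_congr fun y => ?_
          ring
        · exact ((hq.comp (measurable_const.prodMk measurable_id)).ennreal_ofReal).mul
            ((hq.comp (measurable_const.prodMk measurable_id)).ennreal_ofReal)
    _ = ∫⁻ y, ∫⁻ p, (‖f p.1‖ₑ * ENNReal.ofReal (q p.1 y)) *
          (‖g p.2‖ₑ * ENNReal.ofReal (q p.2 y)) ∂(μ.prod μ) ∂ν := by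
        refine lintegral_lintegral_swap ?_
        exact ((hf1.comp_fst).mul hq1.ennreal_ofReal.aemeasurable).mul
          ((hg1.comp_fst).mul hq2.ennreal_ofReal.aemeasurable)
    _ = _ := by
        refine lintegral_congr fun y => ?_
        exact lintegral_prod_mul (hf.enorm.mul (hqy y).ennreal_ofReal.aemeasurable)
          (hg.enorm.mul (hqy y).ennreal_ofReal.aemeasurable)

/-- Cauchy–Schwarz in `L²(ν)` for `y ↦ ∫ |f| q(·,y)` and `y ↦ ∫ |g| q(·,y)`: their squared norms are
the absolute double integrals of the two diagonal forms, which are finite. -/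
lemma IsMixture.integrable_mul (h : IsMixture μ ν k q) (hk : Measurable (Function.uncurry k))
    {f g : α → ℝ}
    (hf : AEStronglyMeasurable f μ) (hg : AEStronglyMeasurable g μ)
    (hff : Integrable (fun p : α × α => f p.1 * f p.2 * k p.1 p.2) (μ.prod μ))
    (hgg : Integrable (fun p : α × α => g p.1 * g p.2 * k p.1 p.2) (μ.prod μ)) :
    Integrable (fun p : α × α => f p.1 * g p.2 * k p.1 p.2) (μ.prod μ) := by
  have hm : ∀ {f : α → ℝ}, AEStronglyMeasurable f μ →
      AEMeasurable (fun y => ∫⁻ s, ‖f s‖ₑ * ENNReal.ofReal (q s y) ∂μ) ν := by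
    intro f hf
    have : AEMeasurable (fun p : α × β => ‖f p.1‖ₑ * ENNReal.ofReal (q p.1 p.2)) (μ.prod ν) :=
      (hf.enorm.comp_fst).mul h.measurable.ennreal_ofReal.aemeasurable
    exact this.lintegral_prod_left'
  refine ⟨(hf.comp_fst.mul hg.comp_snd).mul hk.aestronglyMeasurable, ?_⟩
  have h1 := hff.2
  have h2 := hgg.2
  rw [HasFiniteIntegral, h.lintegral_eq hf hf] at h1
  rw [HasFiniteIntegral, h.lintegral_eq hg hg] at h2
  rw [HasFiniteIntegral, h.lintegral_eq hf hg]
  refine lt_of_le_of_lt (ENNReal.lintegral_mul_le_Lp_mul_Lq ν Real.HolderConjugate.two_two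
    (hm hf) (hm hg)) ?_
  refine ENNReal.mul_lt_top ?_ ?_ <;>
  · refine ENNReal.rpow_lt_top_of_nonneg (by norm_num) (ne_of_lt ?_)
    simpa [pow_two] using by assumption

/-- After Fubini the quadratic form is `∫ (∫ f(s) q(s,y) dμ)² dν`. Fubini applies because
integrating the absolute value over `y` first returns `|f f k|`. -/
lemma IsMixture.integral_nonneg (h : IsMixture μ ν k q)
    {f : α → ℝ} (hf : AEStronglyMeasurable f μ)
    (hff : Integrable (fun p : α × α => f p.1 * f p.2 * k p.1 p.2) (μ.prod μ)) :
    0 ≤ ∫ p, f p.1 * f p.2 * k p.1 p.2 ∂(μ.prod μ) := by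
  have hq := h.measurable
  have hq1 : Measurable (fun x : (α × α) × β => q x.1.1 x.2) :=
    hq.comp ((measurable_fst.comp measurable_fst).prodMk measurable_snd)
  have hq2 : Measurable (fun x : (α × α) × β => q x.1.2 x.2) :=
    hq.comp ((measurable_snd.comp measurable_fst).prodMk measurable_snd)
  have hqs : ∀ s, Measurable (fun y => q s y) := fun y =>
    hq.comp (measurable_const.prodMk measurable_id)
  have hE : ∀ᵐ p ∂(μ.prod μ), ∫⁻ y, ‖f p.1 * q p.1 y * (f p.2 * q p.2 y)‖ₑ ∂ν
      = ‖f p.1 * f p.2 * k p.1 p.2‖ₑ := by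
    filter_upwards [h.eq] with p hp
    rw [enorm_mul, enorm_mul (f p.1), Real.enorm_of_nonneg (h.kernel_nonneg _ _), hp,
      ← lintegral_const_mul]
    · refine lintegral_congr fun y => ?_
      simp only [enorm_mul, Real.enorm_of_nonneg (h.nonneg _ _)]
      ring
    · exact ((hqs _).ennreal_ofReal).mul (hqs _).ennreal_ofReal
  have hI : Integrable (Function.uncurry fun (p : α × α) (y : β) =>
      f p.1 * q p.1 y * (f p.2 * q p.2 y)) ((μ.prod μ).prod ν) := by
    have hmeas : AEStronglyMeasurable (Function.uncurry fun (p : α × α) (y : β) =>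
        f p.1 * q p.1 y * (f p.2 * q p.2 y)) ((μ.prod μ).prod ν) :=
      ((hf.comp_fst.comp_fst).mul hq1.aestronglyMeasurable).mul
        ((hf.comp_snd.comp_fst).mul hq2.aestronglyMeasurable)
    refine ⟨hmeas, ?_⟩
    rw [HasFiniteIntegral, lintegral_prod _ hmeas.enorm]
    simp only [Function.uncurry]
    rw [lintegral_congr_ae hE]
    exact hff.2
  have hk : ∀ᵐ p ∂(μ.prod μ), f p.1 * f p.2 * k p.1 p.2
      = ∫ y, f p.1 * q p.1 y * (f p.2 * q p.2 y) ∂ν := by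
    filter_upwards [h.eq] with p hp
    have : k p.1 p.2 = ∫ y, q p.1 y * q p.2 y ∂ν := by
      rw [integral_eq_lintegral_of_nonneg_ae
        (Eventually.of_forall fun y => mul_nonneg (h.nonneg _ _) (h.nonneg _ _))
        ((hqs _).mul (hqs _)).aestronglyMeasurable]
      simp only [ENNReal.ofReal_mul (h.nonneg _ _)]
      rw [← hp, ENNReal.toReal_ofReal (h.kernel_nonneg _ _)]
    rw [this, ← integral_const_mul]
    refine integral_congr_ae (Eventually.of_forall fun y => ?_)
    simp only
    ring
  rw [integral_congr_ae hk, integral_integral_swap hI]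
  refine MeasureTheory.integral_nonneg fun y => ?_
  have := integral_prod_mul (μ := μ) (ν := μ) (fun s => f s * q s y) (fun s => f s * q s y)
  simp only [Pi.zero_apply]
  rw [this]
  exact mul_self_nonneg _

end PositiveDefiniteKernel

/-! ### The fractional kernel as a mixture of windows. -/

section FractionalKernel

/-- Writes a negative power as a superposition of the tents `(r - x)₊`; `ENNReal.ofReal` takes the
positive part, so only `r > x` contributes. -/
lemma lintegral_tent_rpow {a x : ℝ} (ha : 0 < a) (hx : 0 < x) :
    ∫⁻ r in Ioi (0 : ℝ), ENNReal.ofReal (r ^ (-a - 2)) * ENNReal.ofReal (r - x)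
      = ENNReal.ofReal (x ^ (-a) / (a * (a + 1))) := by
  have h1 : IntegrableOn (fun r : ℝ => r ^ (-a - 1)) (Ioi x) :=
    integrableOn_Ioi_rpow_of_lt (by linarith) hx
  have h2 : IntegrableOn (fun r : ℝ => r ^ (-a - 2)) (Ioi x) :=
    integrableOn_Ioi_rpow_of_lt (by linarith) hx
  have e : Ioi (0 : ℝ) = Ioc 0 x ∪ Ioi x := (Ioc_union_Ioi_eq_Ioi hx.le).symm
  rw [e, lintegral_union measurableSet_Ioi (by
    rw [Set.disjoint_left]; rintro y hy hy'; exact absurd hy.2 (not_le.2 hy'))]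
  have z : ∫⁻ r in Ioc (0 : ℝ) x, ENNReal.ofReal (r ^ (-a - 2)) * ENNReal.ofReal (r - x) = 0 := by
    rw [setLIntegral_congr_fun (g := fun _ => 0) measurableSet_Ioc]
    · simp
    · intro r hr
      simp [ENNReal.ofReal_of_nonpos (sub_nonpos.2 hr.2)]
  rw [z, zero_add]
  have e2 : ∀ r ∈ Ioi x, ENNReal.ofReal (r ^ (-a - 2)) * ENNReal.ofReal (r - x)
      = ENNReal.ofReal (r ^ (-a - 1) - x * r ^ (-a - 2)) := by
    intro r hr
    have hr0 : 0 < r := hx.trans hr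
    rw [← ENNReal.ofReal_mul (Real.rpow_nonneg hr0.le _)]
    congr 1
    have : r ^ (-a - 1) = r ^ (-a - 2) * r := by
      rw [← Real.rpow_add_one hr0.ne']; congr 1; ring
    rw [this]; ring
  have h3 : IntegrableOn (fun r : ℝ => r ^ (-a - 1) - x * r ^ (-a - 2)) (Ioi x) :=
    h1.sub (h2.const_mul x)
  rw [setLIntegral_congr_fun measurableSet_Ioi e2, ← ofReal_integral_eq_lintegral_ofReal h3]
  · congr 1
    rw [integral_sub h1 (h2.const_mul x), integral_const_mul,
      integral_Ioi_rpow_of_lt (by linarith) hx, integral_Ioi_rpow_of_lt (by linarith) hx]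
    have e3 : x ^ (-a - 2 + 1) = x ^ (-a) / x := by
      rw [← Real.rpow_sub_one hx.ne']; congr 1; ring
    have e4 : -a - 1 + 1 = -a := by ring
    have : -a - 2 + 1 ≠ 0 := by linarith
    rw [e3, e4]
    field_simp
    have : (1 + a) ≠ 0 := by positivity
    rw [show -a - 2 + 1 = -(1 + a) by ring]
    field_simp
    ring
  · filter_upwards [ae_restrict_mem measurableSet_Ioi] with r hr
    have hr0 : 0 < r := hx.trans hr
    have : r ^ (-a - 1) = r ^ (-a - 2) * r := by
      rw [← Real.rpow_add_one hr0.ne']; congr 1; ring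
    simp only [Pi.zero_apply]
    rw [this, show r ^ (-a - 2) * r - x * r ^ (-a - 2) = r ^ (-a - 2) * (r - x) by ring]
    exact mul_nonneg (Real.rpow_nonneg hr0.le _) (sub_nonneg.2 (le_of_lt hr))

/-- Two windows of length `r` ending at `s` and `t` overlap in length `(r - |s - t|)₊`. -/
lemma lintegral_indicator_window (s t r : ℝ) :
    ∫⁻ a : ℝ, ENNReal.ofReal ((Icc (s - r) s).indicator (fun _ => (1 : ℝ)) a) *
      ENNReal.ofReal ((Icc (t - r) t).indicator (fun _ => (1 : ℝ)) a)
      = ENNReal.ofReal (r - |s - t|) := by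
  have : ∀ a, ENNReal.ofReal ((Icc (s - r) s).indicator (fun _ => (1 : ℝ)) a) *
      ENNReal.ofReal ((Icc (t - r) t).indicator (fun _ => (1 : ℝ)) a)
      = (Icc (s - r) s ∩ Icc (t - r) t).indicator (fun _ => (1 : ENNReal)) a := by
    intro a
    by_cases h1 : a ∈ Icc (s - r) s <;> by_cases h2 : a ∈ Icc (t - r) t <;>
      simp only [indicator, h1, h2, mem_inter_iff] <;> simp
  simp only [this]
  rw [lintegral_indicator (measurableSet_Icc.inter measurableSet_Icc), setLIntegral_one,
    Icc_inter_Icc, Real.volume_Icc]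
  congr 1
  rcases le_total s t with h | h
  · rw [abs_of_nonpos (by linarith), sup_eq_right.2 (by linarith), inf_eq_left.2 h]; ring
  · rw [abs_of_nonneg (by linarith), sup_eq_left.2 (by linarith), inf_eq_right.2 h]; ring

lemma phi_nonneg {H : ℝ} (hH : H ∈ Ioo (1 / 2 : ℝ) 1) (s t : ℝ) : 0 ≤ phi H s t := by
  have := hH.1
  have := hH.2
  unfold phi
  have := Real.rpow_nonneg (abs_nonneg (s - t)) (2 * H - 2)
  have : 0 ≤ H * (2 * H - 1) := mul_nonneg (by linarith) (by linarith)
  positivity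

lemma measurable_phi (H : ℝ) : Measurable (Function.uncurry (phi H)) := by
  unfold phi Function.uncurry
  fun_prop

/-- Window overlaps produce tents in `|s - t|`, and tents of all lengths `r` produce the power `|s -
t|^(-a)` with `a = 2 - 2H`. The density contains `a (a + 1)` to cancel the denominator in
`lintegral_tent_rpow`. -/
lemma isMixture_phi {H : ℝ} (hH : H ∈ Ioo (1 / 2 : ℝ) 1) (μ : Measure ℝ) [SFinite μ]
    [NullSingletonClass μ] :
    IsMixture μ
      ((volume : Measure ℝ).prod ((volume.restrict (Ioi 0)).withDensity
        (fun r => ENNReal.ofReal (H * (2 * H - 1) * ((2 - 2 * H) * (2 - 2 * H + 1))) *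
          ENNReal.ofReal (r ^ (-(2 - 2 * H) - 2)))))
      (phi H) (fun s y => (Icc (s - y.2) s).indicator (fun _ => (1 : ℝ)) y.1) := by
  have h1 := hH.1
  have h2 := hH.2
  have hmq : Measurable (Function.uncurry fun (s : ℝ) (y : ℝ × ℝ) =>
      (Icc (s - y.2) s).indicator (fun _ => (1 : ℝ)) y.1) := by
    have : (Function.uncurry fun (s : ℝ) (y : ℝ × ℝ) =>
        (Icc (s - y.2) s).indicator (fun _ => (1 : ℝ)) y.1)
        = {x : ℝ × ℝ × ℝ | x.1 - x.2.2 ≤ x.2.1 ∧ x.2.1 ≤ x.1}.indicator (fun _ => (1 : ℝ)) := by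
      funext x
      simp [Function.uncurry, indicator]
    rw [this]
    refine measurable_const.indicator (MeasurableSet.inter ?_ ?_)
    · exact measurableSet_le (measurable_fst.sub (measurable_snd.comp measurable_snd))
        (measurable_fst.comp measurable_snd)
    · exact measurableSet_le (measurable_fst.comp measurable_snd) measurable_fst
  refine ⟨hmq, fun s y => indicator_nonneg (fun _ _ => zero_le_one) _, phi_nonneg hH, ?_⟩
  -- The identity fails on the diagonal, where the mixture is infinite and `phi` is a real number;
  -- the diagonal is null because `μ` has no atoms.
  have hne : ∀ᵐ p ∂(μ.prod μ), p.1 ≠ p.2 := by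
    have hm : MeasurableSet {p : ℝ × ℝ | p.1 ≠ p.2} :=
      (measurableSet_eq_fun measurable_fst measurable_snd).compl
    rw [Measure.ae_prod_iff_ae_ae hm]
    refine Eventually.of_forall fun x => ?_
    have : ∀ᵐ y ∂μ, y ≠ x := by simp [ae_iff]
    filter_upwards [this] with y hy using hy.symm
  filter_upwards [hne] with p hp
  have hx : 0 < |p.1 - p.2| := abs_pos.2 (sub_ne_zero.2 hp)
  have hms : ∀ s : ℝ, Measurable fun y : ℝ × ℝ =>
      ENNReal.ofReal ((Icc (s - y.2) s).indicator (fun _ => (1 : ℝ)) y.1) := fun s =>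
    (hmq.comp (measurable_const.prodMk measurable_id)).ennreal_ofReal
  have hmm : AEMeasurable (fun y : ℝ × ℝ =>
      ENNReal.ofReal ((Icc (p.1 - y.2) p.1).indicator (fun _ => (1 : ℝ)) y.1) *
        ENNReal.ofReal ((Icc (p.2 - y.2) p.2).indicator (fun _ => (1 : ℝ)) y.1))
      ((volume : Measure ℝ).prod ((volume.restrict (Ioi 0)).withDensity
        (fun r => ENNReal.ofReal (H * (2 * H - 1) * ((2 - 2 * H) * (2 - 2 * H + 1))) *
          ENNReal.ofReal (r ^ (-(2 - 2 * H) - 2))))) :=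
    ((hms _).mul (hms _)).aemeasurable
  rw [lintegral_prod_symm _ hmm]
  simp only [lintegral_indicator_window]
  rw [lintegral_withDensity_eq_lintegral_mul _ (by fun_prop) (by fun_prop)]
  simp only [Pi.mul_apply, mul_assoc]
  rw [lintegral_const_mul _ (by fun_prop), lintegral_tent_rpow (by linarith) hx,
    ← ENNReal.ofReal_mul (by
      have : 0 ≤ H * (2 * H - 1) := mul_nonneg (by linarith) (by linarith)
      have : 0 ≤ (2 - 2 * H) * (2 - 2 * H + 1) := mul_nonneg (by linarith) (by linarith)
      rw [← mul_assoc]; positivity)]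
  congr 1
  unfold phi
  rw [show -(2 - 2 * H) = 2 * H - 2 by ring]
  have : (2 - 2 * H) ≠ 0 := by linarith
  have : (2 - 2 * H + 1) ≠ 0 := by linarith
  field_simp

end FractionalKernel

/-! ### The semi-inner product of `H_φ`. -/

section InnerProduct

variable {T H : ℝ} {f g : ℝ → ℝ}

lemma restrict_square (T : ℝ) : (volume : Measure (ℝ × ℝ)).restrict (Icc 0 T ×ˢ Icc 0 T)
    = (volume.restrict (Icc 0 T)).prod (volume.restrict (Icc 0 T)) := by
  rw [Measure.prod_restrict]; rfl

lemma MemHPhi.integrable_mul (hH : H ∈ Ioo (1 / 2 : ℝ) 1) (hf : MemHPhi T H f)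
    (hg : MemHPhi T H g) :
    IntegrableOn (fun p : ℝ × ℝ => f p.1 * g p.2 * phi H p.1 p.2) (Icc 0 T ×ˢ Icc 0 T) := by
  have h1 := hf.2
  have h2 := hg.2
  rw [IntegrableOn, restrict_square] at *
  exact (isMixture_phi hH (volume.restrict (Icc 0 T))).integrable_mul (measurable_phi H)
    hf.1 hg.1 h1 h2

lemma innerPhi_self_nonneg (hH : H ∈ Ioo (1 / 2 : ℝ) 1) (hf : MemHPhi T H f) :
    0 ≤ innerPhi T H f f := by
  have h1 := hf.2
  rw [innerPhi]
  rw [IntegrableOn] at h1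
  rw [restrict_square] at *
  exact (isMixture_phi hH (volume.restrict (Icc 0 T))).integral_nonneg hf.1 h1

lemma phi_comm (H s t : ℝ) : phi H s t = phi H t s := by
  rw [phi, phi, abs_sub_comm]

lemma innerPhi_comm (T H : ℝ) (f g : ℝ → ℝ) : innerPhi T H f g = innerPhi T H g f := by
  rw [innerPhi, innerPhi, restrict_square, ← integral_prod_swap]
  refine integral_congr_ae (Eventually.of_forall fun p => ?_)
  simp only [Prod.fst_swap, Prod.snd_swap]
  rw [phi_comm]; ring

lemma MemHPhi.add (hH : H ∈ Ioo (1 / 2 : ℝ) 1) (hf : MemHPhi T H f) (hg : MemHPhi T H g) :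
    MemHPhi T H (fun s => f s + g s) := by
  refine ⟨hf.1.add hg.1, ?_⟩
  refine (((hf.2.add (hf.integrable_mul hH hg)).add (hg.integrable_mul hH hf)).add hg.2).congr
    (Eventually.of_forall fun p => ?_)
  simp only [Pi.add_apply]; ring

lemma MemHPhi.const_mul (c : ℝ) (hf : MemHPhi T H f) : MemHPhi T H (fun s => c * f s) := by
  refine ⟨hf.1.const_mul c, (hf.2.const_mul (c * c)).congr (Eventually.of_forall fun p => ?_)⟩
  simp only; ring

lemma MemHPhi.sub (hH : H ∈ Ioo (1 / 2 : ℝ) 1) (hf : MemHPhi T H f) (hg : MemHPhi T H g) :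
    MemHPhi T H (fun s => f s - g s) := by
  simpa [sub_eq_add_neg] using hf.add hH (hg.const_mul (-1))

lemma memHPhi_zero : MemHPhi T H (fun _ => 0) := by
  refine ⟨aestronglyMeasurable_const, ?_⟩
  simp

lemma MemHPhi.finset_sum (hH : H ∈ Ioo (1 / 2 : ℝ) 1) {ι : Type*} (s : Finset ι)
    {F : ι → ℝ → ℝ} (h : ∀ i ∈ s, MemHPhi T H (F i)) : MemHPhi T H (fun x => ∑ i ∈ s, F i x) := by
  classical
  induction s using Finset.induction_on with
  | empty => simpa using memHPhi_zero
  | insert a s ha ih =>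
    simp only [Finset.sum_insert ha]
    exact (h a (by simp)).add hH (ih fun i hi => h i (by simp [hi]))

lemma innerPhi_add_left (hH : H ∈ Ioo (1 / 2 : ℝ) 1) {f' : ℝ → ℝ} (hf : MemHPhi T H f)
    (hf' : MemHPhi T H f') (hg : MemHPhi T H g) :
    innerPhi T H (fun s => f s + f' s) g = innerPhi T H f g + innerPhi T H f' g := by
  rw [innerPhi, innerPhi, innerPhi,
    ← integral_add (hf.integrable_mul hH hg) (hf'.integrable_mul hH hg)]
  refine integral_congr_ae (Eventually.of_forall fun p => ?_)
  simp only; ring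

lemma innerPhi_const_mul_left (c : ℝ) (f g : ℝ → ℝ) :
    innerPhi T H (fun s => c * f s) g = c * innerPhi T H f g := by
  rw [innerPhi, innerPhi, ← integral_const_mul]
  refine integral_congr_ae (Eventually.of_forall fun p => ?_)
  simp only; ring

lemma innerPhi_sub_left (hH : H ∈ Ioo (1 / 2 : ℝ) 1) {f' : ℝ → ℝ} (hf : MemHPhi T H f)
    (hf' : MemHPhi T H f') (hg : MemHPhi T H g) :
    innerPhi T H (fun s => f s - f' s) g = innerPhi T H f g - innerPhi T H f' g := by
  have := innerPhi_add_left hH hf (hf'.const_mul (-1)) hg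
  rw [innerPhi_const_mul_left] at this
  simpa [sub_eq_add_neg] using this

lemma innerPhi_sum_left (hH : H ∈ Ioo (1 / 2 : ℝ) 1) {ι : Type*} (s : Finset ι)
    {F : ι → ℝ → ℝ} (h : ∀ i ∈ s, MemHPhi T H (F i)) (hg : MemHPhi T H g) :
    innerPhi T H (fun x => ∑ i ∈ s, F i x) g = ∑ i ∈ s, innerPhi T H (F i) g := by
  classical
  induction s using Finset.induction_on with
  | empty => simp [innerPhi]
  | insert a s ha ih =>
    simp only [Finset.sum_insert ha]
    rw [innerPhi_add_left hH (h a (by simp))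
      (MemHPhi.finset_sum hH s fun i hi => h i (by simp [hi])) hg,
      ih fun i hi => h i (by simp [hi])]

/-- The Cauchy–Schwarz inequality in `H_φ`. -/
lemma innerPhi_sq_le (hH : H ∈ Ioo (1 / 2 : ℝ) 1) (hf : MemHPhi T H f) (hg : MemHPhi T H g) :
    innerPhi T H f g ^ 2 ≤ innerPhi T H f f * innerPhi T H g g := by
  -- This quadratic in `x` is the squared seminorm of `x f + g`, so its discriminant is not
  -- positive.
  have key : ∀ x : ℝ, 0 ≤ innerPhi T H f f * (x * x) + 2 * innerPhi T H f g * x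
      + innerPhi T H g g := by
    intro x
    have h1 := innerPhi_self_nonneg hH ((hf.const_mul x).add hH hg)
    rw [innerPhi_add_left hH (hf.const_mul x) hg ((hf.const_mul x).add hH hg),
      innerPhi_comm _ _ (fun s => x * f s), innerPhi_comm _ _ g,
      innerPhi_add_left hH (hf.const_mul x) hg (hf.const_mul x),
      innerPhi_add_left hH (hf.const_mul x) hg hg, innerPhi_comm _ _ g,
      innerPhi_const_mul_left, innerPhi_const_mul_left,
      innerPhi_comm _ _ f (fun s => x * f s), innerPhi_const_mul_left] at h1
    linarith
  have := discrim_le_zero key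
  rw [discrim] at this
  nlinarith

/-- Continuity of the inner product of `H_φ`. -/
lemma tendsto_innerPhi (hH : H ∈ Ioo (1 / 2 : ℝ) 1) (hf : MemHPhi T H f) (hg : MemHPhi T H g)
    {F G : ℕ → ℝ → ℝ} (hF : ∀ n, MemHPhi T H (F n)) (hG : ∀ n, MemHPhi T H (G n))
    (hFf : Tendsto (fun n => innerPhi T H (fun s => f s - F n s) (fun s => f s - F n s))
      atTop (𝓝 0))
    (hGg : Tendsto (fun n => innerPhi T H (fun s => g s - G n s) (fun s => g s - G n s))
      atTop (𝓝 0)) :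
    Tendsto (fun n => innerPhi T H (F n) (G n)) atTop (𝓝 (innerPhi T H f g)) := by
  have small : ∀ {a : ℕ → ℝ} {b : ℕ → ℝ}, Tendsto b atTop (𝓝 0) → (∀ n, a n ^ 2 ≤ b n) →
      Tendsto a atTop (𝓝 0) := by
    intro a b hb hab
    have : Tendsto (fun n => √(b n)) atTop (𝓝 0) := by
      simpa [Function.comp_def] using (Real.continuous_sqrt.tendsto 0).comp hb
    exact squeeze_zero_norm (fun n => Real.abs_le_sqrt (hab n)) this
  have t1 : Tendsto (fun n => innerPhi T H (fun s => f s - F n s) g) atTop (𝓝 0) :=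
    small (by simpa using hFf.mul_const (innerPhi T H g g))
      fun n => innerPhi_sq_le hH (hf.sub hH (hF n)) hg
  have t2 : Tendsto (fun n => innerPhi T H (fun s => g s - G n s) f) atTop (𝓝 0) :=
    small (by simpa using hGg.mul_const (innerPhi T H f f))
      fun n => innerPhi_sq_le hH (hg.sub hH (hG n)) hf
  have t3 : Tendsto (fun n => innerPhi T H (fun s => f s - F n s) (fun s => g s - G n s))
      atTop (𝓝 0) :=
    small (by simpa using hFf.mul hGg)
      fun n => innerPhi_sq_le hH (hf.sub hH (hF n)) (hg.sub hH (hG n))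
  -- Uses `⟨F,G⟩ = ⟨f-F, g-G⟩ - ⟨f-F, g⟩ - ⟨g-G, f⟩ + ⟨f,g⟩`; the first three terms tend to zero by
  -- Cauchy–Schwarz.
  have t := ((t3.sub t1).sub t2).add_const (innerPhi T H f g)
  simp only [sub_self, zero_add] at t
  refine t.congr fun n => ?_
  rw [innerPhi_sub_left hH hf (hF n) (hg.sub hH (hG n)), innerPhi_comm _ _ f,
    innerPhi_comm _ _ (F n), innerPhi_sub_left hH hg (hG n) hf,
    innerPhi_sub_left hH hg (hG n) (hF n), innerPhi_sub_left hH hf (hF n) hg,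
    innerPhi_comm _ _ g f, innerPhi_comm _ _ g (F n), innerPhi_comm _ _ (G n) (F n)]
  ring

end InnerProduct

/-! ### The inner product of indicators is the fractional covariance. -/

section Covariance

lemma intervalIntegrable_abs_sub_rpow {p a t : ℝ} (hp : -1 < p) :
    IntervalIntegrable (fun b => |a - b| ^ p) volume 0 t := by
  have h0 : ∀ c : ℝ, 0 ≤ c → IntervalIntegrable (fun x : ℝ => |x| ^ p) volume 0 c := by
    intro c hc
    refine (intervalIntegral.intervalIntegrable_rpow' hp (a := 0) (b := c)).congr ?_
    intro x hx
    rw [uIoc_of_le hc] at hx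
    simp [abs_of_pos hx.1]
  have h1 : ∀ c : ℝ, IntervalIntegrable (fun x : ℝ => |x| ^ p) volume 0 c := by
    intro c
    rcases le_total 0 c with hc | hc
    · exact h0 c hc
    · simpa using (h0 (-c) (by linarith)).comp_sub_left 0
  have h2 : IntervalIntegrable (fun x : ℝ => |x| ^ p) volume (a - 0) (a - t) :=
    (h1 _).symm.trans (h1 _)
  simpa using h2.comp_sub_left a

lemma integral_abs_sub_rpow {p a t : ℝ} (hp : -1 < p) (ha : 0 ≤ a) (hat : a ≤ t) :
    ∫ b in (0 : ℝ)..t, |a - b| ^ p = (a ^ (p + 1) + (t - a) ^ (p + 1)) / (p + 1) := by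
  have hp1 : p + 1 ≠ 0 := by linarith
  have I := fun a t => intervalIntegrable_abs_sub_rpow (a := a) (t := t) hp
  rw [← intervalIntegral.integral_add_adjacent_intervals (I a a) ((I a a).symm.trans (I a t))]
  have e1 : ∫ b in (0 : ℝ)..a, |a - b| ^ p = a ^ (p + 1) / (p + 1) := by
    rw [intervalIntegral.integral_congr (g := fun b => (a - b) ^ p)]
    · rw [intervalIntegral.integral_comp_sub_left (fun x => x ^ p) a, integral_rpow (Or.inl hp)]
      simp [Real.zero_rpow hp1]
    · intro b hb
      rw [uIcc_of_le ha] at hb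
      simp only
      rw [abs_of_nonneg (by linarith [hb.2])]
  have e2 : ∫ b in a..t, |a - b| ^ p = (t - a) ^ (p + 1) / (p + 1) := by
    rw [intervalIntegral.integral_congr (g := fun b => (b - a) ^ p)]
    · rw [intervalIntegral.integral_comp_sub_right (fun x => x ^ p) a, integral_rpow (Or.inl hp)]
      simp [Real.zero_rpow hp1]
    · intro b hb
      rw [uIcc_of_le hat] at hb
      simp only
      rw [abs_sub_comm, abs_of_nonneg (by linarith [hb.1])]
  rw [e1, e2, add_div]

lemma integral_phi {H a t : ℝ} (hH : H ∈ Ioo (1 / 2 : ℝ) 1) (ha : 0 ≤ a) (hat : a ≤ t) :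
    ∫ b in (0 : ℝ)..t, phi H a b = H * (a ^ (2 * H - 1) + (t - a) ^ (2 * H - 1)) := by
  have h1 := hH.1
  unfold phi
  rw [intervalIntegral.integral_const_mul, integral_abs_sub_rpow (by linarith) ha hat]
  rw [show 2 * H - 2 + 1 = 2 * H - 1 by ring]
  have : 2 * H - 1 ≠ 0 := by linarith
  rw [mul_assoc, mul_div_cancel₀ _ this]

lemma integrableOn_phi {T H : ℝ} (hT : 0 ≤ T) (hH : H ∈ Ioo (1 / 2 : ℝ) 1) :
    Integrable (fun p : ℝ × ℝ => phi H p.1 p.2)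
      ((volume.restrict (Icc 0 T)).prod (volume.restrict (Icc 0 T))) := by
  have h1 := hH.1
  refine (integrable_prod_iff (f := Function.uncurry (phi H))
    (measurable_phi H).aestronglyMeasurable).2 ?_
  constructor
  · refine Eventually.of_forall fun a => ?_
    have := (intervalIntegrable_abs_sub_rpow (p := 2 * H - 2) (a := a) (t := T)
      (by linarith)).const_mul (H * (2 * H - 1))
    rw [intervalIntegrable_iff_integrableOn_Icc_of_le hT] at this
    exact this
  · have hc : ContinuousOn (fun a => H * (a ^ (2 * H - 1) + (T - a) ^ (2 * H - 1))) (Icc 0 T) := by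
      refine continuousOn_const.mul (ContinuousOn.add ?_ ?_)
      · exact continuousOn_id.rpow_const fun x _ => Or.inr (by linarith)
      · exact (continuousOn_const.sub continuousOn_id).rpow_const fun x _ => Or.inr (by linarith)
    refine (hc.integrableOn_Icc).congr ?_
    filter_upwards [ae_restrict_mem measurableSet_Icc] with a ha
    rw [← integral_phi hH ha.1 ha.2, intervalIntegral.integral_of_le hT,
      ← integral_Icc_eq_integral_Ioc]
    refine integral_congr_ae (Eventually.of_forall fun b => ?_)
    simp [abs_of_nonneg (phi_nonneg hH a b)]

lemma memHPhi_indicator {T H t : ℝ} (hT : 0 ≤ T) (hH : H ∈ Ioo (1 / 2 : ℝ) 1) :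
    MemHPhi T H ((Icc (0 : ℝ) t).indicator (fun _ => (1 : ℝ))) := by
  have hm : Measurable ((Icc (0 : ℝ) t).indicator (fun _ => (1 : ℝ))) :=
    measurable_const.indicator measurableSet_Icc
  refine ⟨hm.aestronglyMeasurable, ?_⟩
  rw [IntegrableOn, restrict_square]
  refine (integrableOn_phi hT hH).mono (((hm.comp measurable_fst).mul
    (hm.comp measurable_snd)).mul (measurable_phi H)).aestronglyMeasurable
    (Eventually.of_forall fun p => ?_)
  rw [norm_mul, norm_mul]
  have : ∀ x, ‖(Icc (0 : ℝ) t).indicator (fun _ => (1 : ℝ)) x‖ ≤ 1 := fun x => by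
    by_cases h : x ∈ Icc 0 t <;> simp [h]
  calc _ ≤ 1 * 1 * ‖phi H p.1 p.2‖ := by gcongr <;> exact this _
    _ = _ := by ring

/-- Integrating `φ(a,·)` over `[0,t]` gives `H (a^(2H-1) + (t-a)^(2H-1))` for every `a ≤ s`, since
`s ≤ t` keeps the singularity inside `[0,t]`. A second integration over `[0,s]` gives the
covariance. -/
lemma innerPhi_indicator_of_le {T H s t : ℝ} (hH : H ∈ Ioo (1 / 2 : ℝ) 1)
    (hs : 0 ≤ s) (hst : s ≤ t) (ht : t ≤ T) :
    innerPhi T H ((Icc (0 : ℝ) s).indicator (fun _ => (1 : ℝ)))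
      ((Icc (0 : ℝ) t).indicator (fun _ => (1 : ℝ)))
      = (1 / 2) * (t ^ (2 * H) + s ^ (2 * H) - (t - s) ^ (2 * H)) := by
  have h1 := hH.1
  have hT : 0 ≤ T := by linarith
  have hI := (memHPhi_indicator (t := s) hT hH).integrable_mul hH
    (memHPhi_indicator (t := t) hT hH)
  rw [IntegrableOn, restrict_square] at hI
  rw [innerPhi, restrict_square, integral_prod _ hI]
  have e1 : ∀ a ∈ Icc (0 : ℝ) T, ∫ b in Icc (0 : ℝ) T, (Icc (0 : ℝ) s).indicator (fun _ => (1 : ℝ)) a *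
      (Icc (0 : ℝ) t).indicator (fun _ => (1 : ℝ)) b * phi H a b
      = (Icc (0 : ℝ) s).indicator (fun a => H * (a ^ (2 * H - 1) + (t - a) ^ (2 * H - 1))) a := by
    intro a ha
    by_cases has : a ∈ Icc 0 s
    · simp only [has, indicator_of_mem, one_mul]
      rw [← integral_phi hH has.1 (has.2.trans hst), intervalIntegral.integral_of_le (hs.trans hst),
        ← integral_Icc_eq_integral_Ioc]
      have : ∀ b, (Icc (0 : ℝ) t).indicator (fun _ => (1 : ℝ)) b * phi H a b
          = (Icc (0 : ℝ) t).indicator (fun b => phi H a b) b := by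
        intro b; by_cases hb : b ∈ Icc 0 t <;> simp [hb]
      simp only [this]
      rw [setIntegral_indicator measurableSet_Icc,
        inter_eq_self_of_subset_right (Icc_subset_Icc_right ht)]
    · simp [has]
  rw [setIntegral_congr_fun measurableSet_Icc e1, setIntegral_indicator measurableSet_Icc,
    inter_eq_self_of_subset_right (Icc_subset_Icc_right (hst.trans ht)),
    integral_Icc_eq_integral_Ioc, ← intervalIntegral.integral_of_le hs,
    intervalIntegral.integral_const_mul]
  have i1 : IntervalIntegrable (fun a : ℝ => a ^ (2 * H - 1)) volume 0 s :=
    intervalIntegral.intervalIntegrable_rpow' (by linarith)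
  have i2 : IntervalIntegrable (fun a : ℝ => (t - a) ^ (2 * H - 1)) volume 0 s := by
    have := (intervalIntegral.intervalIntegrable_rpow' (r := 2 * H - 1) (by linarith)
      (a := t) (b := t - s)).comp_sub_left t
    simpa using this
  rw [intervalIntegral.integral_add i1 i2,
    intervalIntegral.integral_comp_sub_left (fun x => x ^ (2 * H - 1)) t,
    integral_rpow (Or.inl (by linarith)), integral_rpow (Or.inl (by linarith))]
  have : 2 * H ≠ 0 := by linarith
  rw [show 2 * H - 1 + 1 = 2 * H by ring, Real.zero_rpow this, sub_zero, sub_zero]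
  field_simp
  ring

lemma innerPhi_indicator {T H s t : ℝ} (hH : H ∈ Ioo (1 / 2 : ℝ) 1)
    (hs : s ∈ Icc 0 T) (ht : t ∈ Icc 0 T) :
    innerPhi T H ((Icc (0 : ℝ) s).indicator (fun _ => (1 : ℝ)))
      ((Icc (0 : ℝ) t).indicator (fun _ => (1 : ℝ)))
      = (1 / 2) * (t ^ (2 * H) + s ^ (2 * H) - |t - s| ^ (2 * H)) := by
  rcases le_total s t with h | h
  · rw [innerPhi_indicator_of_le hH hs.1 h ht.2, abs_of_nonneg (by linarith)]
  · rw [innerPhi_comm, innerPhi_indicator_of_le hH ht.1 h hs.2, abs_sub_comm,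
      abs_of_nonneg (by linarith)]
    ring

lemma StepFunction.memHPhi {T H : ℝ} (hT : 0 ≤ T) (hH : H ∈ Ioo (1 / 2 : ℝ) 1)
    (F : StepFunction T) : MemHPhi T H F.toFun :=
  MemHPhi.finset_sum hH Finset.univ fun _ _ => (memHPhi_indicator hT hH).const_mul _

/-- The right side is the covariance form of one fractional Brownian component, which makes
elementary integration an isometry. -/
lemma StepFunction.innerPhi_eq {T H : ℝ} (hT : 0 ≤ T) (hH : H ∈ Ioo (1 / 2 : ℝ) 1)
    (F G : StepFunction T) :
    innerPhi T H F.toFun G.toFun = ∑ m, ∑ l, F.coef m * G.coef l *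
      ((1 / 2) * (F.time m ^ (2 * H) + G.time l ^ (2 * H)
        - |F.time m - G.time l| ^ (2 * H))) := by
  have hI := fun t : ℝ => memHPhi_indicator (t := t) hT hH
  have e1 := innerPhi_sum_left hH Finset.univ
    (fun m (_ : m ∈ Finset.univ) => (hI (F.time m)).const_mul (F.coef m)) (G.memHPhi hT hH)
  refine e1.trans (Finset.sum_congr rfl fun m _ => ?_)
  rw [innerPhi_const_mul_left, innerPhi_comm]
  have e2 := innerPhi_sum_left hH Finset.univ
    (fun m (_ : m ∈ Finset.univ) => (hI (G.time m)).const_mul (G.coef m)) (hI (F.time m))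
  refine (congrArg _ e2).trans ?_
  rw [Finset.mul_sum]
  refine Finset.sum_congr rfl fun l _ => ?_
  rw [innerPhi_const_mul_left, innerPhi_indicator hH (G.time_mem l) (F.time_mem m)]
  ring

end Covariance

/-! ### Characteristic functions of `L²` limits of Gaussian variables. -/

section GaussianLimit

variable {Ω : Type*} [MeasurableSpace Ω] {P : Measure Ω} [IsProbabilityMeasure P]

/-- The characteristic function at `1` of an `L²`-limit of centred Gaussian variables. -/
lemma integral_cexp_of_tendsto_gaussian {Y : Ω → ℝ} {Yn : ℕ → Ω → ℝ} {v : ℝ}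
    (hY : AEStronglyMeasurable Y P)
    (hG : ∀ n, HasGaussianLaw (Yn n) P) (hm : ∀ n, ∫ ω, Yn n ω ∂P = 0)
    (hv : Tendsto (fun n => ∫ ω, Yn n ω ^ 2 ∂P) atTop (𝓝 v))
    (hL : Tendsto (fun n => eLpNorm (fun ω => Yn n ω - Y ω) 2 P) atTop (𝓝 0)) :
    ∫ ω, Complex.exp (Y ω * Complex.I) ∂P = Complex.exp (-v / 2) := by
  have hnm : ∀ n, AEStronglyMeasurable (Yn n) P := fun n => (hG n).aemeasurable.aestronglyMeasurable
  have e : ∀ n, ∫ ω, Complex.exp (Yn n ω * Complex.I) ∂P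
      = Complex.exp (-(∫ ω, Yn n ω ^ 2 ∂P : ℝ) / 2) := by
    intro n
    have h := (hG n).charFun_map_eq 1
    rw [charFun_apply_real, integral_map (hG n).aemeasurable (by fun_prop)] at h
    simp only [Complex.ofReal_one, one_mul, RCLike.inner_apply, map_one, mul_one, hm n] at h
    rw [h, variance_of_integral_eq_zero (hG n).aemeasurable (hm n)]
    congr 1
    push_cast
    ring
  have t1 : Tendsto (fun n => ∫ ω, Complex.exp (Yn n ω * Complex.I) ∂P) atTop
      (𝓝 (Complex.exp (-v / 2))) := by
    simp only [e]
    have hc : Continuous fun x : ℝ => Complex.exp (-(x : ℂ) / 2) := by fun_prop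
    exact (hc.tendsto v).comp hv
  have t2 : Tendsto (fun n => ∫ ω, Complex.exp (Yn n ω * Complex.I) ∂P) atTop
      (𝓝 (∫ ω, Complex.exp (Y ω * Complex.I) ∂P)) := by
    have hc : Continuous fun x : ℝ => Complex.exp (x * Complex.I) := by fun_prop
    refine tendsto_integral_of_L1 _ (hc.comp_aestronglyMeasurable hY)
      (Eventually.of_forall fun n => ?_) ?_
    · refine Integrable.of_bound (C := 1) (hc.comp_aestronglyMeasurable (hnm n))
        (Eventually.of_forall fun ω => ?_)
      rw [Complex.norm_exp_ofReal_mul_I]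
    · refine tendsto_of_tendsto_of_tendsto_of_le_of_le tendsto_const_nhds hL
        (fun _ => zero_le) fun n => ?_
      refine le_trans ?_ (eLpNorm_le_eLpNorm_of_exponent_le (p := 1) (q := 2) (by norm_num)
        ((hnm n).sub hY))
      rw [eLpNorm_one_eq_lintegral_enorm]
      refine lintegral_mono fun ω => ?_
      -- Factoring out a number of modulus one reduces `|e^{ix} - e^{iy}| ≤ |x - y|` to the bound
      -- for `|e^{ih} - 1|`.
      have : Complex.exp (Yn n ω * Complex.I) - Complex.exp (Y ω * Complex.I)
          = Complex.exp (Y ω * Complex.I) *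
            (Complex.exp (Complex.I * ((Yn n ω - Y ω : ℝ) : ℂ)) - 1) := by
        rw [mul_sub, ← Complex.exp_add, mul_one]
        congr 2
        push_cast
        ring
      rw [this, enorm_mul, ← ofReal_norm, Complex.norm_exp_ofReal_mul_I, ENNReal.ofReal_one,
        one_mul]
      exact Real.enorm_exp_I_mul_ofReal_sub_one_le
  exact tendsto_nhds_unique t2 t1

end GaussianLimit

/-! ### Standard Gaussian measures and integration by parts. -/

section Gaussian

/-- Gaussian integration by parts on the line. -/
lemma integral_mul_gaussianReal {f f' : ℝ → ℝ} (hf : ∀ x, HasDerivAt f (f' x) x)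
    (h0 : Integrable f (gaussianReal 0 1)) (h1 : Integrable f' (gaussianReal 0 1))
    (h2 : Integrable (fun x => x * f x) (gaussianReal 0 1)) :
    ∫ x, x * f x ∂(gaussianReal 0 1) = ∫ x, f' x ∂(gaussianReal 0 1) := by
  have hint : ∀ {g : ℝ → ℝ}, Integrable g (gaussianReal 0 1) →
      Integrable (fun x => gaussianPDFReal 0 1 x * g x) := by
    intro g hg
    rw [gaussianReal_of_var_ne_zero _ one_ne_zero,
      integrable_withDensity_iff_integrable_smul' (measurable_gaussianPDF _ _)
        (Eventually.of_forall fun x => gaussianPDF_lt_top)] at hg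
    simpa [toReal_gaussianPDF] using hg
  have hp : ∀ x, HasDerivAt (gaussianPDFReal 0 1) (-x * gaussianPDFReal 0 1 x) x := by
    intro x
    have : HasDerivAt (fun x : ℝ => -(x - 0) ^ 2 / (2 * ((1 : NNReal) : ℝ))) (-x) x := by
      have := (((hasDerivAt_id x).sub_const 0).pow 2).neg.div_const (2 * ((1 : NNReal) : ℝ))
      refine this.congr_deriv ?_
      simp
      ring
    refine (this.exp.const_mul (√(2 * Real.pi * ((1 : NNReal) : ℝ)))⁻¹).congr_deriv ?_
    rw [gaussianPDFReal]
    ring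
  have hd : ∀ x, HasDerivAt (fun x => gaussianPDFReal 0 1 x * f x)
      (gaussianPDFReal 0 1 x * f' x - gaussianPDFReal 0 1 x * (x * f x)) x := by
    intro x
    refine ((hp x).mul (hf x)).congr_deriv ?_
    ring
  -- The density satisfies `p' = -x p`, so `(p f)' = p f' - p x f`. Integrability of `p f` and of
  -- its derivative suffices; no decay at infinity has to be shown.
  have h := integral_eq_zero_of_hasDerivAt_of_integrable hd ((hint h1).sub (hint h2)) (hint h0)
  rw [integral_sub (hint h1) (hint h2)] at h
  rw [integral_gaussianReal_eq_integral_smul one_ne_zero,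
    integral_gaussianReal_eq_integral_smul one_ne_zero]
  simp only [smul_eq_mul]
  linarith

variable {ι : Type*} [Fintype ι]

/-- The standard Gaussian measure on `ℝ^ι`. -/
abbrev gaussianPi (ι : Type*) [Fintype ι] : Measure (ι → ℝ) :=
  Measure.pi fun _ => gaussianReal 0 1

/-- The sup norm is at most the sum of the `|x i|`, so the integrand is dominated by a product of
one-dimensional exponential moments. -/
lemma integrable_exp_mul_norm_gaussianPi {C : ℝ} (hC : 0 ≤ C) :
    Integrable (fun x : ι → ℝ => Real.exp (C * ‖x‖)) (gaussianPi ι) := by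
  have h1 : Integrable (fun x : ℝ => Real.exp (C * |x|)) (gaussianReal 0 1) :=
    integrable_exp_mul_abs (integrable_exp_mul_gaussianReal C) (integrable_exp_mul_gaussianReal (-C))
  have h2 : Integrable (fun x : ι → ℝ => ∏ i, Real.exp (C * |x i|)) (gaussianPi ι) :=
    Integrable.fintype_prod fun _ => h1
  refine h2.mono (by fun_prop) (Eventually.of_forall fun x => ?_)
  rw [← Real.exp_sum, Real.norm_of_nonneg (Real.exp_pos _).le,
    Real.norm_of_nonneg (Real.exp_pos _).le, ← Finset.mul_sum]
  gcongr
  refine (pi_norm_le_iff_of_nonneg (Finset.sum_nonneg fun i _ => abs_nonneg _)).2 fun i => ?_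
  exact Finset.single_le_sum (f := fun i => |x i|) (fun i _ => abs_nonneg _) (Finset.mem_univ i)

variable [DecidableEq ι]

/-- Resampling one coordinate independently preserves the product law. One coordinate can thus be
integrated out first without splitting the index set. -/
lemma measurePreserving_update (i : ι) :
    MeasurePreserving (fun p : (ι → ℝ) × ℝ => Function.update p.1 i p.2)
      ((gaussianPi ι).prod (gaussianReal 0 1)) (gaussianPi ι) := by
  have hm : Measurable (fun p : (ι → ℝ) × ℝ => Function.update p.1 i p.2) := by
    refine measurable_pi_lambda _ fun j => ?_
    by_cases h : j = i
    · subst h; simpa using measurable_snd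
    · simpa [Function.update_of_ne h, Function.comp_def] using
        (measurable_pi_apply j).comp (measurable_fst (α := ι → ℝ) (β := ℝ))
  refine ⟨hm, (Measure.pi_eq fun s hs => ?_).symm⟩
  rw [Measure.map_apply hm (MeasurableSet.univ_pi hs)]
  have : (fun p : (ι → ℝ) × ℝ => Function.update p.1 i p.2) ⁻¹' (univ.pi s)
      = (univ.pi (Function.update s i univ)) ×ˢ (s i) := by
    ext p
    simp only [mem_preimage, Set.mem_pi, mem_univ, true_implies, mem_prod]
    constructor
    · intro h
      refine ⟨fun j => ?_, by simpa using h i⟩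
      by_cases hj : j = i
      · subst hj; simp
      · simpa [Function.update_of_ne hj] using h j
    · rintro ⟨h1, h2⟩ j
      by_cases hj : j = i
      · subst hj; simpa using h2
      · simpa [Function.update_of_ne hj] using h1 j
  rw [this, Measure.prod_prod, Measure.pi_pi,
    ← Finset.mul_prod_erase _ _ (Finset.mem_univ i), ← Finset.mul_prod_erase _ (fun j => _) (Finset.mem_univ i)]
  simp only [Function.update_self, measure_univ, one_mul]
  rw [mul_comm]
  congr 1
  refine Finset.prod_congr rfl fun j hj => ?_
  rw [Function.update_of_ne (Finset.ne_of_mem_erase hj)]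

/-- Gaussian integration by parts. -/
lemma integral_mul_gaussianPi (i : ι) {F F' : (ι → ℝ) → ℝ}
    (hF : ∀ x y, HasDerivAt (fun y => F (Function.update x i y)) (F' (Function.update x i y)) y)
    (h0 : Integrable F (gaussianPi ι)) (h1 : Integrable F' (gaussianPi ι))
    (h2 : Integrable (fun x => x i * F x) (gaussianPi ι)) :
    ∫ x, x i * F x ∂(gaussianPi ι) = ∫ x, F' x ∂(gaussianPi ι) := by
  have hmp := measurePreserving_update i
  have e : ∀ {G : (ι → ℝ) → ℝ}, Integrable G (gaussianPi ι) →
      ∫ x, G x ∂(gaussianPi ι) =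
        ∫ x, ∫ y, G (Function.update x i y) ∂(gaussianReal 0 1) ∂(gaussianPi ι) ∧
      ∀ᵐ x ∂(gaussianPi ι), Integrable (fun y => G (Function.update x i y)) (gaussianReal 0 1) := by
    intro G hG
    have hG' := hmp.integrable_comp_of_integrable hG
    refine ⟨?_, hG'.prod_right_ae⟩
    conv_lhs => rw [← hmp.map_eq]
    rw [integral_map hmp.measurable.aemeasurable (by rw [hmp.map_eq]; exact hG.1)]
    exact integral_prod _ hG'
  rw [(e h2).1, (e h1).1]
  refine integral_congr_ae ?_
  filter_upwards [(e h0).2, (e h1).2, (e h2).2] with x a0 a1 a2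
  simp only [Function.update_self] at a2 ⊢
  exact integral_mul_gaussianReal (hF x) a0 a1 a2

end Gaussian

/-! ### The joint law of the fractional Wiener integrals. -/

section WienerIntegrals

variable {Ω : Type*} [MeasurableSpace Ω] {P : Measure Ω} {T H : ℝ} {d : ℕ}
  {B : ℝ → Ω → Fin d → ℝ}

lemma IsFractionalBrownianMotion.memLp (hB : IsFractionalBrownianMotion P T H d B)
    {t : ℝ} (ht : t ∈ Icc 0 T) (i : Fin d) : MemLp (fun ω => B t ω i) 2 P :=
  (hB.gaussian.hasGaussianLaw_eval (i, ⟨t, ht⟩)).memLp_two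

lemma IsFractionalBrownianMotion.memLp_integral (hB : IsFractionalBrownianMotion P T H d B)
    (F : StepFunction T) (i : Fin d) : MemLp (F.integral fun t ω => B t ω i) 2 P :=
  memLp_finsetSum _ fun m _ => (hB.memLp (F.time_mem m) i).const_mul (F.coef m)

/-- The isometry property of elementary fractional Wiener integrals. -/
lemma IsFractionalBrownianMotion.integral_mul (hB : IsFractionalBrownianMotion P T H d B)
    (hT : 0 ≤ T) (hH : H ∈ Ioo (1 / 2 : ℝ) 1) (F G : StepFunction T) (i j : Fin d) :
    ∫ ω, F.integral (fun t ω => B t ω i) ω * G.integral (fun t ω => B t ω j) ω ∂P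
      = if i = j then innerPhi T H F.toFun G.toFun else 0 := by
  have hI : ∀ m l, Integrable (fun ω => F.coef m * G.coef l *
      (B (F.time m) ω i * B (G.time l) ω j)) P := fun m l =>
    ((hB.memLp (F.time_mem m) i).integrable_mul (hB.memLp (G.time_mem l) j)).const_mul _
  have e : ∀ ω, F.integral (fun t ω => B t ω i) ω * G.integral (fun t ω => B t ω j) ω
      = ∑ m, ∑ l, F.coef m * G.coef l * (B (F.time m) ω i * B (G.time l) ω j) := by
    intro ω
    rw [StepFunction.integral, StepFunction.integral, Finset.sum_mul_sum]
    refine Finset.sum_congr rfl fun m _ => Finset.sum_congr rfl fun l _ => ?_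
    ring
  simp only [e]
  rw [integral_finsetSum _ fun m _ => integrable_finsetSum _ fun l _ => hI m l]
  have e2 : ∀ m, ∫ ω, ∑ l, F.coef m * G.coef l * (B (F.time m) ω i * B (G.time l) ω j) ∂P
      = ∑ l, F.coef m * G.coef l * (if i = j then (1 / 2) * (F.time m ^ (2 * H)
        + G.time l ^ (2 * H) - |F.time m - G.time l| ^ (2 * H)) else 0) := by
    intro m
    rw [integral_finsetSum _ fun l _ => hI m l]
    refine Finset.sum_congr rfl fun l _ => ?_
    rw [integral_const_mul, hB.covariance _ (G.time_mem l) _ (F.time_mem m)]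
  simp only [e2]
  split_ifs
  · rw [F.innerPhi_eq hT hH]
  · simp

lemma IsFractionalBrownianMotion.integral_eq_zero (hB : IsFractionalBrownianMotion P T H d B)
    (F : StepFunction T) (i : Fin d) :
    ∫ ω, F.integral (fun t ω => B t ω i) ω ∂P = 0 := by
  have := hB.gaussian.isProbabilityMeasure
  simp only [StepFunction.integral]
  rw [integral_finsetSum _ fun m _ =>
    ((hB.memLp (F.time_mem m) i).integrable (by norm_num)).const_mul _]
  refine Finset.sum_eq_zero fun m _ => ?_
  rw [integral_const_mul, hB.centered _ (F.time_mem m), mul_zero]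

/-- The sum is a linear image of the finite vector of all values of `B` occurring in it, indexed by
the pairs of a summand and one of its step times. Joint Gaussianity across components is what is
used. -/
lemma IsFractionalBrownianMotion.hasGaussianLaw_sum (hB : IsFractionalBrownianMotion P T H d B)
    {ι : Type*} [Fintype ι] (θ : ι → ℝ) (F : ι → StepFunction T) (i : ι → Fin d) :
    HasGaussianLaw (fun ω => ∑ q, θ q * (F q).integral (fun t ω => B t ω (i q)) ω) P := by
  classical
  have h := hB.gaussian.comp_right
    (fun r : (Σ q : ι, Fin (F q).n) => (i r.1, ⟨(F r.1).time r.2, (F r.1).time_mem r.2⟩))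
  have h2 := (h.hasGaussianLaw Finset.univ).map
    (∑ r : (Σ q : ι, Fin (F q).n), (θ r.1 * (F r.1).coef r.2) •
      ContinuousLinearMap.proj (R := ℝ)
        (φ := fun _ : (Finset.univ : Finset (Σ q : ι, Fin (F q).n)) => ℝ)
        (Subtype.mk r (Finset.mem_univ r)))
  refine h2.congr (Eventually.of_forall fun ω => ?_)
  simp [StepFunction.integral, Finset.mul_sum, Fintype.sum_sigma, mul_assoc]

/-- Fractional Wiener integrals of an orthonormal family of `H_φ` against independent
components are independent standard Gaussian variables. -/
lemma map_wienerIntegrals_eq_gaussianPi [IsProbabilityMeasure P] {K : ℕ}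
    (hT : 0 ≤ T) (hH : H ∈ Ioo (1 / 2 : ℝ) 1) (hB : IsFractionalBrownianMotion P T H d B)
    {e : Fin K → ℝ → ℝ}
    (he : ∀ k l, innerPhi T H (e k) (e l) = if k = l then 1 else 0)
    {Z : Fin K → Fin d → Ω → ℝ}
    (hZ : ∀ k i, IsWienerIntegral P T H (fun t ω => B t ω i) (e k) (Z k i)) :
    P.map (fun ω (q : Fin K × Fin d) => Z q.1 q.2 ω) = gaussianPi (Fin K × Fin d) := by
  classical
  choose F hF hFZ using fun k i => (hZ k i).approx
  have hZm : Measurable (fun ω (q : Fin K × Fin d) => Z q.1 q.2 ω) :=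
    measurable_pi_lambda _ fun q => (hZ q.1 q.2).measurable
  have := Measure.isProbabilityMeasure_map (μ := P) hZm.aemeasurable
  -- It suffices to test one linear form `∑ θ_q x_q` at a time; this determines the joint law,
  -- independence included.
  refine Measure.ext_of_charFunDual ?_
  ext L
  set θ : Fin K × Fin d → ℝ := fun q => L (Pi.single q 1) with hθ
  have hL : ∀ x, L x = ∑ q, θ q * x q := by
    intro x
    conv_lhs => rw [pi_eq_sum_univ' x]
    rw [map_sum]
    refine Finset.sum_congr rfl fun q _ => ?_
    rw [map_smul, smul_eq_mul, mul_comm]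
  have hR : charFunDual (gaussianPi (Fin K × Fin d)) L
      = Complex.exp (-(∑ q, θ q ^ 2 : ℝ) / 2) := by
    rw [charFunDual_pi]
    simp only [charFunDual_eq_charFun_map_one]
    have : ∀ q, (gaussianReal 0 1).map (L.comp (.single ℝ (fun _ => ℝ) q))
        = gaussianReal 0 (Real.toNNReal (θ q ^ 2)) := by
      intro q
      have h := gaussianReal_map_const_mul (μ := 0) (v := 1) (θ q)
      rw [mul_zero, mul_one] at h
      rw [Real.toNNReal_of_nonneg (sq_nonneg _)]
      refine Eq.trans ?_ h
      congr 1
      funext x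
      simp [hL, Pi.single_apply]
    simp only [this, charFun_gaussianReal]
    rw [← Complex.exp_sum]
    congr 1
    push_cast
    rw [neg_div, Finset.sum_div, ← Finset.sum_neg_distrib]
    refine Finset.sum_congr rfl fun q _ => ?_
    simp [Real.coe_toNNReal _ (sq_nonneg (θ q))]
  rw [hR, charFunDual_apply, integral_map hZm.aemeasurable
    (by fun_prop)]
  simp only [hL]
  refine integral_cexp_of_tendsto_gaussian
    (Yn := fun n ω => ∑ q : Fin K × Fin d, θ q * (F q.1 q.2 n).integral (fun t ω => B t ω q.2) ω)
    ?_ (fun n => hB.hasGaussianLaw_sum θ _ _) (fun n => ?_) ?_ ?_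
  · exact (Finset.measurable_fun_sum _ fun q _ =>
      ((hZ q.1 q.2).measurable).const_mul (θ q)).aestronglyMeasurable
  · rw [integral_finsetSum _ fun q _ =>
      ((hB.memLp_integral _ q.2).integrable (by norm_num)).const_mul _]
    refine Finset.sum_eq_zero fun q _ => ?_
    rw [integral_const_mul, hB.integral_eq_zero, mul_zero]
  · have hI : ∀ n (q r : Fin K × Fin d), Integrable (fun ω => θ q * θ r *
        ((F q.1 q.2 n).integral (fun t ω => B t ω q.2) ω *
          (F r.1 r.2 n).integral (fun t ω => B t ω r.2) ω)) P := fun n q r =>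
      ((hB.memLp_integral _ q.2).integrable_mul (hB.memLp_integral _ r.2)).const_mul _
    have e1 : ∀ n, ∫ ω, (∑ q : Fin K × Fin d,
          θ q * (F q.1 q.2 n).integral (fun t ω => B t ω q.2) ω) ^ 2 ∂P
        = ∑ q : Fin K × Fin d, ∑ r : Fin K × Fin d, θ q * θ r *
          (if q.2 = r.2 then innerPhi T H (F q.1 q.2 n).toFun (F r.1 r.2 n).toFun else 0) := by
      intro n
      have : ∀ ω, (∑ q : Fin K × Fin d,
          θ q * (F q.1 q.2 n).integral (fun t ω => B t ω q.2) ω) ^ 2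
          = ∑ q : Fin K × Fin d, ∑ r : Fin K × Fin d, θ q * θ r *
        ((F q.1 q.2 n).integral (fun t ω => B t ω q.2) ω *
          (F r.1 r.2 n).integral (fun t ω => B t ω r.2) ω) := by
        intro ω
        rw [sq, Finset.sum_mul_sum]
        refine Finset.sum_congr rfl fun q _ => Finset.sum_congr rfl fun r _ => ?_
        ring
      simp only [this]
      rw [integral_finsetSum _ fun q _ => integrable_finsetSum _ fun r _ => hI n q r]
      refine Finset.sum_congr rfl fun q _ => ?_
      rw [integral_finsetSum _ fun r _ => hI n q r]
      refine Finset.sum_congr rfl fun r _ => ?_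
      rw [integral_const_mul, hB.integral_mul hT hH]
    simp only [e1]
    -- The limiting variance: distinct components of `B` are uncorrelated and the `e k` are
    -- orthonormal, so only the diagonal survives.
    have e2 : ∑ q, θ q ^ 2 = ∑ q : Fin K × Fin d, ∑ r : Fin K × Fin d, θ q * θ r *
          (if q.2 = r.2 then innerPhi T H (e q.1) (e r.1) else 0) := by
      refine Finset.sum_congr rfl fun q _ => ?_
      rw [Finset.sum_eq_single q]
      · simp [he, sq]
      · intro r _ hr
        by_cases h2 : q.2 = r.2
        · have h1 : q.1 ≠ r.1 := fun h1 => hr (Prod.ext h1.symm h2.symm)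
          simp [he, h1]
        · simp [h2]
      · simp
    rw [e2]
    refine tendsto_finsetSum _ fun q _ => tendsto_finsetSum _ fun r _ => ?_
    refine Tendsto.const_mul _ ?_
    split_ifs
    · exact tendsto_innerPhi hH (hZ q.1 q.2).memHPhi (hZ r.1 r.2).memHPhi
        (fun n => (F q.1 q.2 n).memHPhi hT hH) (fun n => (F r.1 r.2 n).memHPhi hT hH)
        (hF q.1 q.2) (hF r.1 r.2)
    · exact tendsto_const_nhds
  · have hmeas : ∀ n (q : Fin K × Fin d), AEStronglyMeasurable (fun ω => θ q *
        ((F q.1 q.2 n).integral (fun t ω => B t ω q.2) ω - Z q.1 q.2 ω)) P := fun n q =>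
      ((hB.memLp_integral _ q.2).1.sub (hZ q.1 q.2).measurable.aestronglyMeasurable).const_mul _
    have t : Tendsto (fun n => ∑ q : Fin K × Fin d, ‖θ q‖ₑ * eLpNorm (fun ω =>
        (F q.1 q.2 n).integral (fun t ω => B t ω q.2) ω - Z q.1 q.2 ω) 2 P) atTop (𝓝 0) := by
      rw [show (0 : ENNReal) = ∑ q : Fin K × Fin d, ‖θ q‖ₑ * 0 by simp]
      exact tendsto_finsetSum _ fun q _ =>
        ENNReal.Tendsto.const_mul (hFZ q.1 q.2) (Or.inr enorm_ne_top)
    refine tendsto_of_tendsto_of_tendsto_of_le_of_le tendsto_const_nhds t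
        (fun _ => zero_le) fun n => ?_
    have e3 : (fun ω => ∑ q : Fin K × Fin d, θ q *
        (F q.1 q.2 n).integral (fun t ω => B t ω q.2) ω - ∑ q, θ q * Z q.1 q.2 ω)
        = ∑ q : Fin K × Fin d, fun ω => θ q *
        ((F q.1 q.2 n).integral (fun t ω => B t ω q.2) ω - Z q.1 q.2 ω) := by
      funext ω
      simp [Finset.sum_apply, mul_sub, Finset.sum_sub_distrib]
    rw [e3]
    refine (eLpNorm_sum_le (fun q _ => hmeas n q) (by norm_num)).trans ?_
    refine Finset.sum_le_sum fun q _ => ?_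
    exact (eLpNorm_const_smul (θ q) (fun ω => (F q.1 q.2 n).integral (fun t ω => B t ω q.2) ω - Z q.1 q.2 ω) 2 P).le

end WienerIntegrals

/-! ### Derivatives of the classical solution and its characteristics. -/

section ClassicalSolution

variable {T : ℝ} {d K : ℕ} {b : ℝ → (Fin d → ℝ) → Fin d → ℝ} {σ : ℝ → Fin d → ℝ}
  {ξ : Fin K → ℝ → ℝ} {c : Fin d → ℝ} {u : ℝ → (Fin K → Fin d → ℝ) → Fin d → ℝ}

/-- The total derivative of `(t, x) ↦ u t x` within `[0,T] × ℝ^{K×d}`. -/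
def totalDeriv (T : ℝ) (u : ℝ → (Fin K → Fin d → ℝ) → Fin d → ℝ)
    (p : ℝ × (Fin K → Fin d → ℝ)) : ℝ × (Fin K → Fin d → ℝ) →L[ℝ] (Fin d → ℝ) :=
  fderivWithin ℝ (fun p : ℝ × (Fin K → Fin d → ℝ) => u p.1 p.2) (Icc 0 T ×ˢ univ) p

lemma IsClassicalSolution.hasFDerivWithinAt (hu : IsClassicalSolution T b σ ξ c u)
    {t : ℝ} (ht : t ∈ Icc 0 T) (x : Fin K → Fin d → ℝ) :
    HasFDerivWithinAt (fun p : ℝ × (Fin K → Fin d → ℝ) => u p.1 p.2) (totalDeriv T u (t, x))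
      (Icc 0 T ×ˢ univ) (t, x) :=
  ((hu.contDiffOn.differentiableOn one_ne_zero) (t, x) ⟨ht, mem_univ _⟩).hasFDerivWithinAt

lemma IsClassicalSolution.continuousOn_totalDeriv (hT : 0 < T)
    (hu : IsClassicalSolution T b σ ξ c u) :
    ContinuousOn (totalDeriv T u) (Icc 0 T ×ˢ univ) :=
  hu.contDiffOn.continuousOn_fderivWithin
    ((uniqueDiffOn_Icc hT).prod uniqueDiffOn_univ) le_rfl

lemma IsClassicalSolution.hasFDerivAt (hu : IsClassicalSolution T b σ ξ c u)
    {t : ℝ} (ht : t ∈ Icc 0 T) (x : Fin K → Fin d → ℝ) :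
    HasFDerivAt (u t)
      ((totalDeriv T u (t, x)).comp (ContinuousLinearMap.inr ℝ ℝ (Fin K → Fin d → ℝ))) x := by
  have h := (hu.hasFDerivWithinAt ht x)
  have h2 : HasFDerivWithinAt (fun y : Fin K → Fin d → ℝ => (t, y))
      (ContinuousLinearMap.inr ℝ ℝ (Fin K → Fin d → ℝ)) univ x :=
    (hasFDerivAt_prodMk_right t x).hasFDerivWithinAt
  exact (HasFDerivWithinAt.comp x h h2 fun y _ => ⟨ht, mem_univ _⟩).hasFDerivAt univ_mem

lemma IsClassicalSolution.partialKI_eq (hu : IsClassicalSolution T b σ ξ c u)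
    {t : ℝ} (ht : t ∈ Icc 0 T) (x : Fin K → Fin d → ℝ) (k : Fin K) (i j : Fin d) :
    partialKI u k i j t x = totalDeriv T u (t, x) (0, Pi.single k (Pi.single i 1)) j := by
  have h := (hasFDerivAt_pi'.1 (hu.hasFDerivAt ht x)) j
  rw [partialKI, h.fderiv]
  simp

lemma IsClassicalSolution.hasDerivWithinAt_time (hu : IsClassicalSolution T b σ ξ c u)
    {t : ℝ} (ht : t ∈ Icc 0 T) (x : Fin K → Fin d → ℝ) (i : Fin d) :
    HasDerivWithinAt (fun s => u s x i) (totalDeriv T u (t, x) (1, 0) i) (Icc 0 T) t := by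
  have h := (hu.hasFDerivWithinAt ht x)
  have h2 : HasDerivWithinAt (fun s : ℝ => (s, x)) ((1 : ℝ), (0 : Fin K → Fin d → ℝ))
      (Icc 0 T) t := (hasDerivWithinAt_id t _).prodMk (hasDerivWithinAt_const t _ x)
  have hm : MapsTo (fun s : ℝ => (s, x)) (Icc 0 T) (Icc 0 T ×ˢ univ) :=
    fun s hs => ⟨hs, mem_univ _⟩
  exact (hasDerivWithinAt_pi.1 (h.comp_hasDerivWithinAt t h2 hm)) i

lemma IsClassicalSolution.continuousOn (hu : IsClassicalSolution T b σ ξ c u) :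
    ContinuousOn (fun p : ℝ × (Fin K → Fin d → ℝ) => u p.1 p.2) (Icc 0 T ×ˢ univ) :=
  hu.contDiffOn.continuousOn

lemma IsClassicalSolution.continuousOn_partialKI (hT : 0 < T)
    (hu : IsClassicalSolution T b σ ξ c u) (k : Fin K) (i j : Fin d) :
    ContinuousOn (fun p : ℝ × (Fin K → Fin d → ℝ) => partialKI u k i j p.1 p.2)
      (Icc 0 T ×ˢ univ) := by
  have h : ContinuousOn (fun p => totalDeriv T u p (0, Pi.single k (Pi.single i 1)) j)
      (Icc 0 T ×ˢ univ) :=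
    (continuous_apply j).comp_continuousOn
      ((hu.continuousOn_totalDeriv hT).clm_apply continuousOn_const)
  exact h.congr fun p hp => hu.partialKI_eq hp.1 p.2 k i j

lemma continuousOn_time_slice {X Y : Type*} [TopologicalSpace X] [TopologicalSpace Y]
    {f : ℝ × X → Y} {S : Set ℝ} (hf : ContinuousOn f (S ×ˢ univ)) (x : X) :
    ContinuousOn (fun t => f (t, x)) S :=
  hf.comp (Continuous.continuousOn (by fun_prop)) fun t ht => ⟨ht, mem_univ _⟩

/-- The drift along the characteristics, as a function of time and space. -/
lemma IsClassicalSolution.continuousOn_rhs (hT : 0 < T)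
    (hbσ : CoefficientAssumption T b σ) (hξ : ∀ k, ContinuousOn (ξ k) (Icc 0 T))
    (hu : IsClassicalSolution T b σ ξ c u) (i : Fin d) :
    ContinuousOn (fun p : ℝ × (Fin K → Fin d → ℝ) => b p.1 (u p.1 p.2) i +
        σ p.1 i * ∑ k, ξ k p.1 * (p.2 k i * u p.1 p.2 i - partialKI u k i i p.1 p.2))
      (Icc 0 T ×ˢ univ) := by
  have hfst : MapsTo (Prod.fst : ℝ × (Fin K → Fin d → ℝ) → ℝ) (Icc 0 T ×ˢ univ) (Icc 0 T) :=
    fun p hp => hp.1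
  have h1 : ContinuousOn (fun p : ℝ × (Fin K → Fin d → ℝ) => b p.1 (u p.1 p.2))
      (Icc 0 T ×ˢ univ) :=
    hbσ.b_continuous.comp (continuousOn_fst.prodMk hu.continuousOn)
      fun p hp => ⟨hp.1, mem_univ _⟩
  have h2 : ContinuousOn (fun p : ℝ × (Fin K → Fin d → ℝ) => σ p.1) (Icc 0 T ×ˢ univ) :=
    hbσ.σ_continuous.comp continuousOn_fst hfst
  refine ((continuous_apply i).comp_continuousOn h1).add
    (((continuous_apply i).comp_continuousOn h2).mul (continuousOn_finsetSum _ fun k _ => ?_))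
  refine ((hξ k).comp continuousOn_fst hfst).mul
    (ContinuousOn.sub (ContinuousOn.mul ?_ ?_) (hu.continuousOn_partialKI hT k i i))
  · exact Continuous.continuousOn (by fun_prop)
  · exact (continuous_apply i).comp_continuousOn hu.continuousOn

/-- On `]0,T]` this is uniqueness of derivatives within `[0,T]`. At `t = 0`, where the equation is
not assumed, it follows by continuity of both sides. -/
lemma IsClassicalSolution.totalDeriv_time (hT : 0 < T)
    (hbσ : CoefficientAssumption T b σ) (hξ : ∀ k, ContinuousOn (ξ k) (Icc 0 T))
    (hu : IsClassicalSolution T b σ ξ c u) {t : ℝ} (ht : t ∈ Icc 0 T)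
    (x : Fin K → Fin d → ℝ) (i : Fin d) :
    totalDeriv T u (t, x) (1, 0) i = b t (u t x) i +
        σ t i * ∑ k, ξ k t * (x k i * u t x i - partialKI u k i i t x) := by
  have h1 : ContinuousOn (fun t => totalDeriv T u (t, x) (1, 0) i) (Icc 0 T) :=
    (continuous_apply i).comp_continuousOn
      ((continuousOn_time_slice (hu.continuousOn_totalDeriv hT) x).clm_apply continuousOn_const)
  have h2 := continuousOn_time_slice (hu.continuousOn_rhs hT hbσ hξ i) x
  have he : EqOn (fun t => totalDeriv T u (t, x) (1, 0) i) (fun t => b t (u t x) i +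
        σ t i * ∑ k, ξ k t * (x k i * u t x i - partialKI u k i i t x)) (Ioc 0 T) := by
    intro s hs
    have hs' : s ∈ Icc 0 T := Ioc_subset_Icc_self hs
    exact (uniqueDiffOn_Icc hT s hs').eq_deriv _ (hu.hasDerivWithinAt_time hs' x i)
      (hu.equation s hs x i)
  exact he.of_subset_closure h1 h2 Ioc_subset_Icc_self
    (by rw [closure_Ioc hT.ne]) ht

/-- The direction of the characteristics of the `i`-th equation. -/
def charDir (σ : ℝ → Fin d → ℝ) (ξ : Fin K → ℝ → ℝ) (i : Fin d) (t : ℝ) : Fin K → Fin d → ℝ :=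
  fun k => Pi.single i (σ t i * ξ k t)

lemma charDir_eq_sum (σ : ℝ → Fin d → ℝ) (ξ : Fin K → ℝ → ℝ) (i : Fin d) (t : ℝ) :
    charDir σ ξ i t = ∑ k, (σ t i * ξ k t) • (Pi.single k (Pi.single i (1 : ℝ)) :
      Fin K → Fin d → ℝ) := by
  funext l m
  simp only [charDir, Finset.sum_apply, Pi.smul_apply, smul_eq_mul]
  rw [Finset.sum_eq_single l]
  · by_cases h : m = i
    · subst h; simp
    · simp [h]
  · intro k _ hk
    simp [Pi.single_eq_of_ne (Ne.symm hk)]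
  · simp

/-- Along the characteristics of the `i`-th equation the first order terms disappear. -/
lemma IsClassicalSolution.hasDerivWithinAt_characteristic (hT : 0 < T)
    (hbσ : CoefficientAssumption T b σ) (hξ : ∀ k, ContinuousOn (ξ k) (Icc 0 T))
    (hu : IsClassicalSolution T b σ ξ c u) (i : Fin d) {y : ℝ → Fin K → Fin d → ℝ} {t : ℝ}
    (ht : t ∈ Icc 0 T) (hy : HasDerivWithinAt y (charDir σ ξ i t) (Icc 0 T) t) :
    HasDerivWithinAt (fun s => u s (y s) i)
      (b t (u t (y t)) i + (∑ k, σ t i * ξ k t * y t k i) * u t (y t) i) (Icc 0 T) t := by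
  have h2 : HasDerivWithinAt (fun s : ℝ => (s, y s)) ((1 : ℝ), charDir σ ξ i t)
      (Icc 0 T) t := (hasDerivWithinAt_id t _).prodMk hy
  have hm : MapsTo (fun s : ℝ => (s, y s)) (Icc 0 T) (Icc 0 T ×ˢ univ) :=
    fun s hs => ⟨hs, mem_univ _⟩
  have h3 := (hasDerivWithinAt_pi.1
    ((hu.hasFDerivWithinAt ht (y t)).comp_hasDerivWithinAt t h2 hm)) i
  refine h3.congr_deriv ?_
  have e : ((1 : ℝ), charDir σ ξ i t) = (1, 0) + ∑ k, (σ t i * ξ k t) •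
      ((0 : ℝ), (Pi.single k (Pi.single i (1 : ℝ)) : Fin K → Fin d → ℝ)) := by
    rw [charDir_eq_sum]
    ext1
    · simp [Prod.fst_sum]
    · simp [Prod.snd_sum]
  rw [e, map_add, map_sum, Pi.add_apply, hu.totalDeriv_time hT hbσ hξ ht]
  simp only [map_smul, Finset.sum_apply, Pi.smul_apply, smul_eq_mul,
    ← hu.partialKI_eq ht, Finset.mul_sum, Finset.sum_mul]
  rw [add_assoc, ← Finset.sum_add_distrib]
  congr 1
  refine Finset.sum_congr rfl fun k _ => ?_
  ring

/-- Characteristics exist, and they travel with bounded speed. -/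
lemma exists_characteristic (hσ : ContinuousOn σ (Icc 0 T))
    (hξ : ∀ k, ContinuousOn (ξ k) (Icc 0 T)) {V : ℝ}
    (hV : ∀ t ∈ Icc (0 : ℝ) T, ∀ i, ‖charDir σ ξ i t‖ ≤ V) (i : Fin d) {t₀ : ℝ}
    (ht₀ : t₀ ∈ Icc 0 T) (x₀ : Fin K → Fin d → ℝ) :
    ∃ y : ℝ → Fin K → Fin d → ℝ, y t₀ = x₀ ∧
      (∀ t ∈ Icc (0 : ℝ) T, HasDerivWithinAt y (charDir σ ξ i t) (Icc 0 T) t) ∧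
      ∀ t ∈ Icc (0 : ℝ) T, ‖y t - x₀‖ ≤ V * |t - t₀| := by
  have hw : ContinuousOn (charDir σ ξ i) (Icc 0 T) := by
    refine continuousOn_pi.2 fun k => continuousOn_pi.2 fun l => ?_
    by_cases h : l = i
    · subst h
      simp only [charDir, Pi.single_eq_same]
      exact ((continuous_apply l).comp_continuousOn hσ).mul (hξ k)
    · simp only [charDir, Pi.single_eq_of_ne h]
      exact continuousOn_const
  -- The velocity does not depend on the position, so a characteristic is just a primitive of
  -- `charDir`.
  have hd : ∀ t ∈ Icc (0 : ℝ) T, HasDerivWithinAt (fun t => x₀ + ∫ r in t₀..t, charDir σ ξ i r)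
      (charDir σ ξ i t) (Icc 0 T) t := by
    intro t ht
    have := Fact.mk ht
    refine (intervalIntegral.integral_hasDerivWithinAt_right ?_ ?_ (hw t ht)).const_add x₀
    · exact (hw.mono (uIcc_subset_Icc ht₀ ht)).intervalIntegrable
    · exact hw.stronglyMeasurableAtFilter_nhdsWithin measurableSet_Icc t
  refine ⟨fun t => x₀ + ∫ r in t₀..t, charDir σ ξ i r, by simp, hd, fun t ht => ?_⟩
  simp only [add_sub_cancel_left]
  refine intervalIntegral.norm_integral_le_of_norm_le_const fun r hr => hV r ?_ i
  have := uIoc_subset_uIcc hr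
  exact (uIcc_subset_Icc ht₀ ht) this

end ClassicalSolution

/-! ### Exponential growth of the solution and of its gradient. -/

section Growth

variable {T : ℝ} {d K : ℕ} {b : ℝ → (Fin d → ℝ) → Fin d → ℝ} {σ : ℝ → Fin d → ℝ}
  {ξ : Fin K → ℝ → ℝ} {c : Fin d → ℝ} {u : ℝ → (Fin K → Fin d → ℝ) → Fin d → ℝ}

/-- A single constant bounds both the speed of the characteristics and the zeroth order coefficient
per unit of `‖y‖`, because both are built from the products `σ_i ξ_k`. -/
lemma exists_speed_bound (hbσ : CoefficientAssumption T b σ)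
    (hξ : ∀ k, ContinuousOn (ξ k) (Icc 0 T)) :
    ∃ V : ℝ, 0 ≤ V ∧ (∀ t ∈ Icc (0 : ℝ) T, ∀ i, ‖charDir σ ξ i t‖ ≤ V) ∧
      ∀ t ∈ Icc (0 : ℝ) T, ∀ i, ∀ y : Fin K → Fin d → ℝ,
        |∑ k, σ t i * ξ k t * y k i| ≤ V * ‖y‖ := by
  obtain ⟨S, hS⟩ := hbσ.σ_bounded
  choose X hX using fun k => isCompact_Icc.exists_bound_of_continuousOn (hξ k)
  have hle : ∀ t ∈ Icc (0 : ℝ) T, ∀ i k, |σ t i * ξ k t| ≤ |S| * |X k| := by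
    intro t ht i k
    rw [abs_mul]
    exact mul_le_mul (((norm_le_pi_norm (σ t) i).trans (hS t ht)).trans (le_abs_self S))
      ((hX k t ht).trans (le_abs_self _)) (abs_nonneg _) (abs_nonneg _)
  refine ⟨∑ k, |S| * |X k|, by positivity, fun t ht i => ?_, fun t ht i y => ?_⟩
  · refine (pi_norm_le_iff_of_nonneg (by positivity)).2 fun k => ?_
    rw [charDir, Pi.norm_single]
    exact (hle t ht i k).trans (Finset.single_le_sum (f := fun k => |S| * |X k|)
      (fun k _ => by positivity) (Finset.mem_univ k))
  · rw [Finset.sum_mul]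
    refine (Finset.abs_sum_le_sum_abs _ _).trans (Finset.sum_le_sum fun k _ => ?_)
    rw [abs_mul]
    have := (norm_le_pi_norm (y k) i).trans (norm_le_pi_norm y k)
    exact mul_le_mul (hle t ht i k) this (abs_nonneg _) (by positivity)

lemma hasDerivWithinAt_Ici_of_Icc {f : ℝ → ℝ} {f' T s : ℝ} (hs : s ∈ Ico 0 T)
    (h : HasDerivWithinAt f f' (Icc 0 T) s) : HasDerivWithinAt f f' (Ici s) s :=
  h.mono_of_mem_nhdsWithin (Icc_mem_nhdsGE_of_mem hs)

/-- The solution grows at most exponentially in `x`. -/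
lemma IsClassicalSolution.norm_le (hT : 0 < T) (hbσ : CoefficientAssumption T b σ)
    (hξ : ∀ k, ContinuousOn (ξ k) (Icc 0 T)) (hu : IsClassicalSolution T b σ ξ c u)
    {M V : ℝ} (hM : ∀ t ∈ Icc (0 : ℝ) T, ∀ x, ‖b t x‖ ≤ M) (hV0 : 0 ≤ V)
    (hV : ∀ t ∈ Icc (0 : ℝ) T, ∀ i, ‖charDir σ ξ i t‖ ≤ V)
    (hVs : ∀ t ∈ Icc (0 : ℝ) T, ∀ i, ∀ y : Fin K → Fin d → ℝ,
        |∑ k, σ t i * ξ k t * y k i| ≤ V * ‖y‖)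
    {t : ℝ} (ht : t ∈ Icc 0 T) (x : Fin K → Fin d → ℝ) :
    ‖u t x‖ ≤ (‖c‖ + M) * Real.exp ((V * (‖x‖ + V * T) + 1) * T) := by
  have hM0 : 0 ≤ M := (norm_nonneg _).trans (hM t ht 0)
  refine (pi_norm_le_iff_of_nonneg (by positivity)).2 fun i => ?_
  obtain ⟨y, hyt, hyd, hyb⟩ := exists_characteristic hbσ.σ_continuous hξ hV i ht x
  -- A characteristic ending at `x` stays within norm `‖x‖ + V T`, so `A` bounds the linear
  -- coefficient along it. The extra `1` makes `A` nonzero and gives `M / A ≤ M`. Since `b` is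
  -- bounded, each component can be estimated separately.
  set A : ℝ := V * (‖x‖ + V * T) + 1 with hA
  have hA1 : 1 ≤ A := by
    have : 0 ≤ V * (‖x‖ + V * T) := by positivity
    linarith
  clear_value A
  have hd := fun s (hs : s ∈ Icc 0 T) =>
    hu.hasDerivWithinAt_characteristic hT hbσ hξ i hs (hyd s hs)
  have hsub : Icc 0 t ⊆ Icc 0 T := Icc_subset_Icc_right ht.2
  have key := norm_le_gronwallBound_of_norm_deriv_right_le (f := fun s => u s (y s) i)
    (f' := fun s => b s (u s (y s)) i + (∑ k, σ s i * ξ k s * y s k i) * u s (y s) i)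
    (δ := ‖c‖) (K := A) (ε := M) (a := 0) (b := t)
    (fun s hs => ((hd s (hsub hs)).mono hsub).continuousWithinAt)
    (fun s hs => hasDerivWithinAt_Ici_of_Icc ⟨hs.1, hs.2.trans_le ht.2⟩
      (hd s (hsub (Ico_subset_Icc_self hs))))
    (by rw [hu.initial]; exact norm_le_pi_norm c i)
    (fun s hs => ?_) t ⟨ht.1, le_rfl⟩
  · rw [hyt, gronwallBound_of_K_ne_0 (by positivity)] at key
    refine key.trans ?_
    simp only [sub_zero]
    have e1 : Real.exp (A * t) ≤ Real.exp (A * T) := by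
      gcongr
      exact ht.2
    have e2 : M / A ≤ M := div_le_self hM0 hA1
    have e3 := Real.exp_pos (A * t)
    have e4 : M / A * (Real.exp (A * t) - 1) ≤ M * Real.exp (A * T) := by
      refine mul_le_mul e2 (by linarith) ?_ hM0
      have : 0 ≤ A * t := mul_nonneg (by linarith) ht.1
      linarith [Real.add_one_le_exp (A * t)]
    have e5 : ‖c‖ * Real.exp (A * t) ≤ ‖c‖ * Real.exp (A * T) := by gcongr
    rw [add_mul]
    linarith
  · have hs' : s ∈ Icc 0 T := hsub (Ico_subset_Icc_self hs)
    have hy : ‖y s‖ ≤ ‖x‖ + V * T := by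
      have h1 := hyb s hs'
      have h2 : |s - t| ≤ T := by
        rw [abs_le]; constructor <;> linarith [hs.1, hs.2, ht.1, ht.2]
      have h3 := norm_sub_norm_le (y s) x
      have h4 : V * |s - t| ≤ V * T := by gcongr
      linarith
    have h1 : ‖b s (u s (y s)) i‖ ≤ M := (norm_le_pi_norm _ i).trans (hM s hs' _)
    have h2 : ‖(∑ k, σ s i * ξ k s * y s k i) * u s (y s) i‖ ≤ A * ‖u s (y s) i‖ := by
      rw [norm_mul]
      gcongr
      refine (hVs s hs' i (y s)).trans ?_
      have : V * ‖y s‖ ≤ V * (‖x‖ + V * T) := by gcongr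
      linarith
    refine (norm_add_le _ _).trans ?_
    linarith

/-- Increments of the solution in the space variables. -/
lemma IsClassicalSolution.norm_sub_le (hT : 0 < T) (hbσ : CoefficientAssumption T b σ)
    (hξ : ∀ k, ContinuousOn (ξ k) (Icc 0 T)) (hu : IsClassicalSolution T b σ ξ c u)
    {L V U R : ℝ} (hL0 : 0 ≤ L)
    (hL : ∀ t ∈ Icc (0 : ℝ) T, ∀ x y, ‖b t x - b t y‖ ≤ L * ‖x - y‖) (hV0 : 0 ≤ V)
    (hV : ∀ t ∈ Icc (0 : ℝ) T, ∀ i, ‖charDir σ ξ i t‖ ≤ V)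
    (hVs : ∀ t ∈ Icc (0 : ℝ) T, ∀ i, ∀ y : Fin K → Fin d → ℝ,
        |∑ k, σ t i * ξ k t * y k i| ≤ V * ‖y‖)
    {t₀ : ℝ} (ht₀ : t₀ ∈ Icc 0 T) (x₀ h : Fin K → Fin d → ℝ) (hh : ‖h‖ ≤ 1)
    (hR : R = ‖x₀‖ + V * T + 1) (hU0 : 0 ≤ U)
    (hU : ∀ t ∈ Icc (0 : ℝ) T, ∀ x, ‖x‖ ≤ R → ‖u t x‖ ≤ U) :
    ‖u t₀ (x₀ + h) - u t₀ x₀‖ ≤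
      2 * V * U * T * Real.exp ((2 * (L + V * R) + 1) * T) * ‖h‖ := by
  have hR0 : 0 ≤ R := by rw [hR]; positivity
  set A : ℝ := L + V * R with hA
  have hA0 : 0 ≤ A := by positivity
  set l : ℝ := 2 * A + 1 with hl
  have hl0 : 0 < l := by positivity
  clear_value A l
  -- The increment of `b` couples components that have different characteristics, so a Gronwall
  -- bound along one curve does not close. The compact set `Q` is stable under following any of
  -- these characteristics backwards in time, which allows all components to be estimated by one
  -- maximum over `Q`.
  set Q : Set (ℝ × (Fin K → Fin d → ℝ)) :=
    {p | p.1 ∈ Icc 0 T ∧ ‖p.2 - x₀‖ ≤ V * (T - p.1)} with hQ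
  have hQc : IsCompact Q := by
    refine ((isCompact_Icc (a := (0 : ℝ)) (b := T)).prod
      (isCompact_closedBall x₀ (V * T))).of_isClosed_subset ?_ ?_
    · refine IsClosed.inter (isClosed_Icc.preimage continuous_fst) ?_
      have h1 : Continuous fun p : ℝ × (Fin K → Fin d → ℝ) => ‖p.2 - x₀‖ := by fun_prop
      have h2 : Continuous fun p : ℝ × (Fin K → Fin d → ℝ) => V * (T - p.1) := by fun_prop
      exact isClosed_le h1 h2
    · rintro ⟨t, x⟩ ⟨h1, h2⟩
      refine ⟨h1, ?_⟩
      rw [mem_closedBall_iff_norm]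
      refine h2.trans ?_
      have := h1.1
      gcongr
      simp only
      linarith
  -- The weight `exp (-l t)` with `l = 2 A + 1` makes the Lipschitz contribution at most half of the
  -- maximum `N`, so it can be absorbed.
  set f : ℝ × (Fin K → Fin d → ℝ) → ℝ :=
    fun p => ‖u p.1 (p.2 + h) - u p.1 p.2‖ * Real.exp (-l * p.1) with hf
  have hQs : Q ⊆ Icc 0 T ×ˢ univ := fun p hp => ⟨hp.1, mem_univ _⟩
  have hfc : ContinuousOn f Q := by
    have h1 : ContinuousOn (fun p : ℝ × (Fin K → Fin d → ℝ) => u p.1 (p.2 + h)) Q :=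
      hu.continuousOn.comp (f := fun p : ℝ × (Fin K → Fin d → ℝ) => (p.1, p.2 + h))
        (Continuous.continuousOn (by fun_prop)) fun p hp => ⟨hp.1, mem_univ _⟩
    exact (h1.sub (hu.continuousOn.mono hQs)).norm.mul (Continuous.continuousOn (by fun_prop))
  have h0Q : (t₀, x₀) ∈ Q := by
    refine ⟨ht₀, ?_⟩
    simp only [sub_self, norm_zero]
    exact mul_nonneg hV0 (by linarith [ht₀.2])
  obtain ⟨⟨t, x⟩, hpQ, hmax⟩ := hQc.exists_isMaxOn ⟨_, h0Q⟩ hfc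
  set N : ℝ := f (t, x) with hN
  have hN0 : 0 ≤ N := by simp only [hN, hf]; positivity
  have hle : ∀ p ∈ Q, ‖u p.1 (p.2 + h) - u p.1 p.2‖ ≤ N * Real.exp (l * p.1) := by
    intro p hp
    have h1 : f p ≤ N := hmax hp
    have h2 : ‖u p.1 (p.2 + h) - u p.1 p.2‖ = f p * Real.exp (l * p.1) := by
      simp only [hf]
      rw [mul_assoc, ← Real.exp_add]
      simp
    rw [h2]
    gcongr
  have ht : t ∈ Icc 0 T := hpQ.1
  have hsub : Icc 0 t ⊆ Icc 0 T := Icc_subset_Icc_right ht.2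
  have hstep : ∀ i, ‖u t (x + h) i - u t x i‖ ≤
      (N / 2 + V * ‖h‖ * U * T) * Real.exp (l * t) := by
    intro i
    obtain ⟨y, hyt, hyd, hyb⟩ := exists_characteristic hbσ.σ_continuous hξ hV i ht x
    have hyQ : ∀ s ∈ Icc 0 t, (s, y s) ∈ Q := by
      intro s hs
      refine ⟨hsub hs, ?_⟩
      have h1 := hyb s (hsub hs)
      rw [abs_of_nonpos (by linarith [hs.2])] at h1
      have h2 : ‖x - x₀‖ ≤ V * (T - t) := hpQ.2
      calc ‖y s - x₀‖ = ‖(y s - x) + (x - x₀)‖ := by congr 1; abel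
        _ ≤ ‖y s - x‖ + ‖x - x₀‖ := norm_add_le _ _
        _ ≤ V * -(s - t) + V * (T - t) := add_le_add h1 h2
        _ = V * (T - s) := by ring
    have hyR : ∀ s ∈ Icc 0 t, ‖y s‖ + 1 ≤ R := by
      intro s hs
      have h1 : ‖y s - x₀‖ ≤ V * (T - s) := (hyQ s hs).2
      have h2 := norm_sub_norm_le (y s) x₀
      have h3 : V * (T - s) ≤ V * T := by
        gcongr
        linarith [hs.1]
      rw [hR]
      linarith
    have hd1 := fun s (hs : s ∈ Icc 0 T) =>
      hu.hasDerivWithinAt_characteristic hT hbσ hξ i hs (hyd s hs)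
    have hd2 := fun s (hs : s ∈ Icc 0 T) =>
      hu.hasDerivWithinAt_characteristic hT hbσ hξ i hs ((hyd s hs).add_const h)
    -- The comparison function starts at zero, like the increment itself, because the initial value
    -- does not depend on `x`.
    have hB : ∀ s : ℝ, HasDerivAt (fun s => A * N * (Real.exp (l * s) - 1) / l + V * ‖h‖ * U * s)
        (A * N * Real.exp (l * s) + V * ‖h‖ * U) s := by
      intro s
      have h1 : HasDerivAt (fun s : ℝ => Real.exp (l * s)) (Real.exp (l * s) * (l * 1)) s :=
        ((hasDerivAt_id s).const_mul l).exp
      refine ((((h1.sub_const 1).const_mul (A * N)).div_const l).add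
        ((hasDerivAt_id s).const_mul (V * ‖h‖ * U))).congr_deriv ?_
      field_simp
    have key := image_norm_le_of_norm_deriv_right_le_deriv_boundary
      (f := fun s => u s (y s + h) i - u s (y s) i) (a := 0) (b := t)
      (f' := fun s => (b s (u s (y s + h)) i +
          (∑ k, σ s i * ξ k s * (y s + h) k i) * u s (y s + h) i)
        - (b s (u s (y s)) i + (∑ k, σ s i * ξ k s * y s k i) * u s (y s) i))
      (fun s hs => (((hd2 s (hsub hs)).sub (hd1 s (hsub hs))).mono hsub).continuousWithinAt)
      (fun s hs => hasDerivWithinAt_Ici_of_Icc ⟨hs.1, hs.2.trans_le ht.2⟩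
        ((hd2 s (hsub (Ico_subset_Icc_self hs))).sub (hd1 s (hsub (Ico_subset_Icc_self hs)))))
      (by simp [hu.initial]) hB (fun s hs => ?_) ⟨ht.1, le_rfl⟩
    · rw [hyt] at key
      refine key.trans ?_
      have h1 : A * N * (Real.exp (l * t) - 1) / l ≤ N / 2 * Real.exp (l * t) := by
        rw [div_le_iff₀ hl0, hl]
        have := Real.exp_pos ((2 * A + 1) * t)
        have : 0 ≤ A * N := by positivity
        nlinarith
      have h2 : V * ‖h‖ * U * t ≤ V * ‖h‖ * U * T * Real.exp (l * t) := by
        have e1 : V * ‖h‖ * U * t ≤ V * ‖h‖ * U * T := by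
          gcongr
          exact ht.2
        have e2 : (1 : ℝ) ≤ Real.exp (l * t) := Real.one_le_exp (mul_nonneg hl0.le ht.1)
        have e3 : 0 ≤ V * ‖h‖ * U * T := by positivity
        nlinarith
      rw [add_mul]
      linarith
    · have hs0 := Ico_subset_Icc_self hs
      have hs' : s ∈ Icc 0 T := hsub hs0
      have h1 := hle _ (hyQ s hs0)
      simp only at h1
      have h2 : ‖b s (u s (y s + h)) i - b s (u s (y s)) i‖ ≤ L * (N * Real.exp (l * s)) :=
        ((norm_le_pi_norm (b s (u s (y s + h)) - b s (u s (y s))) i).trans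
          (hL s hs' _ _)).trans (by gcongr)
      have h3 : ‖(∑ k, σ s i * ξ k s * (y s + h) k i) *
          (u s (y s + h) i - u s (y s) i)‖ ≤ V * R * (N * Real.exp (l * s)) := by
        rw [norm_mul]
        refine mul_le_mul ((hVs s hs' i _).trans ?_)
          ((norm_le_pi_norm (u s (y s + h) - u s (y s)) i).trans h1) (norm_nonneg _)
          (by positivity)
        gcongr
        have := norm_add_le (y s) h
        linarith [hyR s hs0]
      have h4 : ‖(∑ k, σ s i * ξ k s * h k i) * u s (y s) i‖ ≤ V * ‖h‖ * U := by
        rw [norm_mul]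
        refine mul_le_mul (hVs s hs' i _) ((norm_le_pi_norm _ i).trans
          (hU s hs' _ (by linarith [hyR s hs0]))) (norm_nonneg _) (by positivity)
      -- The first two terms are controlled by the increment of `u`, hence by `N`; the last is the
      -- only source term and is linear in `h`.
      have e : (b s (u s (y s + h)) i +
          (∑ k, σ s i * ξ k s * (y s + h) k i) * u s (y s + h) i)
        - (b s (u s (y s)) i + (∑ k, σ s i * ξ k s * y s k i) * u s (y s) i)
        = (b s (u s (y s + h)) i - b s (u s (y s)) i)
          + (∑ k, σ s i * ξ k s * (y s + h) k i) * (u s (y s + h) i - u s (y s) i)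
          + (∑ k, σ s i * ξ k s * h k i) * u s (y s) i := by
        have : ∑ k, σ s i * ξ k s * (y s + h) k i
            = ∑ k, σ s i * ξ k s * y s k i + ∑ k, σ s i * ξ k s * h k i := by
          rw [← Finset.sum_add_distrib]
          refine Finset.sum_congr rfl fun k _ => ?_
          simp only [Pi.add_apply]
          ring
        rw [this]
        ring
      rw [e]
      refine (norm_add₃_le).trans ?_
      rw [hA]
      linarith
  -- Evaluating the estimate at the maximum point gives `N ≤ 2 V ‖h‖ U T`.
  have hNle : N ≤ N / 2 + V * ‖h‖ * U * T := by
    have h1 : ‖u t (x + h) - u t x‖ ≤ (N / 2 + V * ‖h‖ * U * T) * Real.exp (l * t) :=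
      (pi_norm_le_iff_of_nonneg (by positivity)).2 hstep
    calc N = ‖u t (x + h) - u t x‖ * Real.exp (-l * t) := rfl
      _ ≤ (N / 2 + V * ‖h‖ * U * T) * Real.exp (l * t) * Real.exp (-l * t) := by gcongr
      _ = N / 2 + V * ‖h‖ * U * T := by
        rw [mul_assoc, ← Real.exp_add]
        simp
  have h1 := hle _ h0Q
  simp only at h1
  refine h1.trans ?_
  have e1 : Real.exp (l * t₀) ≤ Real.exp (l * T) := by
    gcongr
    exact ht₀.2
  calc N * Real.exp (l * t₀) ≤ (2 * V * U * T * ‖h‖) * Real.exp (l * T) := by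
        refine mul_le_mul ?_ e1 (Real.exp_pos _).le (by positivity)
        linarith
    _ = _ := by ring

/-- The first order space derivatives of the solution grow at most exponentially. -/
lemma IsClassicalSolution.exists_partialKI_le (hT : 0 < T) (hbσ : CoefficientAssumption T b σ)
    (hξ : ∀ k, ContinuousOn (ξ k) (Icc 0 T)) (hu : IsClassicalSolution T b σ ξ c u) :
    ∃ C : ℝ, 0 ≤ C ∧ ∀ t ∈ Icc (0 : ℝ) T, ∀ x k i j,
      |partialKI u k i j t x| ≤ C * Real.exp (C * ‖x‖) := by
  obtain ⟨M, hM⟩ := hbσ.b_bounded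
  obtain ⟨L, hL⟩ := hbσ.db_bounded
  obtain ⟨V, hV0, hV, hVs⟩ := exists_speed_bound hbσ hξ
  have hM0 : 0 ≤ M := (norm_nonneg _).trans (hM 0 ⟨le_rfl, hT.le⟩ 0)
  have hL0 : 0 ≤ L := (norm_nonneg _).trans (hL 0 ⟨le_rfl, hT.le⟩ 0)
  have hLip : ∀ t ∈ Icc (0 : ℝ) T, ∀ x y, ‖b t x - b t y‖ ≤ L * ‖x - y‖ := fun t ht x y =>
    convex_univ.norm_image_sub_le_of_norm_fderiv_le
      (fun z _ => hbσ.b_differentiable t ht z) (fun z _ => hL t ht z) (mem_univ y) (mem_univ x)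
  -- The exponents in the bounds for `u` and for its increments are affine in `‖x‖`. Here `a₁` and
  -- `a₂` are the constant parts, and `C₂` adds the slopes `V T` and `2 V T`.
  set a₁ : ℝ := (V * (V * T + 1 + V * T) + 1) * T with ha₁
  set a₂ : ℝ := (2 * (L + V * (V * T + 1)) + 1) * T with ha₂
  set C₁ : ℝ := 2 * V * ((‖c‖ + M) * Real.exp a₁) * T * Real.exp a₂ with hC₁
  set C₂ : ℝ := V * T + 2 * V * T with hC₂
  have hC₁0 : 0 ≤ C₁ := by positivity
  have hC₂0 : 0 ≤ C₂ := by positivity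
  refine ⟨max C₁ C₂, le_max_of_le_left hC₁0, fun t ht x k i j => ?_⟩
  have hbound : ∀ h : Fin K → Fin d → ℝ, ‖h‖ ≤ 1 →
      ‖u t (x + h) - u t x‖ ≤ C₁ * Real.exp (C₂ * ‖x‖) * ‖h‖ := by
    intro h hh
    refine (hu.norm_sub_le hT hbσ hξ hL0 hLip hV0 hV hVs ht x h hh rfl
      (U := (‖c‖ + M) * Real.exp ((V * ((‖x‖ + V * T + 1) + V * T) + 1) * T)) (by positivity)
      fun s hs z hz => (hu.norm_le hT hbσ hξ hM hV0 hV hVs hs z).trans ?_).trans_eq ?_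
    · gcongr
    · have e1 : (V * ((‖x‖ + V * T + 1) + V * T) + 1) * T = a₁ + V * T * ‖x‖ := by
        rw [ha₁]; ring
      have e2 : (2 * (L + V * (‖x‖ + V * T + 1)) + 1) * T = a₂ + 2 * V * T * ‖x‖ := by
        rw [ha₂]; ring
      rw [e1, e2, Real.exp_add, Real.exp_add, hC₁, hC₂, add_mul (V * T), Real.exp_add]
      ring
  -- A local Lipschitz bound at `x` controls the derivative there. Differentiating the system in `x`
  -- would require second derivatives of `u`.
  have hD := (hu.hasFDerivAt ht x).le_of_lip' (C := C₁ * Real.exp (C₂ * ‖x‖)) (by positivity) (by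
    filter_upwards [Metric.closedBall_mem_nhds x one_pos] with z hz
    have := hbound (z - x) (mem_closedBall_iff_norm.1 hz)
    simpa using this)
  have hle : ‖(totalDeriv T u (t, x)).comp (ContinuousLinearMap.inr ℝ ℝ (Fin K → Fin d → ℝ))
      (Pi.single k (Pi.single i 1))‖ ≤ C₁ * Real.exp (C₂ * ‖x‖) * 1 := by
    refine ContinuousLinearMap.le_of_opNorm_le_of_le _ hD ?_
    rw [Pi.norm_single, Pi.norm_single, norm_one]
  rw [hu.partialKI_eq ht]
  refine ((norm_le_pi_norm (totalDeriv T u (t, x) (0, Pi.single k (Pi.single i 1))) j).trans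
    hle).trans ?_
  rw [mul_one]
  gcongr
  · exact le_max_left _ _
  · exact le_max_right _ _

end Growth

/-! ### Conditional expectations jointly measurable in time and space. -/

section ConditionalExpectation

variable {Ω : Type*} [MeasurableSpace Ω] {P : Measure Ω} [IsProbabilityMeasure P]

/-- A version of `E[Y_t | X_t] = g(t, X_t)` which is jointly measurable in `(t, x)`. -/
lemma exists_measurable_condExp {E : Type*} [MeasurableSpace E]
    [MeasurableSpace.CountablyGenerated E] {X : ℝ → Ω → E} {Y : ℝ → Ω → ℝ}
    (hX : Measurable (Function.uncurry X)) (hY : Measurable (Function.uncurry Y)) :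
    ∃ g : ℝ → E → ℝ, Measurable (Function.uncurry g) ∧
      ∀ t, Integrable (Y t) P → (fun ω => g t (X t ω)) =ᵐ[P]
        P[Y t | MeasurableSpace.comap (X t) inferInstance] := by
  have hXt : ∀ t, Measurable (X t) := fun t => hX.comp (measurable_const.prodMk measurable_id)
  have hYt : ∀ t, Measurable (Y t) := fun t => hY.comp (measurable_const.prodMk measurable_id)
  have hXY : Measurable (fun p : ℝ × Ω => (X p.1 p.2, Y p.1 p.2)) := hX.prodMk hY
  -- The joint laws of `(X t, Y t)` form a kernel in `t`. Disintegrating the kernel, rather than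
  -- each law separately, yields measurability in `(t, x)`; at each `t` the result agrees almost
  -- everywhere with the usual conditional distribution.
  set κ : Kernel ℝ (E × ℝ) := Kernel.map (Kernel.id ×ₖ Kernel.const ℝ P)
    (fun p : ℝ × Ω => (X p.1 p.2, Y p.1 p.2)) with hκ
  have hκt : ∀ t, κ t = P.map (fun ω => (X t ω, Y t ω)) := by
    intro t
    rw [hκ, Kernel.map_apply _ hXY, Kernel.prod_apply, Kernel.id_apply,
      Kernel.const_apply, Measure.dirac_prod, Measure.map_map hXY (by fun_prop)]
    rfl
  have : IsMarkovKernel κ := Kernel.IsMarkovKernel.map _ hXY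
  refine ⟨fun t x => ∫ y, y ∂(Kernel.condKernel κ (t, x)), ?_, fun t hint => ?_⟩
  · exact (StronglyMeasurable.integral_kernel (κ := Kernel.condKernel κ)
      (f := fun y : ℝ => y) stronglyMeasurable_id).measurable
  · have h1 := condExp_ae_eq_integral_condDistrib' (hXt t) hint
    have h2 := Kernel.condKernel_apply_eq_condKernel κ t
    simp only [Kernel.fst_apply, hκt] at h2
    rw [← Measure.fst, Measure.fst_map_prodMk (hYt t)] at h2
    have h3 := ae_of_ae_map (hXt t).aemeasurable h2
    filter_upwards [h1, h3] with ω h1 h3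
    rw [h1, h3, condDistrib]

end ConditionalExpectation

/-! ### Gaussian matrices and functions of exponential growth. -/

section GaussianVector

variable {Ω : Type*} [MeasurableSpace Ω] {P : Measure Ω} {d K : ℕ}
  {z : Ω → Fin K → Fin d → ℝ}

/-- `z` is a matrix of independent standard Gaussian variables. -/
structure IsGaussianMatrix (P : Measure Ω) (z : Ω → Fin K → Fin d → ℝ) : Prop where
  measurable : Measurable z
  map_eq : P.map (fun ω (q : Fin K × Fin d) => z ω q.1 q.2) = gaussianPi (Fin K × Fin d)

lemma measurable_uncurry_pi :
    Measurable (fun (x : Fin K → Fin d → ℝ) (q : Fin K × Fin d) => x q.1 q.2) := by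
  fun_prop

lemma IsGaussianMatrix.integrable_exp (hz : IsGaussianMatrix P z) {C : ℝ} (hC : 0 ≤ C) :
    Integrable (fun ω => Real.exp (C * ‖z ω‖)) P := by
  have hm : Measurable (fun ω (q : Fin K × Fin d) => z ω q.1 q.2) :=
    measurable_uncurry_pi.comp hz.measurable
  have h := integrable_exp_mul_norm_gaussianPi (ι := Fin K × Fin d) hC
  rw [← hz.map_eq, integrable_map_measure (by fun_prop) hm.aemeasurable] at h
  have hzm := hz.measurable
  refine h.mono (by fun_prop) (Eventually.of_forall fun ω => ?_)
  simp only [Function.comp_apply]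
  rw [Real.norm_of_nonneg (Real.exp_pos _).le, Real.norm_of_nonneg (Real.exp_pos _).le]
  gcongr
  refine (pi_norm_le_iff_of_nonneg (norm_nonneg _)).2 fun k =>
    (pi_norm_le_iff_of_nonneg (norm_nonneg _)).2 fun i => ?_
  exact norm_le_pi_norm (fun q : Fin K × Fin d => z ω q.1 q.2) (k, i)

lemma IsGaussianMatrix.integrable_of_le (hz : IsGaussianMatrix P z)
    {F : (Fin K → Fin d → ℝ) → ℝ} (hF : Continuous F) {C : ℝ} (hC : 0 ≤ C)
    (hb : ∀ x, |F x| ≤ C * Real.exp (C * ‖x‖)) : Integrable (fun ω => F (z ω)) P :=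
  ((hz.integrable_exp hC).const_mul C).mono'
    (hF.comp_aestronglyMeasurable hz.measurable.aestronglyMeasurable)
    (Eventually.of_forall fun ω => hb (z ω))

/-- A coordinate is at most `exp ‖x‖`, so multiplying by it raises the exponential rate by one. -/
lemma abs_mul_le_exp {C : ℝ} {F : (Fin K → Fin d → ℝ) → ℝ}
    (hb : ∀ x, |F x| ≤ C * Real.exp (C * ‖x‖)) (k : Fin K) (i : Fin d)
    (x : Fin K → Fin d → ℝ) :
    |x k i * F x| ≤ (C + 1) * Real.exp ((C + 1) * ‖x‖) := by
  have h1 : |x k i| ≤ ‖x‖ := (norm_le_pi_norm (x k) i).trans (norm_le_pi_norm x k)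
  have h2 : ‖x‖ ≤ Real.exp ‖x‖ := by linarith [Real.add_one_le_exp ‖x‖]
  rw [abs_mul]
  calc |x k i| * |F x| ≤ Real.exp ‖x‖ * (C * Real.exp (C * ‖x‖)) :=
        mul_le_mul (h1.trans h2) (hb x) (abs_nonneg _) (Real.exp_pos _).le
    _ = C * Real.exp ((C + 1) * ‖x‖) := by
        rw [add_mul, Real.exp_add, one_mul]; ring
    _ ≤ _ := by gcongr; linarith

/-- Gaussian integration by parts for functions of exponential growth. -/
lemma IsGaussianMatrix.integral_mul (hz : IsGaussianMatrix P z)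
    {F : (Fin K → Fin d → ℝ) → ℝ} {DF : (Fin K → Fin d → ℝ) → (Fin K → Fin d → ℝ) →L[ℝ] ℝ}
    (hF : ∀ x, HasFDerivAt F (DF x) x) (k : Fin K) (i : Fin d)
    (hDF : Continuous fun x => DF x (Pi.single k (Pi.single i 1)))
    {C : ℝ} (hC : 0 ≤ C) (hb : ∀ x, |F x| ≤ C * Real.exp (C * ‖x‖))
    (hb' : ∀ x, |DF x (Pi.single k (Pi.single i 1))| ≤ C * Real.exp (C * ‖x‖)) :
    ∫ ω, z ω k i * F (z ω) ∂P = ∫ ω, DF (z ω) (Pi.single k (Pi.single i 1)) ∂P := by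
  have hm : Measurable (fun ω (q : Fin K × Fin d) => z ω q.1 q.2) :=
    measurable_uncurry_pi.comp hz.measurable
  have hFc : Continuous F := continuous_iff_continuousAt.2 fun x => (hF x).continuousAt
  -- Reshapes a vector indexed by pairs into a matrix, so that the product measure formula applies.
  set R : (Fin K × Fin d → ℝ) → Fin K → Fin d → ℝ := fun x k i => x (k, i) with hR
  have hRc : Continuous R := by fun_prop
  have tr : ∀ {G : (Fin K → Fin d → ℝ) → ℝ}, Continuous G →
      ∫ ω, G (z ω) ∂P = ∫ x, G (R x) ∂(gaussianPi (Fin K × Fin d)) := by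
    intro G hG
    have hGR : Continuous fun x => G (R x) := hG.comp hRc
    rw [← hz.map_eq, integral_map hm.aemeasurable hGR.aestronglyMeasurable]
  have ti : ∀ {G : (Fin K → Fin d → ℝ) → ℝ}, Continuous G → ∀ {C : ℝ}, 0 ≤ C →
      (∀ x, |G x| ≤ C * Real.exp (C * ‖x‖)) →
      Integrable (fun x => G (R x)) (gaussianPi (Fin K × Fin d)) := by
    intro G hG C hC hb
    have hGR : Continuous fun x => G (R x) := hG.comp hRc
    rw [← hz.map_eq, integrable_map_measure hGR.aestronglyMeasurable hm.aemeasurable]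
    exact hz.integrable_of_le hG hC hb
  have hxF : Continuous fun x : Fin K → Fin d → ℝ => x k i * F x :=
    Continuous.mul (by fun_prop) hFc
  rw [tr hxF, tr hDF]
  refine integral_mul_gaussianPi (k, i) (F := fun x => F (R x))
    (F' := fun x => DF (R x) (Pi.single k (Pi.single i 1))) (fun x y => ?_)
    (ti hFc hC hb) (ti hDF hC hb') (ti hxF (by linarith) (abs_mul_le_exp hb k i))
  have hd : HasDerivAt (fun y => R (Function.update x (k, i) y))
      (Pi.single k (Pi.single i 1)) y := by
    refine hasDerivAt_pi.2 fun l => hasDerivAt_pi.2 fun m => ?_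
    have h := hasDerivAt_pi.1 (hasDerivAt_update x (k, i) y) (l, m)
    refine h.congr_deriv ?_
    by_cases hl : l = k
    · subst hl
      by_cases hmi : m = i
      · subst hmi; simp
      · simp [hmi]
    · simp [hl]
  exact (hF _).comp_hasDerivAt y hd

end GaussianVector

/-! ### Regularity and support of the derivatives of test functions. -/

section TestFunctions

variable {d : ℕ} {ψ : ℝ → (Fin d → ℝ) → ℝ}

/-- Expressing the partial derivative through the full derivative in `(t,x)` gives joint regularity
and compact support. -/
lemma partialX_eq_fderiv {n : WithTop ℕ∞} (hn : 1 ≤ n)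
    (hψ : ContDiff ℝ n (fun p : ℝ × (Fin d → ℝ) => ψ p.1 p.2)) (i : Fin d) (t : ℝ)
    (x : Fin d → ℝ) :
    partialX i (ψ t) x
      = fderiv ℝ (fun p : ℝ × (Fin d → ℝ) => ψ p.1 p.2) (t, x) (0, Pi.single i 1) := by
  have h := (hψ.differentiable (by
    intro h0; rw [h0] at hn; exact absurd hn (by simp)) (t, x)).hasFDerivAt
  have h2 : HasFDerivAt (ψ t)
      ((fderiv ℝ (fun p : ℝ × (Fin d → ℝ) => ψ p.1 p.2) (t, x)).comp
        (ContinuousLinearMap.inr ℝ ℝ (Fin d → ℝ))) x :=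
    HasFDerivAt.comp x h (hasFDerivAt_prodMk_right t x)
  rw [partialX, h2.fderiv]
  simp

lemma deriv_eq_fderiv_time {n : WithTop ℕ∞} (hn : 1 ≤ n)
    (hψ : ContDiff ℝ n (fun p : ℝ × (Fin d → ℝ) => ψ p.1 p.2)) (t : ℝ)
    (x : Fin d → ℝ) :
    deriv (fun s => ψ s x) t
      = fderiv ℝ (fun p : ℝ × (Fin d → ℝ) => ψ p.1 p.2) (t, x) (1, 0) := by
  have h := (hψ.differentiable (by
    intro h0; rw [h0] at hn; exact absurd hn (by simp)) (t, x)).hasFDerivAt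
  have h2 : HasDerivAt (fun s : ℝ => (s, x)) ((1 : ℝ), (0 : Fin d → ℝ)) t :=
    (hasDerivAt_id t).prodMk (hasDerivAt_const t x)
  exact (h.comp_hasDerivAt t h2).deriv

lemma contDiff_partialX {n : WithTop ℕ∞}
    (hψ : ContDiff ℝ (n + 1) (fun p : ℝ × (Fin d → ℝ) => ψ p.1 p.2)) (i : Fin d) :
    ContDiff ℝ n (fun p : ℝ × (Fin d → ℝ) => partialX i (ψ p.1) p.2) := by
  simp only [partialX_eq_fderiv le_add_self hψ]
  exact (hψ.fderiv_right le_rfl).clm_apply contDiff_const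

lemma hasCompactSupport_partialX {n : WithTop ℕ∞} (hn : 1 ≤ n)
    (hψ : ContDiff ℝ n (fun p : ℝ × (Fin d → ℝ) => ψ p.1 p.2))
    (hc : HasCompactSupport (fun p : ℝ × (Fin d → ℝ) => ψ p.1 p.2)) (i : Fin d) :
    HasCompactSupport (fun p : ℝ × (Fin d → ℝ) => partialX i (ψ p.1) p.2) := by
  simp only [partialX_eq_fderiv hn hψ]
  exact hc.fderiv_apply ℝ _

lemma partialX_comm (hψ : ContDiff ℝ 2 (fun p : ℝ × (Fin d → ℝ) => ψ p.1 p.2)) (i j : Fin d)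
    (t : ℝ) (x : Fin d → ℝ) :
    partialX i (partialX j (ψ t)) x = partialX j (partialX i (ψ t)) x := by
  have h1 : ContDiff ℝ 2 (ψ t) := hψ.comp (contDiff_const.prodMk contDiff_id)
  have hs := h1.contDiffAt (x := x) |>.isSymmSndFDerivAt (by simp)
  have hd : DifferentiableAt ℝ (fderiv ℝ (ψ t)) x :=
    (h1.fderiv_right (m := 1) (by norm_num)).differentiable one_ne_zero x
  have e : ∀ i j : Fin d, partialX i (partialX j (ψ t)) x
      = fderiv ℝ (fderiv ℝ (ψ t)) x (Pi.single i 1) (Pi.single j 1) := by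
    intro i j
    have := hd.hasFDerivAt.clm_apply (hasFDerivAt_const (Pi.single j (1 : ℝ) : Fin d → ℝ) x)
    rw [partialX, show partialX j (ψ t) = fun y => fderiv ℝ (ψ t) y (Pi.single j 1) from rfl,
      this.fderiv]
    simp
  rw [e, e, hs]

end TestFunctions

/-! ### Calculus of bounded and exponentially growing functions. -/

section ExponentialGrowth

variable {T : ℝ} {d K : ℕ}

/-- `F` is bounded on `[0,T] × ℝ^{K×d}`. -/
def IsUniformlyBounded (T : ℝ) (F : ℝ → (Fin K → Fin d → ℝ) → ℝ) : Prop :=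
  ∃ M : ℝ, ∀ t ∈ Icc (0 : ℝ) T, ∀ x, |F t x| ≤ M

/-- `F` grows at most exponentially in `x`, uniformly in `t ∈ [0,T]`. -/
def HasExpGrowth (T : ℝ) (F : ℝ → (Fin K → Fin d → ℝ) → ℝ) : Prop :=
  ∃ C : ℝ, 0 ≤ C ∧ ∀ t ∈ Icc (0 : ℝ) T, ∀ x, |F t x| ≤ C * Real.exp (C * ‖x‖)

variable {F G : ℝ → (Fin K → Fin d → ℝ) → ℝ}

lemma IsUniformlyBounded.hasExpGrowth (h : IsUniformlyBounded T F) : HasExpGrowth T F := by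
  obtain ⟨M, hM⟩ := h
  refine ⟨|M|, abs_nonneg _, fun t ht x => (hM t ht x).trans ((le_abs_self M).trans ?_)⟩
  exact le_mul_of_one_le_right (abs_nonneg _) (Real.one_le_exp (by positivity))

lemma IsUniformlyBounded.mul (hF : IsUniformlyBounded T F) (hG : IsUniformlyBounded T G) :
    IsUniformlyBounded T (fun t x => F t x * G t x) := by
  obtain ⟨M, hM⟩ := hF
  obtain ⟨N, hN⟩ := hG
  refine ⟨M * N, fun t ht x => ?_⟩
  rw [abs_mul]
  exact mul_le_mul (hM t ht x) (hN t ht x) (abs_nonneg _) ((abs_nonneg _).trans (hM t ht x))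

lemma HasExpGrowth.add (hF : HasExpGrowth T F) (hG : HasExpGrowth T G) :
    HasExpGrowth T (fun t x => F t x + G t x) := by
  obtain ⟨A, hA0, hA⟩ := hF
  obtain ⟨B, hB0, hB⟩ := hG
  refine ⟨A + B, by positivity, fun t ht x => (abs_add_le _ _).trans ?_⟩
  rw [add_mul A B (Real.exp _)]
  refine add_le_add ((hA t ht x).trans ?_) ((hB t ht x).trans ?_) <;> gcongr <;> linarith

lemma HasExpGrowth.bdd_mul (hG : HasExpGrowth T G) (hF : IsUniformlyBounded T F) :
    HasExpGrowth T (fun t x => F t x * G t x) := by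
  obtain ⟨M, hM⟩ := hF
  obtain ⟨A, hA0, hA⟩ := hG
  refine ⟨max (|M| * A) A, le_max_of_le_right hA0, fun t ht x => ?_⟩
  rw [abs_mul]
  calc |F t x| * |G t x| ≤ |M| * (A * Real.exp (A * ‖x‖)) :=
        mul_le_mul ((hM t ht x).trans (le_abs_self _)) (hA t ht x) (abs_nonneg _) (abs_nonneg _)
    _ = |M| * A * Real.exp (A * ‖x‖) := by ring
    _ ≤ _ := by
      gcongr
      · exact le_max_left _ _
      · exact le_max_right _ _

lemma HasExpGrowth.neg (hG : HasExpGrowth T G) : HasExpGrowth T (fun t x => -G t x) := by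
  obtain ⟨A, hA0, hA⟩ := hG
  exact ⟨A, hA0, fun t ht x => by rw [abs_neg]; exact hA t ht x⟩

lemma HasExpGrowth.sub (hF : HasExpGrowth T F) (hG : HasExpGrowth T G) :
    HasExpGrowth T (fun t x => F t x - G t x) := by
  simpa [sub_eq_add_neg] using hF.add hG.neg

lemma HasExpGrowth.coord_mul (hF : HasExpGrowth T F) (k : Fin K) (i : Fin d) :
    HasExpGrowth T (fun t x => x k i * F t x) := by
  obtain ⟨A, hA0, hA⟩ := hF
  exact ⟨A + 1, by positivity, fun t ht x => abs_mul_le_exp (hA t ht) k i x⟩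

lemma HasExpGrowth.finset_sum {ι : Type*} (s : Finset ι)
    {F : ι → ℝ → (Fin K → Fin d → ℝ) → ℝ} (h : ∀ i ∈ s, HasExpGrowth T (F i)) :
    HasExpGrowth T (fun t x => ∑ i ∈ s, F i t x) := by
  classical
  induction s using Finset.induction_on with
  | empty => exact ⟨0, le_rfl, by simp⟩
  | insert a s ha ih =>
    simp only [Finset.sum_insert ha]
    exact (h a (by simp)).add (ih fun i hi => h i (by simp [hi]))

variable {Ω : Type*} [MeasurableSpace Ω] {P : Measure Ω} {z : Ω → Fin K → Fin d → ℝ}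

lemma HasExpGrowth.integrable (hF : HasExpGrowth T F) (hz : IsGaussianMatrix P z) {t : ℝ}
    (ht : t ∈ Icc 0 T) (hc : Continuous (F t)) : Integrable (fun ω => F t (z ω)) P := by
  obtain ⟨C, hC0, hC⟩ := hF
  exact hz.integrable_of_le hc hC0 (hC t ht)

lemma continuous_space_slice {X Y : Type*} [TopologicalSpace X] [TopologicalSpace Y]
    {f : ℝ × X → Y} {S : Set ℝ} (hf : ContinuousOn f (S ×ˢ univ)) {t : ℝ} (ht : t ∈ S) :
    Continuous (fun x => f (t, x)) := by
  rw [← continuousOn_univ]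
  exact hf.comp (Continuous.continuousOn (by fun_prop)) fun x _ => ⟨ht, mem_univ _⟩

/-- Clamping time to `[0,T]` turns continuity on the strip into global continuity, from which joint
measurability follows. -/
lemma continuous_projIcc_extend {X Y : Type*} [TopologicalSpace X] [TopologicalSpace Y]
    (hT : 0 ≤ T) {f : ℝ × X → Y} (hf : ContinuousOn f (Icc 0 T ×ˢ univ)) :
    Continuous (fun p : ℝ × X => f (projIcc 0 T hT p.1, p.2)) := by
  rw [← continuousOn_univ]
  refine hf.comp (Continuous.continuousOn ?_) fun p _ => ⟨(projIcc 0 T hT p.1).2, mem_univ _⟩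
  exact (continuous_subtype_val.comp (continuous_projIcc.comp continuous_fst)).prodMk
    continuous_snd

lemma ae_fst_mem_Icc [SFinite P] : ∀ᵐ p : ℝ × Ω ∂((volume.restrict (Icc 0 T)).prod P),
    p.1 ∈ Icc 0 T :=
  Measure.quasiMeasurePreserving_fst.ae (ae_restrict_mem measurableSet_Icc)

lemma aestronglyMeasurable_comp_prod [SFinite P] (hT : 0 ≤ T)
    (hz : Measurable z) (hF : ContinuousOn (Function.uncurry F) (Icc 0 T ×ˢ univ)) :
    AEStronglyMeasurable (fun p : ℝ × Ω => F p.1 (z p.2))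
      ((volume.restrict (Icc 0 T)).prod P) := by
  have h := continuous_projIcc_extend hT hF
  have hm : Measurable (fun p : ℝ × Ω => (p.1, z p.2)) :=
    measurable_fst.prodMk (hz.comp measurable_snd)
  refine (h.measurable.comp hm).aestronglyMeasurable.congr ?_
  filter_upwards [ae_fst_mem_Icc] with p hp
  simp [Function.uncurry, projIcc_of_mem hT hp]

end ExponentialGrowth

/-! ### Test functions along the solution and integration by parts in the noise. -/

section FokkerPlanck

variable {Ω : Type*} [MeasurableSpace Ω] {P : Measure Ω} {T : ℝ}
  {d K : ℕ} {b : ℝ → (Fin d → ℝ) → Fin d → ℝ} {σ : ℝ → Fin d → ℝ}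
  {ξ : Fin K → ℝ → ℝ} {c : Fin d → ℝ} {u : ℝ → (Fin K → Fin d → ℝ) → Fin d → ℝ}
  {z : Ω → Fin K → Fin d → ℝ} {ψ : ℝ → (Fin d → ℝ) → ℝ}

/-- A classical solution of the hyperbolic system together with a Gaussian matrix at which it is
evaluated. -/
structure IsModel (P : Measure Ω) (T : ℝ) (b : ℝ → (Fin d → ℝ) → Fin d → ℝ) (σ : ℝ → Fin d → ℝ)
    (ξ : Fin K → ℝ → ℝ) (c : Fin d → ℝ) (u : ℝ → (Fin K → Fin d → ℝ) → Fin d → ℝ)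
    (z : Ω → Fin K → Fin d → ℝ) : Prop where
  pos : 0 < T
  coeff : CoefficientAssumption T b σ
  continuous_xi : ∀ k, ContinuousOn (ξ k) (Icc 0 T)
  sol : IsClassicalSolution T b σ ξ c u
  gaussian : IsGaussianMatrix P z

/-- `C²` test functions with compact support. -/
structure IsTest (ψ : ℝ → (Fin d → ℝ) → ℝ) : Prop where
  contDiff : ContDiff ℝ 2 (fun p : ℝ × (Fin d → ℝ) => ψ p.1 p.2)
  compact : HasCompactSupport (fun p : ℝ × (Fin d → ℝ) => ψ p.1 p.2)

lemma IsTest.contDiff_partialX (h : IsTest ψ) (i : Fin d) :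
    ContDiff ℝ 1 (fun p : ℝ × (Fin d → ℝ) => partialX i (ψ p.1) p.2) :=
  WongZakaiFBM.contDiff_partialX (n := 1) (by simpa [one_add_one_eq_two] using h.contDiff) i

lemma IsTest.compact_partialX (h : IsTest ψ) (i : Fin d) :
    HasCompactSupport (fun p : ℝ × (Fin d → ℝ) => partialX i (ψ p.1) p.2) :=
  hasCompactSupport_partialX (by norm_num) h.contDiff h.compact i

lemma IsTest.continuous_partialX₂ (h : IsTest ψ) (i j : Fin d) :
    Continuous (fun p : ℝ × (Fin d → ℝ) => partialX i (partialX j (ψ p.1)) p.2) :=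
  (WongZakaiFBM.contDiff_partialX (n := 0) (ψ := fun t => partialX j (ψ t))
    (by simpa using h.contDiff_partialX j) i).continuous

lemma IsTest.compact_partialX₂ (h : IsTest ψ) (i j : Fin d) :
    HasCompactSupport (fun p : ℝ × (Fin d → ℝ) => partialX i (partialX j (ψ p.1)) p.2) :=
  hasCompactSupport_partialX (ψ := fun t => partialX j (ψ t)) le_rfl
    (h.contDiff_partialX j) (h.compact_partialX j) i

lemma IsTest.continuous_time (h : IsTest ψ) :
    Continuous (fun p : ℝ × (Fin d → ℝ) => deriv (fun s => ψ s p.2) p.1) := by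
  simp only [deriv_eq_fderiv_time (n := 2) (by norm_num) h.contDiff]
  exact (h.contDiff.continuous_fderiv (by norm_num)).clm_apply continuous_const

lemma IsTest.compact_time (h : IsTest ψ) :
    HasCompactSupport (fun p : ℝ × (Fin d → ℝ) => deriv (fun s => ψ s p.2) p.1) := by
  simp only [deriv_eq_fderiv_time (n := 2) (by norm_num) h.contDiff]
  exact h.compact.fderiv_apply ℝ _

namespace IsModel

section Composition

variable {Θ : ℝ × (Fin d → ℝ) → ℝ}

lemma continuousOn_comp (hM : IsModel P T b σ ξ c u z) (hΘ : ContinuousOn Θ (Icc 0 T ×ˢ univ)) :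
    ContinuousOn (Function.uncurry fun t x => Θ (t, u t x)) (Icc 0 T ×ˢ univ) :=
  hΘ.comp (continuousOn_fst.prodMk hM.sol.continuousOn) fun _ hp => ⟨hp.1, mem_univ _⟩

lemma isUniformlyBounded_fst {f : ℝ → ℝ} (hf : ContinuousOn f (Icc 0 T)) :
    IsUniformlyBounded T (fun t (_ : Fin K → Fin d → ℝ) => f t) := by
  obtain ⟨C, hC⟩ := isCompact_Icc.exists_bound_of_continuousOn hf
  exact ⟨C, fun t ht _ => hC t ht⟩

lemma isUniformlyBounded_comp (u : ℝ → (Fin K → Fin d → ℝ) → Fin d → ℝ) (T : ℝ)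
    (hc : Continuous Θ) (hs : HasCompactSupport Θ) :
    IsUniformlyBounded T (fun t x => Θ (t, u t x)) := by
  obtain ⟨C, hC⟩ := hs.exists_bound_of_continuous hc
  exact ⟨C, fun t _ x => hC (t, u t x)⟩

end Composition

lemma continuousOn_sigma_xi (hM : IsModel P T b σ ξ c u z) (i : Fin d) (k : Fin K) :
    ContinuousOn (fun t => σ t i * ξ k t) (Icc 0 T) :=
  ((continuous_apply i).comp_continuousOn hM.coeff.σ_continuous).mul (hM.continuous_xi k)

lemma hasExpGrowth_partialKI (hM : IsModel P T b σ ξ c u z) (k : Fin K) (i j : Fin d) :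
    HasExpGrowth T (partialKI u k i j) := by
  obtain ⟨C, hC0, hC⟩ := hM.sol.exists_partialKI_le hM.pos hM.coeff hM.continuous_xi
  exact ⟨C, hC0, fun t ht x => hC t ht x k i j⟩

lemma continuous_partialKI (hM : IsModel P T b σ ξ c u z) {t : ℝ} (ht : t ∈ Icc 0 T)
    (k : Fin K) (i j : Fin d) : Continuous (partialKI u k i j t) :=
  continuous_space_slice (hM.sol.continuousOn_partialKI hM.pos k i j) ht

lemma integrable_partialKI (hM : IsModel P T b σ ξ c u z) {t : ℝ} (ht : t ∈ Icc 0 T)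
    (k : Fin K) (i j : Fin d) : Integrable (fun ω => partialKI u k i j t (z ω)) P :=
  (hM.hasExpGrowth_partialKI k i j).integrable hM.gaussian ht (hM.continuous_partialKI ht k i j)

lemma continuous_sol (hM : IsModel P T b σ ξ c u z) {t : ℝ} (ht : t ∈ Icc 0 T) :
    Continuous (u t) :=
  continuous_space_slice hM.sol.continuousOn ht

lemma measurable_sol (hM : IsModel P T b σ ξ c u z) {t : ℝ} (ht : t ∈ Icc 0 T) :
    Measurable (fun ω => u t (z ω)) :=
  (hM.continuous_sol ht).measurable.comp hM.gaussian.measurable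

/-- The zeroth and first order part of the operator, along the solution. -/
def lowerOrder (b : ℝ → (Fin d → ℝ) → Fin d → ℝ) (u : ℝ → (Fin K → Fin d → ℝ) → Fin d → ℝ)
    (ψ : ℝ → (Fin d → ℝ) → ℝ) (t : ℝ) (x : Fin K → Fin d → ℝ) : ℝ :=
  deriv (fun s => ψ s (u t x)) t + ∑ i, b t (u t x) i * partialX i (ψ t) (u t x)

/-- The part of the second order coefficients which is a function of the solution. -/
def secondOrder (σ : ℝ → Fin d → ℝ) (ξ : Fin K → ℝ → ℝ) (ψ : ℝ → (Fin d → ℝ) → ℝ)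
    (i j : Fin d) (k : Fin K) (t : ℝ) (y : Fin d → ℝ) : ℝ :=
  σ t i * ξ k t * (y i * partialX i (partialX j (ψ t)) y)

/-- The time derivative of `ψ (t, u t x)`. -/
def totalTime (b : ℝ → (Fin d → ℝ) → Fin d → ℝ) (σ : ℝ → Fin d → ℝ) (ξ : Fin K → ℝ → ℝ)
    (u : ℝ → (Fin K → Fin d → ℝ) → Fin d → ℝ) (ψ : ℝ → (Fin d → ℝ) → ℝ) (t : ℝ)
    (x : Fin K → Fin d → ℝ) : ℝ :=
  deriv (fun s => ψ s (u t x)) t + ∑ i, (b t (u t x) i +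
      σ t i * ∑ k, ξ k t * (x k i * u t x i - partialKI u k i i t x)) *
    partialX i (ψ t) (u t x)

/-- The bracket has the form needed for Gaussian integration by parts: a coordinate times `u_i ∂_i
ψ`, minus the very term that the product rule will return. -/
lemma totalTime_eq (t : ℝ) (x : Fin K → Fin d → ℝ) :
    totalTime b σ ξ u ψ t x = lowerOrder b u ψ t x +
      ∑ i, ∑ k, σ t i * ξ k t * (x k i * (u t x i * partialX i (ψ t) (u t x))
        - partialX i (ψ t) (u t x) * partialKI u k i i t x) := by
  rw [totalTime, lowerOrder, add_assoc, ← Finset.sum_add_distrib]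
  congr 1
  refine Finset.sum_congr rfl fun i _ => ?_
  rw [add_mul, Finset.mul_sum, Finset.sum_mul]
  congr 1
  refine Finset.sum_congr rfl fun k _ => ?_
  ring

lemma isUniformlyBounded_drift (hM : IsModel P T b σ ξ c u z) (i : Fin d) :
    IsUniformlyBounded T (fun t x => b t (u t x) i) := by
  obtain ⟨M, hb⟩ := hM.coeff.b_bounded
  exact ⟨M, fun t ht x => (norm_le_pi_norm (b t (u t x)) i).trans (hb t ht _)⟩

lemma isUniformlyBounded_partialX (hψ : IsTest ψ) (u : ℝ → (Fin K → Fin d → ℝ) → Fin d → ℝ)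
    (T : ℝ) (i : Fin d) : IsUniformlyBounded T (fun t x => partialX i (ψ t) (u t x)) :=
  isUniformlyBounded_comp u T (hψ.contDiff_partialX i).continuous (hψ.compact_partialX i)

/-- Although `u` is unbounded, `y ↦ y_i ∂_i ψ` has compact support. -/
lemma isUniformlyBounded_mul_partialX (hψ : IsTest ψ)
    (u : ℝ → (Fin K → Fin d → ℝ) → Fin d → ℝ) (T : ℝ) (i : Fin d) :
    IsUniformlyBounded T (fun t x => u t x i * partialX i (ψ t) (u t x)) :=
  isUniformlyBounded_comp u T
    (Θ := fun p : ℝ × (Fin d → ℝ) => p.2 i * partialX i (ψ p.1) p.2)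
    (Continuous.mul (by fun_prop) (hψ.contDiff_partialX i).continuous)
    ((hψ.compact_partialX i).mul_left)

lemma isUniformlyBounded_mul_partialX₂ (hψ : IsTest ψ)
    (u : ℝ → (Fin K → Fin d → ℝ) → Fin d → ℝ) (T : ℝ) (i j : Fin d) :
    IsUniformlyBounded T
      (fun t x => u t x i * partialX i (partialX j (ψ t)) (u t x)) :=
  isUniformlyBounded_comp u T
    (Θ := fun p : ℝ × (Fin d → ℝ) => p.2 i * partialX i (partialX j (ψ p.1)) p.2)
    (Continuous.mul (by fun_prop) (hψ.continuous_partialX₂ i j))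
    ((hψ.compact_partialX₂ i j).mul_left)

lemma isUniformlyBounded_secondOrder (hM : IsModel P T b σ ξ c u z) (hψ : IsTest ψ)
    (i j : Fin d) (k : Fin K) :
    IsUniformlyBounded T (fun t x => secondOrder σ ξ ψ i j k t (u t x)) :=
  (isUniformlyBounded_fst (hM.continuousOn_sigma_xi i k)).mul
    (isUniformlyBounded_mul_partialX₂ hψ u T i j)

lemma continuousOn_secondOrder (hM : IsModel P T b σ ξ c u z) (hψ : IsTest ψ)
    (i j : Fin d) (k : Fin K) :
    ContinuousOn (fun p : ℝ × (Fin d → ℝ) => secondOrder σ ξ ψ i j k p.1 p.2)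
      (Icc 0 T ×ˢ univ) := by
  have h1 : ContinuousOn (fun p : ℝ × (Fin d → ℝ) => σ p.1 i * ξ k p.1) (Icc 0 T ×ˢ univ) :=
    (hM.continuousOn_sigma_xi i k).comp continuousOn_fst fun p hp => hp.1
  exact h1.mul (Continuous.continuousOn
    (Continuous.mul (by fun_prop) (hψ.continuous_partialX₂ i j)))

lemma continuousOn_lowerOrder (hM : IsModel P T b σ ξ c u z) (hψ : IsTest ψ) :
    ContinuousOn (Function.uncurry (lowerOrder b u ψ)) (Icc 0 T ×ˢ univ) := by
  have h : ContinuousOn (fun p : ℝ × (Fin d → ℝ) => deriv (fun s => ψ s p.2) p.1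
      + ∑ i, b p.1 p.2 i * partialX i (ψ p.1) p.2) (Icc 0 T ×ˢ univ) := by
    refine hψ.continuous_time.continuousOn.add (continuousOn_finsetSum _ fun i _ => ?_)
    exact ((continuous_apply i).comp_continuousOn hM.coeff.b_continuous).mul
      (hψ.contDiff_partialX i).continuous.continuousOn
  exact hM.continuousOn_comp h

lemma hasExpGrowth_lowerOrder (hM : IsModel P T b σ ξ c u z) (hψ : IsTest ψ) :
    HasExpGrowth T (lowerOrder b u ψ) :=
  (isUniformlyBounded_comp u T hψ.continuous_time hψ.compact_time).hasExpGrowth.add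
    (HasExpGrowth.finset_sum _ fun i _ =>
      ((hM.isUniformlyBounded_drift i).mul
        (isUniformlyBounded_partialX hψ u T i)).hasExpGrowth)

lemma continuous_lowerOrder (hM : IsModel P T b σ ξ c u z)
    (hψ : IsTest ψ) {t : ℝ}
    (ht : t ∈ Icc 0 T) : Continuous (lowerOrder b u ψ t) :=
  continuous_space_slice (hM.continuousOn_lowerOrder hψ) ht

lemma continuous_secondOrder (hM : IsModel P T b σ ξ c u z)
    (hψ : IsTest ψ) {t : ℝ}
    (ht : t ∈ Icc 0 T) (i j : Fin d) (k : Fin K) : Continuous (secondOrder σ ξ ψ i j k t) :=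
  continuous_space_slice (hM.continuousOn_secondOrder hψ i j k) ht

lemma hasExpGrowth_totalTime (hM : IsModel P T b σ ξ c u z) (hψ : IsTest ψ) :
    HasExpGrowth T (totalTime b σ ξ u ψ) := by
  have e : totalTime b σ ξ u ψ = fun t x => lowerOrder b u ψ t x +
      ∑ i, ∑ k, σ t i * ξ k t * (x k i * (u t x i * partialX i (ψ t) (u t x))
        - partialX i (ψ t) (u t x) * partialKI u k i i t x) := by
    funext t x
    exact totalTime_eq t x
  rw [e]
  refine (hM.hasExpGrowth_lowerOrder hψ).add (HasExpGrowth.finset_sum _ fun i _ =>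
    HasExpGrowth.finset_sum _ fun k _ => HasExpGrowth.bdd_mul (HasExpGrowth.sub ?_ ?_)
      (isUniformlyBounded_fst (hM.continuousOn_sigma_xi i k)))
  · exact (isUniformlyBounded_mul_partialX hψ u T i).hasExpGrowth.coord_mul k i
  · exact (hM.hasExpGrowth_partialKI k i i).bdd_mul (isUniformlyBounded_partialX hψ u T i)

lemma continuousOn_totalTime (hM : IsModel P T b σ ξ c u z) (hψ : IsTest ψ) :
    ContinuousOn (Function.uncurry (totalTime b σ ξ u ψ)) (Icc 0 T ×ˢ univ) := by
  refine (hM.continuousOn_comp hψ.continuous_time.continuousOn).add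
    (continuousOn_finsetSum _ fun i _ => ?_)
  exact (hM.sol.continuousOn_rhs hM.pos hM.coeff hM.continuous_xi i).mul
    (hM.continuousOn_comp (hψ.contDiff_partialX i).continuous.continuousOn)

lemma fderiv_eq_sum_partialX {f : (Fin d → ℝ) → ℝ} (y v : Fin d → ℝ) :
    fderiv ℝ f y v = ∑ j, v j * partialX j f y := by
  conv_lhs => rw [pi_eq_sum_univ' v, map_sum]
  refine Finset.sum_congr rfl fun j _ => ?_
  rw [map_smul, smul_eq_mul, partialX]

lemma hasDerivWithinAt_test (hM : IsModel P T b σ ξ c u z) (hψ : IsTest ψ) {t : ℝ}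
    (ht : t ∈ Icc 0 T) (x : Fin K → Fin d → ℝ) :
    HasDerivWithinAt (fun s => ψ s (u s x)) (totalTime b σ ξ u ψ t x) (Icc 0 T) t := by
  have h1 := (hψ.contDiff.differentiable (by norm_num) (t, u t x)).hasFDerivAt
  have h2 : HasDerivWithinAt (fun s => (s, u s x)) ((1 : ℝ), totalDeriv T u (t, x) (1, 0))
      (Icc 0 T) t :=
    (hasDerivWithinAt_id t _).prodMk
      (hasDerivWithinAt_pi.2 fun i => hM.sol.hasDerivWithinAt_time ht x i)
  have h3 := h1.comp_hasDerivWithinAt t h2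
  refine h3.congr_deriv ?_
  have e : ((1 : ℝ), totalDeriv T u (t, x) (1, 0)) = (1, 0) + ∑ i,
      (totalDeriv T u (t, x) (1, 0) i) • ((0 : ℝ), (Pi.single i (1 : ℝ) : Fin d → ℝ)) := by
    ext1
    · simp [Prod.fst_sum]
    · simp only [Prod.snd_add, Prod.snd_sum, Prod.smul_snd, zero_add]
      exact pi_eq_sum_univ' _
  rw [e, map_add, map_sum, totalTime, deriv_eq_fderiv_time (n := 2) (by norm_num) hψ.contDiff]
  congr 1
  refine Finset.sum_congr rfl fun i _ => ?_
  rw [map_smul, smul_eq_mul, partialX_eq_fderiv (n := 2) (by norm_num) hψ.contDiff,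
    hM.sol.totalDeriv_time hM.pos hM.coeff hM.continuous_xi ht]

/-- The fundamental theorem of calculus at a fixed value of the noise; both boundary terms vanish by
assumption on `ψ`. -/
lemma integral_totalTime_eq_zero (hM : IsModel P T b σ ξ c u z) (hψ : IsTest ψ)
    (h0 : ∀ x, ψ 0 x = 0) (h1 : ∀ x, ψ T x = 0) (x : Fin K → Fin d → ℝ) :
    ∫ t in (0 : ℝ)..T, totalTime b σ ξ u ψ t x = 0 := by
  have hT := hM.pos.le
  have hc := continuousOn_time_slice (hM.continuousOn_totalTime hψ) x
  have hd := fun t (ht : t ∈ Icc 0 T) => hM.hasDerivWithinAt_test hψ ht x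
  rw [intervalIntegral.integral_eq_sub_of_hasDeriv_right_of_le (f := fun s => ψ s (u s x)) hT
    (fun t ht => (hd t ht).continuousWithinAt) (fun t ht =>
      ((hd t (Ioo_subset_Icc_self ht)).hasDerivAt (Icc_mem_nhds ht.1 ht.2)).hasDerivWithinAt)
    (ContinuousOn.intervalIntegrable (by rw [uIcc_of_le hT]; exact hc))]
  simp [h0, h1]

lemma integral_integral_totalTime [IsProbabilityMeasure P] (hM : IsModel P T b σ ξ c u z) (hψ : IsTest ψ)
    (h0 : ∀ x, ψ 0 x = 0) (h1 : ∀ x, ψ T x = 0) :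
    ∫ t in (0 : ℝ)..T, ∫ ω, totalTime b σ ξ u ψ t (z ω) ∂P = 0 := by
  have hT := hM.pos.le
  obtain ⟨C, hC0, hC⟩ := hM.hasExpGrowth_totalTime hψ
  have hI : Integrable (fun p : ℝ × Ω => totalTime b σ ξ u ψ p.1 (z p.2))
      ((volume.restrict (Icc 0 T)).prod P) := by
    refine Integrable.mono'
      (((hM.gaussian.integrable_exp hC0).const_mul C).comp_snd (volume.restrict (Icc 0 T)))
      (aestronglyMeasurable_comp_prod hT hM.gaussian.measurable (hM.continuousOn_totalTime hψ)) ?_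
    filter_upwards [ae_fst_mem_Icc] with p hp using hC p.1 hp (z p.2)
  rw [intervalIntegral.integral_of_le hT, ← integral_Icc_eq_integral_Ioc,
    integral_integral_swap (f := fun t ω => totalTime b σ ξ u ψ t (z ω)) hI]
  refine integral_eq_zero_of_ae (Eventually.of_forall fun ω => ?_)
  simp only [Pi.zero_apply]
  rw [integral_Icc_eq_integral_Ioc, ← intervalIntegral.integral_of_le hT]
  exact hM.integral_totalTime_eq_zero hψ h0 h1 (z ω)

/-- Integration by parts in the noise variables. -/
lemma integral_coord_mul (hM : IsModel P T b σ ξ c u z) (hψ : IsTest ψ) {t : ℝ}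
    (ht : t ∈ Icc 0 T) (i : Fin d) (k : Fin K) :
    ∫ ω, z ω k i * (u t (z ω) i * partialX i (ψ t) (u t (z ω))) ∂P
      = ∫ ω, (partialX i (ψ t) (u t (z ω)) * partialKI u k i i t (z ω) +
        ∑ j, u t (z ω) i * partialX i (partialX j (ψ t)) (u t (z ω))
          * partialKI u k i j t (z ω)) ∂P := by
  set D : (Fin K → Fin d → ℝ) → (Fin K → Fin d → ℝ) →L[ℝ] (Fin d → ℝ) := fun x =>
    (totalDeriv T u (t, x)).comp (ContinuousLinearMap.inr ℝ ℝ (Fin K → Fin d → ℝ)) with hD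
  have hp : ContDiff ℝ 1 (partialX i (ψ t)) :=
    (hψ.contDiff_partialX i).comp (contDiff_const.prodMk contDiff_id)
  have hF : ∀ x, HasFDerivAt (fun x => u t x i * partialX i (ψ t) (u t x))
      (u t x i • (fderiv ℝ (partialX i (ψ t)) (u t x)).comp (D x) +
        partialX i (ψ t) (u t x) • (ContinuousLinearMap.proj i).comp (D x)) x := by
    intro x
    have h1 := hM.sol.hasFDerivAt ht x
    have h2 : HasFDerivAt (fun x => u t x i) ((ContinuousLinearMap.proj i).comp (D x)) x :=
      hasFDerivAt_pi'.1 h1 i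
    exact h2.mul ((hp.differentiable one_ne_zero (u t x)).hasFDerivAt.comp x h1)
  have hval : ∀ x, (u t x i • (fderiv ℝ (partialX i (ψ t)) (u t x)).comp (D x) +
        partialX i (ψ t) (u t x) • (ContinuousLinearMap.proj i).comp (D x))
          (Pi.single k (Pi.single i 1))
      = partialX i (ψ t) (u t x) * partialKI u k i i t x +
        ∑ j, u t x i * partialX i (partialX j (ψ t)) (u t x) * partialKI u k i j t x := by
    intro x
    have e : ∀ j, D x (Pi.single k (Pi.single i 1)) j = partialKI u k i j t x := fun j => by
      rw [hM.sol.partialKI_eq ht]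
      rfl
    simp only [add_apply, smul_apply,
      ContinuousLinearMap.comp_apply, ContinuousLinearMap.proj_apply, smul_eq_mul, e]
    rw [add_comm, fderiv_eq_sum_partialX, Finset.mul_sum]
    congr 1
    refine Finset.sum_congr rfl fun j _ => ?_
    -- The chain rule produces `∂_j ∂_i ψ`; the operator contains `∂_i ∂_j ψ`.
    rw [e, partialX_comm hψ.contDiff j i]
    ring
  have hgr : HasExpGrowth T (fun t x => partialX i (ψ t) (u t x) * partialKI u k i i t x +
        ∑ j, u t x i * partialX i (partialX j (ψ t)) (u t x) * partialKI u k i j t x) :=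
    ((hM.hasExpGrowth_partialKI k i i).bdd_mul (isUniformlyBounded_partialX hψ u T i)).add
      (HasExpGrowth.finset_sum _ fun j _ => (hM.hasExpGrowth_partialKI k i j).bdd_mul
        (isUniformlyBounded_mul_partialX₂ hψ u T i j))
  have hcu := hM.continuous_sol ht
  have hcont : Continuous (fun x => partialX i (ψ t) (u t x) * partialKI u k i i t x +
        ∑ j, u t x i * partialX i (partialX j (ψ t)) (u t x) * partialKI u k i j t x) := by
    refine ((hp.continuous.comp hcu).mul (hM.continuous_partialKI ht k i i)).add
      (continuous_finsetSum _ fun j _ => ?_)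
    refine Continuous.mul (Continuous.mul ((continuous_apply i).comp hcu) ?_)
      (hM.continuous_partialKI ht k i j)
    exact (hψ.continuous_partialX₂ i j).comp (continuous_const.prodMk hcu)
  obtain ⟨C₁, hC₁0, hC₁⟩ := hgr
  obtain ⟨C₂, hC₂0, hC₂⟩ := (isUniformlyBounded_mul_partialX hψ u T i).hasExpGrowth
  have hle : ∀ {C C' : ℝ}, 0 ≤ C → C ≤ C' → ∀ x : Fin K → Fin d → ℝ,
      C * Real.exp (C * ‖x‖) ≤ C' * Real.exp (C' * ‖x‖) := by
    intro C C' h0 h x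
    have := h0.trans h
    gcongr
  have key := hM.gaussian.integral_mul hF k i (by simpa only [hval] using hcont)
    (C := max C₁ C₂) (le_max_of_le_left hC₁0)
    (fun x => (hC₂ t ht x).trans (hle hC₂0 (le_max_right _ _) x))
    (fun x => by rw [hval]; exact (hC₁ t ht x).trans (hle hC₁0 (le_max_left _ _) x))
  simpa only [hval] using key

end IsModel
end FokkerPlanck

/-! ### Conditioning on the process and the Fokker–Planck equation. -/

section FokkerPlanck

variable {Ω : Type*} {T : ℝ}
  {d K : ℕ} {b : ℝ → (Fin d → ℝ) → Fin d → ℝ} {σ : ℝ → Fin d → ℝ}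
  {ξ : Fin K → ℝ → ℝ} {c : Fin d → ℝ} {u : ℝ → (Fin K → Fin d → ℝ) → Fin d → ℝ}
  {Z : Fin K → Fin d → Ω → ℝ} {ψ : ℝ → (Fin d → ℝ) → ℝ}
  {g : Fin d → Fin K → Fin d → ℝ → (Fin d → ℝ) → ℝ}

namespace IsModel

lemma parabolicOp_eq (t : ℝ) (ω : Ω) :
    parabolicOp (fun i j t x => ∑ k, σ t i * ξ k t * x i * g i k j t x) b ψ t
        (approxProcess u Z t ω)
      = lowerOrder b u ψ t (fun k i => Z k i ω) + ∑ i, ∑ j, ∑ k,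
        secondOrder σ ξ ψ i j k t (approxProcess u Z t ω) *
          g i k j t (approxProcess u Z t ω) := by
  rw [parabolicOp, lowerOrder, add_right_comm]
  congr 1
  refine Finset.sum_congr rfl fun i _ => Finset.sum_congr rfl fun j _ => ?_
  rw [Finset.sum_mul]
  refine Finset.sum_congr rfl fun k _ => ?_
  rw [secondOrder]
  ring

variable [MeasurableSpace Ω] {P : Measure Ω}

lemma measurable_parabolicOp (hM : IsModel P T b σ ξ c u (fun ω k i => Z k i ω))
    (hψ : IsTest ψ) (hg : IsCondDerivative P T u Z g) {t : ℝ} (ht : t ∈ Icc 0 T) :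
    Measurable (parabolicOp
      (fun i j t x => ∑ k, σ t i * ξ k t * x i * g i k j t x) b ψ t) := by
  have hg' : ∀ i k j, Measurable (g i k j t) := fun i k j =>
    (hg.measurable i k j).comp (measurable_const.prodMk measurable_id)
  have h1 : Measurable fun x => deriv (fun s => ψ s x) t :=
    (hψ.continuous_time.comp (Continuous.prodMk_right t)).measurable
  have h2 : ∀ i j, Measurable (partialX i (partialX j (ψ t))) := fun i j =>
    ((hψ.continuous_partialX₂ i j).comp (Continuous.prodMk_right t)).measurable
  have h3 : ∀ i, Measurable (partialX i (ψ t)) := fun i =>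
    ((hψ.contDiff_partialX i).continuous.comp (Continuous.prodMk_right t)).measurable
  have h4 : Measurable (b t) :=
    (continuous_space_slice hM.coeff.b_continuous ht).measurable
  unfold parabolicOp
  refine (h1.add ?_).add ?_
  · refine Finset.measurable_fun_sum _ fun i _ => Finset.measurable_fun_sum _ fun j _ =>
      Measurable.mul (Finset.measurable_fun_sum _ fun k _ => ?_) (h2 i j)
    exact ((measurable_pi_apply i).const_mul _).mul (hg' i k j)
  · exact Finset.measurable_fun_sum _ fun i _ =>
      ((measurable_pi_apply i).comp h4).mul (h3 i)

/-- Conditional expectation is a contraction in `L¹`. -/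
lemma integrable_condDerivative (hg : IsCondDerivative P T u Z g) {t : ℝ}
    (ht : t ∈ Icc 0 T) (i : Fin d) (k : Fin K) (j : Fin d) :
    Integrable (fun ω => g i k j t (approxProcess u Z t ω)) P ∧
      ∫ ω, |g i k j t (approxProcess u Z t ω)| ∂P
        ≤ ∫ ω, |partialKI u k i j t (fun l m => Z l m ω)| ∂P := by
  have h := hg.condExp_eq i k j t ht
  refine ⟨integrable_condExp.congr h.symm, ?_⟩
  have h' : (fun ω => |g i k j t (approxProcess u Z t ω)|) =ᵐ[P]
      fun ω => |(P[fun ω => partialKI u k i j t (fun l m => Z l m ω) |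
        MeasurableSpace.comap (approxProcess u Z t) inferInstance]) ω| :=
    h.fun_comp (fun x => |x|)
  rw [integral_congr_ae h']
  exact integral_abs_condExp_le _

lemma integrable_secondOrder_mul (hM : IsModel P T b σ ξ c u (fun ω k i => Z k i ω))
    (hψ : IsTest ψ) (hg : IsCondDerivative P T u Z g) {t : ℝ} (ht : t ∈ Icc 0 T)
    (i j : Fin d) (k : Fin K) :
    Integrable (fun ω => secondOrder σ ξ ψ i j k t (approxProcess u Z t ω) *
          g i k j t (approxProcess u Z t ω)) P := by
  obtain ⟨Q, hQ⟩ := hM.isUniformlyBounded_secondOrder hψ i j k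
  exact (integrable_condDerivative hg ht i k j).1.bdd_mul
    ((hM.continuous_secondOrder hψ ht i j k).measurable.comp
      (hM.measurable_sol ht)).aestronglyMeasurable (Eventually.of_forall fun ω => hQ t ht _)

lemma integrable_parabolicOp (hM : IsModel P T b σ ξ c u (fun ω k i => Z k i ω))
    (hψ : IsTest ψ) (hg : IsCondDerivative P T u Z g) {t : ℝ} (ht : t ∈ Icc 0 T) :
    Integrable (fun ω => parabolicOp (fun i j t x => ∑ k, σ t i * ξ k t * x i * g i k j t x) b ψ t
        (approxProcess u Z t ω)) P := by
  simp only [parabolicOp_eq]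
  exact ((hM.hasExpGrowth_lowerOrder hψ).integrable hM.gaussian ht
    (hM.continuous_lowerOrder hψ ht)).add
    (integrable_finsetSum _ fun i _ => integrable_finsetSum _ fun j _ =>
      integrable_finsetSum _ fun k _ => hM.integrable_secondOrder_mul hψ hg ht i j k)

/-- Uniformity in `t` is what makes the time integral absolutely convergent. It holds because the
growth constants are uniform on `[0,T]` and `g` is controlled in `L¹` by the gradient of `u`. -/
lemma integral_abs_parabolicOp_le (hM : IsModel P T b σ ξ c u (fun ω k i => Z k i ω))
    (hψ : IsTest ψ) (hg : IsCondDerivative P T u Z g) :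
    ∃ C : ℝ, ∀ t ∈ Icc (0 : ℝ) T, ∫ ω, |parabolicOp
      (fun i j t x => ∑ k, σ t i * ξ k t * x i * g i k j t x) b ψ t
        (approxProcess u Z t ω)| ∂P ≤ C := by
  have hE : ∀ {F : ℝ → (Fin K → Fin d → ℝ) → ℝ}, HasExpGrowth T F →
      (∀ t ∈ Icc (0 : ℝ) T, Continuous (F t)) →
      ∃ C : ℝ, ∀ t ∈ Icc (0 : ℝ) T, ∫ ω, |F t (fun k i => Z k i ω)| ∂P ≤ C := by
    intro F hF hc
    obtain ⟨C, hC0, hC⟩ := hF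
    refine ⟨∫ ω, C * Real.exp (C * ‖fun k i => Z k i ω‖) ∂P, fun t ht => ?_⟩
    refine integral_mono (HasExpGrowth.integrable ⟨C, hC0, hC⟩ hM.gaussian ht (hc t ht)).abs
      ((hM.gaussian.integrable_exp hC0).const_mul C) fun ω => hC t ht _
  obtain ⟨A, hA⟩ := hE (hM.hasExpGrowth_lowerOrder hψ) fun t ht => hM.continuous_lowerOrder hψ ht
  choose D hD using fun i j k => hE (hM.hasExpGrowth_partialKI k i j)
    fun t ht => hM.continuous_partialKI ht k i j
  choose Q hQ using fun i j k => hM.isUniformlyBounded_secondOrder hψ i j k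
  refine ⟨A + ∑ i, ∑ j, ∑ k, |Q i j k| * D i j k, fun t ht => ?_⟩
  have hI1 := (hM.hasExpGrowth_lowerOrder hψ).integrable hM.gaussian ht
    (hM.continuous_lowerOrder hψ ht)
  have hI2 := fun i j k => hM.integrable_secondOrder_mul hψ hg ht i j k
  have hI3 : Integrable (fun ω => ∑ i, ∑ j, ∑ k,
      |secondOrder σ ξ ψ i j k t (approxProcess u Z t ω) *
          g i k j t (approxProcess u Z t ω)|) P :=
    integrable_finsetSum _ fun i _ => integrable_finsetSum _ fun j _ =>
      integrable_finsetSum _ fun k _ => (hI2 i j k).abs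
  calc _ ≤ ∫ ω, (|lowerOrder b u ψ t (fun k i => Z k i ω)| + ∑ i, ∑ j, ∑ k,
        |secondOrder σ ξ ψ i j k t (approxProcess u Z t ω) *
          g i k j t (approxProcess u Z t ω)|) ∂P := by
        refine integral_mono (hM.integrable_parabolicOp hψ hg ht).abs (hI1.abs.add hI3)
          fun ω => ?_
        simp only [parabolicOp_eq]
        refine (abs_add_le _ _).trans (add_le_add le_rfl ?_)
        refine (Finset.abs_sum_le_sum_abs _ _).trans (Finset.sum_le_sum fun i _ => ?_)
        refine (Finset.abs_sum_le_sum_abs _ _).trans (Finset.sum_le_sum fun j _ => ?_)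
        exact Finset.abs_sum_le_sum_abs _ _
    _ ≤ _ := by
        rw [integral_add hI1.abs hI3, integral_finsetSum _ fun i _ =>
          integrable_finsetSum _ fun j _ => integrable_finsetSum _ fun k _ => (hI2 i j k).abs]
        refine add_le_add (hA t ht) (Finset.sum_le_sum fun i _ => ?_)
        rw [integral_finsetSum _ fun j _ => integrable_finsetSum _ fun k _ => (hI2 i j k).abs]
        refine Finset.sum_le_sum fun j _ => ?_
        rw [integral_finsetSum _ fun k _ => (hI2 i j k).abs]
        refine Finset.sum_le_sum fun k _ => ?_
        have h1 := integrable_condDerivative hg ht i k j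
        calc _ ≤ ∫ ω, |Q i j k| * |g i k j t (approxProcess u Z t ω)| ∂P := by
              refine integral_mono (hI2 i j k).abs (h1.1.abs.const_mul _) fun ω => ?_
              simp only
              rw [abs_mul]
              exact mul_le_mul_of_nonneg_right
                ((hQ i j k t ht (fun k i => Z k i ω)).trans (le_abs_self _)) (abs_nonneg _)
          _ ≤ |Q i j k| * D i j k := by
              rw [integral_const_mul]
              have := h1.2.trans (hD i j k t ht)
              gcongr

variable [IsProbabilityMeasure P]

lemma exists_isCondDerivative (hM : IsModel P T b σ ξ c u (fun ω k i => Z k i ω)) :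
    ∃ g, IsCondDerivative P T u Z g := by
  have hT := hM.pos.le
  have hzm : Measurable (fun p : ℝ × Ω => (p.1, fun k i => Z k i p.2)) :=
    measurable_fst.prodMk (hM.gaussian.measurable.comp measurable_snd)
  -- Nothing is known about `u` outside `[0,T]`, so time is clamped to obtain processes measurable
  -- on the whole line.
  have hX : Measurable (Function.uncurry fun (t : ℝ) (ω : Ω) =>
      u (projIcc 0 T hT t) (fun k i => Z k i ω)) :=
    (continuous_projIcc_extend hT hM.sol.continuousOn).measurable.comp hzm
  have hY : ∀ k i j, Measurable (Function.uncurry fun (t : ℝ) (ω : Ω) =>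
      partialKI u k i j (projIcc 0 T hT t) (fun k i => Z k i ω)) := fun k i j =>
    (continuous_projIcc_extend hT (hM.sol.continuousOn_partialKI hM.pos k i j)).measurable.comp hzm
  choose g hg hgc using fun k i j => exists_measurable_condExp (P := P) hX (hY k i j)
  refine ⟨fun i k j => g k i j, fun i k j => hg k i j, fun i k j t ht => ?_⟩
  have h := hgc k i j t
  simp only [projIcc_of_mem hT ht] at h
  exact h (hM.integrable_partialKI ht k i j)

/-- Bounded functions of the process may be pulled into the conditional expectation. -/
lemma integral_mul_condDerivative (hM : IsModel P T b σ ξ c u (fun ω k i => Z k i ω))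
    (hg : IsCondDerivative P T u Z g) {t : ℝ} (ht : t ∈ Icc 0 T) (i : Fin d) (k : Fin K)
    (j : Fin d) {h : (Fin d → ℝ) → ℝ} (hm : Measurable h) {C : ℝ}
    (hC : ∀ x, |h (u t x)| ≤ C) :
    ∫ ω, h (approxProcess u Z t ω) * g i k j t (approxProcess u Z t ω) ∂P
      = ∫ ω, h (approxProcess u Z t ω) * partialKI u k i j t (fun l m => Z l m ω) ∂P := by
  have hX : Measurable (approxProcess u Z t) := hM.measurable_sol ht
  have hle : MeasurableSpace.comap (approxProcess u Z t) inferInstance ≤ _ := hX.comap_le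
  have hs : StronglyMeasurable[MeasurableSpace.comap (approxProcess u Z t) inferInstance]
      (fun ω => h (approxProcess u Z t ω)) :=
    (hm.comp (comap_measurable _)).stronglyMeasurable
  have hI := hM.integrable_partialKI ht k i j
  have hI2 : Integrable (fun ω => h (approxProcess u Z t ω) *
      partialKI u k i j t (fun l m => Z l m ω)) P :=
    hI.bdd_mul (hm.comp hX).aestronglyMeasurable (Eventually.of_forall fun ω => hC _)
  have e := condExp_mul_of_stronglyMeasurable_left hs hI2 hI
  refine Eq.trans (integral_congr_ae ?_) (integral_condExp hle)
  filter_upwards [e, hg.condExp_eq i k j t ht] with ω h1 h2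
  rw [h2]
  exact h1.symm

/-- The core identity at a fixed time: Gaussian integration by parts trades the noise for second
derivatives of `ψ`, and conditioning on the process trades the derivatives of `u` for `g`. -/
lemma integral_totalTime_eq (hM : IsModel P T b σ ξ c u (fun ω k i => Z k i ω))
    (hψ : IsTest ψ) (hg : IsCondDerivative P T u Z g) {t : ℝ} (ht : t ∈ Icc 0 T) :
    ∫ ω, totalTime b σ ξ u ψ t (fun k i => Z k i ω) ∂P
      = ∫ ω, parabolicOp (fun i j t x => ∑ k, σ t i * ξ k t * x i * g i k j t x) b ψ t
        (approxProcess u Z t ω) ∂P := by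
  have hcu := hM.continuous_sol ht
  have hcp : ∀ i, Continuous fun x => partialX i (ψ t) (u t x) := fun i =>
    (hψ.contDiff_partialX i).continuous.comp (continuous_const.prodMk hcu)
  have hcui : ∀ i, Continuous fun x => u t x i := fun i => (continuous_apply i).comp hcu
  have hI1 := (hM.hasExpGrowth_lowerOrder hψ).integrable hM.gaussian ht
    (hM.continuous_lowerOrder hψ ht)
  have hI2 := fun i j k => hM.integrable_secondOrder_mul hψ hg ht i j k
  have hA : ∀ i k, Integrable (fun ω => Z k i ω * (u t (fun k i => Z k i ω) i *
      partialX i (ψ t) (u t (fun k i => Z k i ω)))) P := fun i k =>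
    ((isUniformlyBounded_mul_partialX hψ u T i).hasExpGrowth.coord_mul k i).integrable
      hM.gaussian ht (Continuous.mul (by fun_prop) ((hcui i).mul (hcp i)))
  have hB : ∀ i k, Integrable (fun ω => partialX i (ψ t) (u t (fun k i => Z k i ω)) *
      partialKI u k i i t (fun k i => Z k i ω)) P := fun i k =>
    ((hM.hasExpGrowth_partialKI k i i).bdd_mul
      (isUniformlyBounded_partialX hψ u T i)).integrable
      hM.gaussian ht ((hcp i).mul (hM.continuous_partialKI ht k i i))
  have hC : ∀ i j k, Integrable (fun ω => u t (fun k i => Z k i ω) i *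
      partialX i (partialX j (ψ t)) (u t (fun k i => Z k i ω)) *
      partialKI u k i j t (fun k i => Z k i ω)) P := fun i j k =>
    ((hM.hasExpGrowth_partialKI k i j).bdd_mul
      (isUniformlyBounded_mul_partialX₂ hψ u T i j)).integrable hM.gaussian ht
      (((hcui i).mul ((hψ.continuous_partialX₂ i j).comp (continuous_const.prodMk hcu))).mul
        (hM.continuous_partialKI ht k i j))
  have hS : ∀ i j k, ∫ ω, secondOrder σ ξ ψ i j k t (approxProcess u Z t ω) *
          g i k j t (approxProcess u Z t ω) ∂P
      = σ t i * ξ k t * ∫ ω, u t (fun k i => Z k i ω) i *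
      partialX i (partialX j (ψ t)) (u t (fun k i => Z k i ω)) *
      partialKI u k i j t (fun k i => Z k i ω) ∂P := by
    intro i j k
    obtain ⟨Q, hQ⟩ := hM.isUniformlyBounded_secondOrder hψ i j k
    rw [hM.integral_mul_condDerivative hg ht i k j
      (hM.continuous_secondOrder hψ ht i j k).measurable (hQ t ht), ← integral_const_mul]
    refine integral_congr_ae (Eventually.of_forall fun ω => ?_)
    simp only [secondOrder, approxProcess]
    ring
  have hAB : ∀ i k, Integrable (fun ω => σ t i * ξ k t * (Z k i ω * (u t (fun k i => Z k i ω) i *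
      partialX i (ψ t) (u t (fun k i => Z k i ω))) - partialX i (ψ t) (u t (fun k i => Z k i ω)) *
      partialKI u k i i t (fun k i => Z k i ω))) P := fun i k =>
    ((hA i k).sub (hB i k)).const_mul _
  simp only [parabolicOp_eq, totalTime_eq]
  rw [integral_add hI1 (integrable_finsetSum _ fun i _ => integrable_finsetSum _ fun k _ =>
      hAB i k),
    integral_add hI1 (integrable_finsetSum _ fun i _ => integrable_finsetSum _ fun j _ =>
      integrable_finsetSum _ fun k _ => hI2 i j k),
    integral_finsetSum _ fun i _ => integrable_finsetSum _ fun k _ =>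
      hAB i k,
    integral_finsetSum _ fun i _ => integrable_finsetSum _ fun j _ =>
      integrable_finsetSum _ fun k _ => hI2 i j k]
  congr 1
  refine Finset.sum_congr rfl fun i _ => ?_
  rw [integral_finsetSum _ fun k _ => hAB i k,
    integral_finsetSum _ fun j _ => integrable_finsetSum _ fun k _ => hI2 i j k]
  have e : ∀ j, ∫ ω, ∑ k, secondOrder σ ξ ψ i j k t (approxProcess u Z t ω) *
          g i k j t (approxProcess u Z t ω) ∂P = ∑ k, σ t i * ξ k t * ∫ ω,
      u t (fun k i => Z k i ω) i * partialX i (partialX j (ψ t)) (u t (fun k i => Z k i ω)) *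
      partialKI u k i j t (fun k i => Z k i ω) ∂P := by
    intro j
    rw [integral_finsetSum _ fun k _ => hI2 i j k]
    exact Finset.sum_congr rfl fun k _ => hS i j k
  simp only [e]
  rw [Finset.sum_comm]
  refine Finset.sum_congr rfl fun k _ => ?_
  -- Integration by parts returns `∂_i ψ ∂_{ki} u_i`, which cancels the subtracted integral and
  -- leaves the sum over `j`.
  rw [integral_const_mul, integral_sub (hA i k) (hB i k), hM.integral_coord_mul hψ ht i k,
    integral_add (hB i k) (integrable_finsetSum _ fun j _ => hC i j k),
    integral_finsetSum _ fun j _ => hC i j k, add_sub_cancel_left, Finset.mul_sum]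

/-- The joint measurability of `g` in `(t,x)` enters here; it makes the expectation measurable as a
function of time. -/
lemma aestronglyMeasurable_parabolicOp (hM : IsModel P T b σ ξ c u (fun ω k i => Z k i ω))
    (hψ : IsTest ψ) (hg : IsCondDerivative P T u Z g) :
    AEStronglyMeasurable (fun p : ℝ × Ω => parabolicOp
      (fun i j t x => ∑ k, σ t i * ξ k t * x i * g i k j t x) b ψ p.1
        (approxProcess u Z p.1 p.2)) ((volume.restrict (Icc 0 T)).prod P) := by
  have hT := hM.pos.le
  have hzm : Measurable (fun p : ℝ × Ω => (p.1, fun k i => Z k i p.2)) :=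
    measurable_fst.prodMk (hM.gaussian.measurable.comp measurable_snd)
  have hX : Measurable (fun p : ℝ × Ω => (p.1, u (projIcc 0 T hT p.1) (fun k i => Z k i p.2))) :=
    measurable_fst.prodMk
      ((continuous_projIcc_extend hT hM.sol.continuousOn).measurable.comp hzm)
  simp only [parabolicOp_eq]
  refine (aestronglyMeasurable_comp_prod hT hM.gaussian.measurable
    (hM.continuousOn_lowerOrder hψ)).add ?_
  refine Finset.aestronglyMeasurable_fun_sum _ fun i _ =>
    Finset.aestronglyMeasurable_fun_sum _ fun j _ =>
    Finset.aestronglyMeasurable_fun_sum _ fun k _ => ?_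
  refine AEStronglyMeasurable.mul ?_ ?_
  · exact aestronglyMeasurable_comp_prod
      (F := fun t x => secondOrder σ ξ ψ i j k t (u t x)) hT hM.gaussian.measurable
      (hM.continuousOn_comp (hM.continuousOn_secondOrder hψ i j k))
  · refine ((hg.measurable i k j).comp hX).aestronglyMeasurable.congr ?_
    filter_upwards [ae_fst_mem_Icc] with p hp
    simp [approxProcess, projIcc_of_mem hT hp]

/-- The law of the solution evaluated at the Gaussian matrix solves a Fokker–Planck equation. -/
lemma solvesFokkerPlanck (hM : IsModel P T b σ ξ c u (fun ω k i => Z k i ω))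
    (hg : IsCondDerivative P T u Z g) :
    SolvesFokkerPlanck T (fun i j t x => ∑ k, σ t i * ξ k t * x i * g i k j t x) b
      (fun t => P.map (approxProcess u Z t)) := by
  intro ψ hψ₂ hψc h0 h1
  have hψ : IsTest ψ := ⟨hψ₂, hψc⟩
  have hT := hM.pos.le
  have hX : ∀ t ∈ Icc (0 : ℝ) T, Measurable (approxProcess u Z t) :=
    fun t ht => hM.measurable_sol ht
  have hm := fun t (ht : t ∈ Icc (0 : ℝ) T) => hM.measurable_parabolicOp hψ hg ht
  have hJ := hM.aestronglyMeasurable_parabolicOp hψ hg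
  obtain ⟨C, hC⟩ := hM.integral_abs_parabolicOp_le hψ hg
  have e1 : ∀ t ∈ Icc (0 : ℝ) T, ∫ x, |parabolicOp
      (fun i j t x => ∑ k, σ t i * ξ k t * x i * g i k j t x) b ψ t x|
      ∂(P.map (approxProcess u Z t)) = ∫ ω, |parabolicOp
      (fun i j t x => ∑ k, σ t i * ξ k t * x i * g i k j t x) b ψ t
        (approxProcess u Z t ω)| ∂P := fun t ht =>
    integral_map (hX t ht).aemeasurable (hm t ht).abs.aestronglyMeasurable
  have e2 : ∀ t ∈ Icc (0 : ℝ) T, ∫ x, parabolicOp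
      (fun i j t x => ∑ k, σ t i * ξ k t * x i * g i k j t x) b ψ t x
      ∂(P.map (approxProcess u Z t)) = ∫ ω, parabolicOp
      (fun i j t x => ∑ k, σ t i * ξ k t * x i * g i k j t x) b ψ t
        (approxProcess u Z t ω) ∂P := fun t ht =>
    integral_map (hX t ht).aemeasurable (hm t ht).aestronglyMeasurable
  refine ⟨fun t ht => ?_, ?_, ?_, ?_⟩
  · exact (integrable_map_measure (hm t ht).aestronglyMeasurable (hX t ht).aemeasurable).2
      (hM.integrable_parabolicOp hψ hg ht)
  · refine IntegrableOn.congr_fun ?_ (fun t ht => (e1 t ht).symm) measurableSet_Icc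
    refine Integrable.of_bound (C := C) hJ.norm.integral_prod_right' ?_
    filter_upwards [ae_restrict_mem measurableSet_Icc] with t ht
    rw [Real.norm_of_nonneg (integral_nonneg fun _ => abs_nonneg _)]
    exact hC t ht
  · refine IntegrableOn.congr_fun ?_ (fun t ht => (e2 t ht).symm) measurableSet_Icc
    refine Integrable.of_bound (C := C) hJ.integral_prod_right' ?_
    filter_upwards [ae_restrict_mem measurableSet_Icc] with t ht
    exact (norm_integral_le_integral_norm _).trans (hC t ht)
  -- At each time the spatial integral equals the expected time derivative of `ψ(t, X(t))`, whose
  -- integral over `[0,T]` is zero.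
  · refine Eq.trans (intervalIntegral.integral_congr
      (g := fun t => ∫ ω, totalTime b σ ξ u ψ t (fun k i => Z k i ω) ∂P) fun t ht => ?_)
      (hM.integral_integral_totalTime hψ h0 h1)
    rw [uIcc_of_le hT] at ht
    simp only
    rw [e2 t ht, hM.integral_totalTime_eq hψ hg ht]

end IsModel
end FokkerPlanck

end WongZakaiFBM

end

theorem theorem2 {Ω : Type*} [MeasurableSpace Ω] (P : MeasureTheory.Measure Ω)
    [MeasureTheory.IsProbabilityMeasure P]
    (T H : ℝ) (hT : 0 < T) (hH : H ∈ Set.Ioo (1 / 2 : ℝ) 1) (d K : ℕ)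
    (B : ℝ → Ω → Fin d → ℝ) (hB : WongZakaiFBM.IsFractionalBrownianMotion P T H d B)
    (e : Fin K → ℝ → ℝ) (he : ∀ k, WongZakaiFBM.MemHPhi T H (e k))
    (he_orthonormal : ∀ k l, WongZakaiFBM.innerPhi T H (e k) (e l) = if k = l then 1 else 0)
    (hξ : ∀ k, ContinuousOn (WongZakaiFBM.PhiMap T H (e k)) (Set.Icc 0 T))
    (b : ℝ → (Fin d → ℝ) → Fin d → ℝ) (σ : ℝ → Fin d → ℝ)
    (hbσ : WongZakaiFBM.CoefficientAssumption T b σ) (c : Fin d → ℝ)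
    (Z : Fin K → Fin d → Ω → ℝ)
    (hZ : ∀ k i, WongZakaiFBM.IsWienerIntegral P T H (fun t ω => B t ω i) (e k) (Z k i))
    (u : ℝ → (Fin K → Fin d → ℝ) → Fin d → ℝ)
    (hu : WongZakaiFBM.IsClassicalSolution T b σ
      (fun k => WongZakaiFBM.PhiMap T H (e k)) c u) :
    (∀ i k j, ∀ t ∈ Set.Icc (0 : ℝ) T,
      MeasureTheory.Integrable
        (fun ω => WongZakaiFBM.partialKI u k i j t (fun l m => Z l m ω)) P) ∧
    (∃ g, WongZakaiFBM.IsCondDerivative P T u Z g) ∧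
    ∀ g, WongZakaiFBM.IsCondDerivative P T u Z g →
      WongZakaiFBM.SolvesFokkerPlanck T
        (fun i j t x => ∑ k, σ t i * WongZakaiFBM.PhiMap T H (e k) t * x i * g i k j t x)
        b
        (fun t => P.map (WongZakaiFBM.approxProcess u Z t)) := by
  have hM : WongZakaiFBM.IsModel P T b σ (fun k => WongZakaiFBM.PhiMap T H (e k)) c u
      (fun ω k i => Z k i ω) :=
    { pos := hT
      coeff := hbσ
      continuous_xi := hξ
      sol := hu
      gaussian :=
        { measurable := measurable_pi_lambda _ fun k => measurable_pi_lambda _ fun i =>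
            (hZ k i).measurable
          map_eq := WongZakaiFBM.map_wienerIntegrals_eq_gaussianPi hT.le hH hB
            he_orthonormal hZ } }
  exact ⟨fun i k j t ht => hM.integrable_partialKI ht k i j, hM.exists_isCondDerivative,
    fun g hg => hM.solvesFokkerPlanck hg⟩
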